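/- Write $\mathbb C\{x,y\}$ for the ring of germs of holomorphic functions at $0\in\mathbb C^2$. Let $S$ be a (reduced, non-empty) germ of curve in $(\mathbb C^2,0)$ with irreducible components $S_1,\dots,S_k$, and let $\sigma:(\mathcal M,\mathcal D)\to(\mathbb C^2,0)$, $\mathcal D=\sigma^{-1}(0)$, be a composition of finitely many (possibly no) blowing-ups at points over the origin such that all the strict transforms $\tilde S_i=\sigma^*S_i=\overline{\sigma^{-1}(S_i)\setminus\mathcal D}$ are smooth. For a smooth curve germ $C$ at a point $p$, let $\mathfrak m^n(C)$ be the set of germs of holomorphic functions on $C$ whose vanishing order at $p$ is at least $n$. A desingularization map of a curve germ $S$ is a composition $\pi$ of finitely many (possibly no) blowing-ups at points over the origin such that the union of the strict transform of $S$ by $\pi$ and of the exceptional divisor $\pi^{-1}(0)$ has only normal crossings (at every point of $\pi^{-1}(0)$ this union is, in suitable holomorphic coordinates $(u,v)$ centred at the point, $\{u=0\}$ or $\{uv=0\}$); the singularities of $S$ after $\pi$ are the points of $\pi^{-1}(0)$ at which this union is not smooth. Let $\Sigma(S)$ be the set of all (reduced, non-empty) germs of curves $S'$ in $(\mathbb C^2,0)$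 for which there is a map $\pi$ that is a desingularization map of both $S$ and $S'$ and after which $S$ and $S'$ have the same singularities. Then there exists a natural number $N$ such that for all $f_i\in\mathfrak m^N(\tilde S_i)$, $i=1,\dots,k$, there exists $F\in\mathbb C\{x,y\}$ with $F\circ\sigma|_{\tilde S_i}=f_i$ for all $i=1,\dots,k$. Moreover, the same $N$ can be chosen for all elements of $\Sigma(S)$: for every $S'\in\Sigma(S)$, with irreducible components $S'_1,\dots,S'_{k'}$, the strict transforms $\tilde S'_j=\sigma^*S'_j$ are smooth, and for all $f_j\in\mathfrak m^N(\tilde S'_j)$, $j=1,\dots,k'$, there exists $F\in\mathbb C\{x,y\}$ with $F\circ\sigma|_{\tilde S'_j}=f_j$ for all $j$. -/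

import Mathlib

open Filter Topology

namespace PlaneGerm

/-- The local ring `ℂ{x,y}` of germs at the origin of `ℂ²` of holomorphic functions. -/
noncomputable def holGerms : Subring (Germ (𝓝 (0 : ℂ × ℂ)) ℂ) where
  carrier := {φ | ∃ f : ℂ × ℂ → ℂ, AnalyticAt ℂ f 0 ∧ (f : Germ (𝓝 (0 : ℂ × ℂ)) ℂ) = φ}
  mul_mem' := by
    rintro _ _ ⟨f, hf, rfl⟩ ⟨g, hg, rfl⟩
    exact ⟨f * g, hf.mul hg, rfl⟩
  one_mem' := ⟨1, analyticAt_const, rfl⟩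
  add_mem' := by
    rintro _ _ ⟨f, hf, rfl⟩ ⟨g, hg, rfl⟩
    exact ⟨f + g, hf.add hg, rfl⟩
  zero_mem' := ⟨0, analyticAt_const, rfl⟩
  neg_mem' := by
    rintro _ ⟨f, hf, rfl⟩
    exact ⟨-f, hf.neg, rfl⟩

/-- The germ at the origin of a function that is holomorphic there. -/
noncomputable def toGerm (f : ℂ × ℂ → ℂ) (hf : AnalyticAt ℂ f 0) : holGerms :=
  ⟨(f : Germ (𝓝 (0 : ℂ × ℂ)) ℂ), f, hf, rfl⟩

/-- A (reduced) germ of curve in `(ℂ², 0)`, given by reduced equations of its irreducible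
components `S₁, …, S_k`: irreducible elements of `ℂ{x,y}`, no two of which are associated. -/
structure Curve where
  /-- the number of irreducible components -/
  k : ℕ
  k_pos : 0 < k
  /-- a representative of the equation of the `i`-th component -/
  eqn : Fin k → ℂ × ℂ → ℂ
  analyticAt : ∀ i, AnalyticAt ℂ (eqn i) 0
  irreducible : ∀ i, Irreducible (toGerm (eqn i) (analyticAt i))
  not_associated : ∀ i j, i ≠ j →
    ¬ Associated (toGerm (eqn i) (analyticAt i)) (toGerm (eqn j) (analyticAt j))

/-- The component `Sᵢ`; only its germ at the origin matters. -/
def Curve.component (S : Curve) (i : Fin S.k) : Set (ℂ × ℂ) := {z | S.eqn i z = 0}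

/-- The whole curve, the union of its components. -/
def Curve.support (S : Curve) : Set (ℂ × ℂ) := ⋃ i, S.component i

/-! ### Blowing-ups

If a point of a surface has local coordinates `(x, y)`, then the blowing-up of the surface at this
point replaces it by the projective line of directions through it. The blown-up surface is given
near the direction `y = c x` by the coordinates `(u, v)` with `x = u`, `y = u (v + c)`, and near the
direction `x = 0` by the coordinates `(u, v)` with `x = u v`, `y = v`, both centred at the
direction in question. Iterating, a point of a surface obtained from `(ℂ², 0)` by blowing up
finitely many points over the origin, if it lies over the origin itself, is a finite sequence of
directions, and it comes with coordinates centred at it. -/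

/-- The points of the projective line of directions at a point with coordinates `(x, y)`. -/
inductive Direction where
  /-- the direction of the line `y = c x` -/
  | slope (c : ℂ)
  /-- the direction of the line `x = 0` -/
  | vertical

/-- The blowing-up of the origin of `ℂ²`, in the coordinates centred at a given direction. -/
noncomputable def blowUpChart : Direction → ℂ × ℂ → ℂ × ℂ
  | .slope c, z => (z.1, z.1 * (z.2 + c))
  | .vertical, z => (z.1 * z.2, z.2)

/-- Points infinitely near to the origin, or the origin itself (the empty list). In `d :: p`, the
first entry `d` is a direction at the origin, the next one is a direction at the point `d` of the
blown-up plane, and so on. -/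
abbrev NearPoint := List Direction

/-- The composite of blowing-ups down to `(ℂ², 0)`, in the coordinates centred at a point. -/
noncomputable def NearPoint.proj : NearPoint → ℂ × ℂ → ℂ × ℂ
  | [] => id
  | d :: p => blowUpChart d ∘ NearPoint.proj p

/-- A finite composition of blowing-ups `σ : (M, D) → (ℂ², 0)` at points over the origin, given by
the finite set of all the points that are blown up. A point can be blown up only after the points
below it. No blowing-up at all, `σ = id`, is allowed. -/
structure BlowUps where
  centers : Finset NearPoint
  mem_of_append : ∀ (p : NearPoint) (d : Direction), p ++ [d] ∈ centers → p ∈ centers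

/-- The points of `D = σ⁻¹(0)`: the points that are not blown up although all points strictly
below them are. Near such a point, `M` has the coordinates centred at the point, and `σ` is given
in them by `NearPoint.proj`. -/
def BlowUps.points (σ : BlowUps) : Set NearPoint :=
  {p | p ∉ σ.centers ∧ ∀ q : NearPoint, q <+: p → q ≠ p → q ∈ σ.centers}

/-- The exceptional divisor `σ⁻¹(0)`, in the coordinates centred at `p`. -/
def exceptional (p : NearPoint) : Set (ℂ × ℂ) := p.proj ⁻¹' {0}

/-- The strict transform of a curve `C`, i.e. the closure of `σ⁻¹(C) \ σ⁻¹(0)`, in the coordinates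
centred at `p`; only its germ at `p`, the origin of these coordinates, matters. -/
def strictTransform (p : NearPoint) (C : Set (ℂ × ℂ)) : Set (ℂ × ℂ) :=
  closure (p.proj ⁻¹' C \ exceptional p)

/-! ### Smooth curves, functions on them, normal crossings -/

/-- `γ` is a regular holomorphic parametrization of the germ of `C` at the origin. -/
def IsRegularParam (C : Set (ℂ × ℂ)) (γ : ℂ → ℂ × ℂ) : Prop :=
  AnalyticAt ℂ γ 0 ∧ γ 0 = 0 ∧ deriv γ 0 ≠ 0 ∧ map γ (𝓝 0) = 𝓝[C] 0

/-- The germ of `C` at the origin is a smooth holomorphic curve. -/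
def IsSmoothCurveAt (C : Set (ℂ × ℂ)) : Prop := ∃ γ, IsRegularParam C γ

/-- `𝔪ⁿ(C)` for the germ at the origin of a smooth curve `C`: the functions that are holomorphic on
`C` near the origin and vanish there to order at least `n`, both in terms of a local parameter
of `C`. Only the germ of the function along `C` matters. -/
def vanishingFunctions (n : ℕ) (C : Set (ℂ × ℂ)) : Set (ℂ × ℂ → ℂ) :=
  {f | ∃ γ, IsRegularParam C γ ∧ AnalyticAt ℂ (f ∘ γ) 0 ∧ (n : ℕ∞) ≤ analyticOrderAt (f ∘ γ) 0}

/-- The germ of `C` at the origin is, in suitable holomorphic coordinates `Φ = (Φ₁, Φ₂)`, either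
the smooth curve `Φ₁ = 0` or the normal crossing `Φ₁ Φ₂ = 0`. -/
def IsNormalCrossingAt (C : Set (ℂ × ℂ)) : Prop :=
  ∃ Φ : ℂ × ℂ → ℂ × ℂ, AnalyticAt ℂ Φ 0 ∧ Φ 0 = 0 ∧ Function.Bijective (fderiv ℂ Φ 0) ∧
    ((∀ᶠ z in 𝓝 0, z ∈ C ↔ (Φ z).1 = 0) ∨ (∀ᶠ z in 𝓝 0, z ∈ C ↔ (Φ z).1 * (Φ z).2 = 0))

/-! ### The curves of the statement -/

/-- All the strict transforms `σ^* Sᵢ` are smooth, at each of their points over the origin. -/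
def BlowUps.MakesSmooth (σ : BlowUps) (S : Curve) : Prop :=
  ∀ i, ∀ p ∈ σ.points, (0 : ℂ × ℂ) ∈ strictTransform p (S.component i) →
    IsSmoothCurveAt (strictTransform p (S.component i))

/-- The union of the strict transform of `S` and of the exceptional divisor, in the coordinates
centred at `p`. -/
def fullTransform (p : NearPoint) (S : Curve) : Set (ℂ × ℂ) :=
  strictTransform p S.support ∪ exceptional p

/-- `π` is a desingularization of `S`: the union of the strict transform of `S` and of the
exceptional divisor has only normal crossings. -/
def BlowUps.IsDesingularization (π : BlowUps) (S : Curve) : Prop :=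
  ∀ p ∈ π.points, IsNormalCrossingAt (fullTransform p S)

/-- The singularities of `S` after `π`: the points over the origin at which the union of the strict
transform of `S` and of the exceptional divisor is not a smooth curve. -/
def BlowUps.singularities (π : BlowUps) (S : Curve) : Set NearPoint :=
  {p ∈ π.points | ¬ IsSmoothCurveAt (fullTransform p S)}

/-- `Σ(S)`: the germs of curves that have a desingularization map in common with `S` and the same
singularities as `S` after this desingularization. -/
def sameDesingularization (S : Curve) : Set Curve :=
  {S' | ∃ π : BlowUps, π.IsDesingularization S ∧ π.IsDesingularization S' ∧
    π.singularities S' = π.singularities S}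

/-- Any functions `fᵢ ∈ 𝔪ᴺ(σ^* Sᵢ)`, `i = 1, …, k`, are the restrictions of `F ∘ σ` for one and
the same `F ∈ ℂ{x,y}`. Here `f i p` represents `fᵢ` near the point `p` of `σ^* Sᵢ`. -/
def BlowUps.Lifts (σ : BlowUps) (S : Curve) (N : ℕ) : Prop :=
  ∀ f : Fin S.k → NearPoint → ℂ × ℂ → ℂ,
    (∀ i, ∀ p ∈ σ.points, (0 : ℂ × ℂ) ∈ strictTransform p (S.component i) →
      f i p ∈ vanishingFunctions N (strictTransform p (S.component i))) →
    ∃ F : ℂ × ℂ → ℂ, AnalyticAt ℂ F 0 ∧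
      ∀ i, ∀ p ∈ σ.points, (0 : ℂ × ℂ) ∈ strictTransform p (S.component i) →
        ∀ᶠ z in 𝓝[strictTransform p (S.component i)] 0, F (p.proj z) = f i p z

end PlaneGerm

/-! Extension from one branch. After a change of parameter a branch is `t ↦ (tⁿ, y(t))`, and its
equation is the Weierstrass polynomial `W`, the product of the `w - y(ζᵐ t)` over all conjugates.
For any holomorphic `g`, the sum over the conjugates of `g(t) ∏_{m ≠ 0} (w - y(ζᵐ t))` is a
holomorphic function of `(tⁿ, w)` that restricts to `g · ∂W/∂w` on the branch
(`NormalArc.exists_interpolation`). Hence every function on the branch whose order is at least that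
of one of the partial derivatives of the equation, that is, at least `different`, extends to the
plane (`IsArc.exists_lift`). For several branches, divide each datum by the product of the other
equations, extend the quotient, multiply back and add up (`Curve.exists_extension`). The threshold
`Curve.bound` is the different plus the intersection multiplicities with the other branches. It is
finite because distinct components share no branch.

Uniformity. The threshold is expressed through multiplicities at infinitely near points. The
different is `c + mult - 1`, where the conductor `c` grows by `m (m - 1)` under each blowing-down
(`HasConductor.blowUp`). Intersection multiplicities are sums of products of multiplicities, by
Noether's formula (`order_blowUp_same`, `order_blowUp_ne`). These multiplicities are the orders of
the equations of the exceptional divisors along the strict transform. After a desingularization with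
at least one blowing-up, the strict transform is transverse to a smooth exceptional divisor, so the
orders depend only on the point through which it passes (`sameOrders_of_isAxis`). Equality of the
singularities makes each branch of `S'` pass through such a point of a branch of `S`
(`exists_isCompanion`); smoothness after `σ` and the threshold are then transferred from `S` to `S'`
(`exists_isLift_of_isCompanion`, `bound_le_of_isCompanion`). If the common desingularization is the
identity, then `S'` itself has normal crossings and its thresholds are at most one (`bound_le_one`).
-/

namespace PlaneGerm

/-! ### Analytic functions of two variables as double power series -/

/-- The coefficients `a` grow at most geometrically. -/
def GeometricBound (a : ℕ → ℕ → ℂ) : Prop :=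
  ∃ C R : ℝ, 0 < C ∧ 0 < R ∧ ∀ j k, ‖a j k‖ ≤ C * R ^ (j + k)

lemma hasSum_of_forall_eq {ι : Type*} {F G : ι → ℂ} {T : ℂ} (h : HasSum F T)
    (hFG : ∀ i, F i = G i) : HasSum G T := funext hFG ▸ h

/-- Regrouping by total degree links double series with the homogeneous terms of a formal
multilinear series. -/
lemma hasSum_antidiagonal {F : ℕ × ℕ → ℂ} {T : ℂ} (h : HasSum F T) :
    HasSum (fun n => ∑ x ∈ Finset.HasAntidiagonal.antidiagonal n, F x) T := by
  have h1 := (Finset.HasAntidiagonal.sigmaAntidiagonalEquivProd (A := ℕ)).hasSum_iff.mpr h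
  refine hasSum_of_forall_eq (h1.sigma (fun n => hasSum_fintype _)) ?_
  intro n
  exact Finset.sum_coe_sort _ F

lemma eventually_small (R : ℝ) :
    ∀ᶠ z : ℂ × ℂ in 𝓝 0, R * ‖z.1‖ < 1 ∧ R * ‖z.2‖ < 1 := by
  have h1 : Tendsto (fun z : ℂ × ℂ => R * ‖z.1‖) (𝓝 0) (𝓝 0) := by
    have : Continuous (fun z : ℂ × ℂ => R * ‖z.1‖) := by fun_prop
    simpa using this.tendsto 0
  have h2 : Tendsto (fun z : ℂ × ℂ => R * ‖z.2‖) (𝓝 0) (𝓝 0) := by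
    have : Continuous (fun z : ℂ × ℂ => R * ‖z.2‖) := by fun_prop
    simpa using this.tendsto 0
  exact (h1.eventually_lt_const one_pos).and (h2.eventually_lt_const one_pos)

lemma GeometricBound.summable {a : ℕ → ℕ → ℂ} (ha : GeometricBound a) :
    ∀ᶠ z : ℂ × ℂ in 𝓝 0,
      Summable (fun jk : ℕ × ℕ => a jk.1 jk.2 * z.1 ^ jk.1 * z.2 ^ jk.2) := by
  obtain ⟨C, R, hC, hR, h⟩ := ha
  filter_upwards [eventually_small R] with z hz
  have h1 := summable_geometric_of_lt_one (by positivity) hz.1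
  have h2 := summable_geometric_of_lt_one (by positivity) hz.2
  have h3 := (h1.mul_of_nonneg h2 (fun _ => by positivity) (fun _ => by positivity)).mul_left C
  refine Summable.of_norm_bounded h3 fun jk => ?_
  rw [norm_mul, norm_mul, norm_pow, norm_pow]
  calc _ ≤ C * R ^ (jk.1 + jk.2) * ‖z.1‖ ^ jk.1 * ‖z.2‖ ^ jk.2 := by
        gcongr; exact h _ _
    _ = _ := by rw [mul_pow, mul_pow, pow_add]; ring

/-- The coefficient of `z.1 ^ j * z.2 ^ k` is the sum of the values of the multilinear term of
degree `j + k` on all arrangements of `j` vectors `(1, 0)` and `k` vectors `(0, 1)`. There are at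
most `2 ^ (j + k)` arrangements, so the bound stays geometric. -/
lemma exists_coeff {f : ℂ × ℂ → ℂ} (hf : AnalyticAt ℂ f 0) :
    ∃ a, GeometricBound a ∧ ∀ᶠ z : ℂ × ℂ in 𝓝 0,
      HasSum (fun jk : ℕ × ℕ => a jk.1 jk.2 * z.1 ^ jk.1 * z.2 ^ jk.2) (f z) := by
  obtain ⟨p, hp⟩ := hf
  let b : ℕ → ℕ → ℂ := fun n j => ∑ s ∈ Finset.powersetCard j (Finset.univ : Finset (Fin n)),
    p n (s.piecewise (fun _ => (1, 0)) (fun _ => (0, 1)))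
  have hb : GeometricBound fun j k => b (j + k) j := by
    obtain ⟨r, hr0, hr⟩ := ENNReal.lt_iff_exists_nnreal_btwn.mp hp.radius_pos
    have hr0' : 0 < r := by exact_mod_cast hr0
    obtain ⟨C, hC, h⟩ := p.norm_le_div_pow_of_pos_of_lt_radius hr0' hr
    have hr1 : (0 : ℝ) < r := by exact_mod_cast hr0'
    refine ⟨C, 2 / r, hC, by positivity, fun j k => ?_⟩
    have h1 : ∀ s ∈ Finset.powersetCard j (Finset.univ : Finset (Fin (j + k))),
        ‖p (j + k) (s.piecewise (fun _ => ((1 : ℂ), (0 : ℂ))) (fun _ => (0, 1)))‖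
          ≤ C / r ^ (j + k) := by
      intro s _
      refine ((p (j + k)).le_opNorm _).trans ?_
      refine le_trans ?_ (h (j + k))
      refine mul_le_of_le_one_right (norm_nonneg _) (Finset.prod_le_one (fun _ _ => norm_nonneg _) ?_)
      intro i _
      by_cases hi : i ∈ s <;> simp [hi, Prod.norm_def]
    refine (Finset.sum_le_sum_of_subset_of_nonneg (f := fun s : Finset (Fin (j + k)) => ‖p (j + k) (s.piecewise (fun _ => ((1 : ℂ), (0 : ℂ))) (fun _ => (0, 1)))‖) (le_refl _) (fun _ _ _ => norm_nonneg _) |> (norm_sum_le _ _).trans).trans ?_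
    refine (Finset.sum_le_card_nsmul _ _ _ h1).trans ?_
    rw [nsmul_eq_mul, Finset.card_powersetCard, Finset.card_univ, Fintype.card_fin, div_pow,
      mul_div_assoc', mul_div_assoc', mul_comm]
    gcongr
    exact_mod_cast Nat.choose_le_two_pow _ _
  refine ⟨_, hb, ?_⟩
  filter_upwards [hb.summable, hp.eventually_hasSum] with z hz hs
  have h1 := hasSum_antidiagonal hz.hasSum
  rw [zero_add] at hs
  convert hz.hasSum using 1
  refine hs.unique (hasSum_of_forall_eq h1 ?_)
  intro n
  rw [Finset.Nat.sum_antidiagonal_eq_sum_range_succ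
    (fun j k => b (j + k) j * z.1 ^ j * z.2 ^ k)]
  have hz' : (fun _ : Fin n => z) = (fun _ => z.1 • ((1 : ℂ), (0 : ℂ))) + fun _ => z.2 • ((0 : ℂ), (1 : ℂ)) := by
    ext <;> simp
  rw [hz', ContinuousMultilinearMap.map_add_univ, ← Finset.powerset_univ, Finset.sum_powerset,
    Finset.card_univ, Fintype.card_fin]
  refine Finset.sum_congr rfl fun j hj => ?_
  have hj' : j + (n - j) = n := by have := Finset.mem_range.mp hj; omega
  rw [hj', Finset.sum_mul, Finset.sum_mul]
  refine Finset.sum_congr rfl fun s hs => ?_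
  have hc := (Finset.mem_powersetCard.mp hs).2
  have : s.piecewise (fun _ => z.1 • ((1 : ℂ), (0 : ℂ))) (fun _ => z.2 • ((0 : ℂ), (1 : ℂ))) =
      fun i => (s.piecewise (fun _ => z.1) (fun _ => z.2) i : ℂ) •
        (s.piecewise (fun _ => ((1 : ℂ), (0 : ℂ))) (fun _ => (0, 1)) i : ℂ × ℂ) := by
    ext i <;> by_cases hi : i ∈ s <;> simp [hi]
  rw [this, ContinuousMultilinearMap.map_smul_univ, Finset.prod_piecewise]
  simp [hc, Finset.card_sdiff]
  ring

/-- A monomial is the diagonal of the multilinear map that multiplies first coordinates in the first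
`j` slots and second coordinates in the others; its norm is at most one. Degree `n` has `n + 1 ≤ 2 ^
n` monomials, whence the ratio `2 * R`. -/
lemma GeometricBound.analyticAt {a : ℕ → ℕ → ℂ} (ha : GeometricBound a) :
    AnalyticAt ℂ (fun z : ℂ × ℂ => ∑' jk : ℕ × ℕ, a jk.1 jk.2 * z.1 ^ jk.1 * z.2 ^ jk.2) 0 := by
  let M : ∀ n : ℕ, ℕ → ContinuousMultilinearMap ℂ (fun _ : Fin n => ℂ × ℂ) ℂ := fun n j =>
    (ContinuousMultilinearMap.mkPiAlgebraFin ℂ n ℂ).compContinuousLinearMap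
      (fun i => if (i : ℕ) < j then ContinuousLinearMap.fst ℂ ℂ ℂ else ContinuousLinearMap.snd ℂ ℂ ℂ)
  have hM : ∀ n j, ‖M n j‖ ≤ 1 := by
    intro n j
    refine (ContinuousMultilinearMap.norm_compContinuousLinearMap_le _ _).trans ?_
    rw [ContinuousMultilinearMap.norm_mkPiAlgebraFin, one_mul]
    refine Finset.prod_le_one (fun _ _ => norm_nonneg _) fun i _ => ?_
    split_ifs
    · exact ContinuousLinearMap.norm_fst_le _ _ _
    · exact ContinuousLinearMap.norm_snd_le _ _ _
  have hMz : ∀ j k (z : ℂ × ℂ), M (j + k) j (fun _ => z) = z.1 ^ j * z.2 ^ k := by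
    intro j k z
    simp only [M, ContinuousMultilinearMap.compContinuousLinearMap_apply,
      ContinuousMultilinearMap.mkPiAlgebraFin_apply, List.prod_ofFn]
    rw [Fin.prod_univ_add]
    congr 1 <;> simp
  let p : FormalMultilinearSeries ℂ (ℂ × ℂ) ℂ := fun n =>
    ∑ x ∈ Finset.HasAntidiagonal.antidiagonal n, a x.1 x.2 • M n x.1
  have hpz : ∀ n (z : ℂ × ℂ), p n (fun _ => z) =
      ∑ x ∈ Finset.HasAntidiagonal.antidiagonal n, a x.1 x.2 * z.1 ^ x.1 * z.2 ^ x.2 := by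
    intro n z
    simp only [p, sum_apply]
    refine Finset.sum_congr rfl fun x hx => ?_
    obtain rfl := Finset.HasAntidiagonal.mem_antidiagonal.mp hx
    simp [hMz, mul_assoc]
  obtain ⟨C, R, hC, hR, h⟩ := id ha
  have hpn : ∀ n, ‖p n‖ ≤ C * (2 * R) ^ n := by
    intro n
    refine (norm_sum_le _ _).trans ?_
    refine (Finset.sum_le_card_nsmul _ _ (C * R ^ n) ?_).trans ?_
    · intro x hx
      obtain rfl := Finset.HasAntidiagonal.mem_antidiagonal.mp hx
      rw [norm_smul]
      exact (mul_le_of_le_one_right (norm_nonneg _) (hM _ _)).trans (h _ _)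
    · rw [nsmul_eq_mul, Finset.Nat.card_antidiagonal, mul_pow]
      have : ((n + 1 : ℕ) : ℝ) ≤ 2 ^ n := by exact_mod_cast Nat.lt_two_pow_self
      calc _ ≤ 2 ^ n * (C * R ^ n) := by gcongr
        _ = _ := by ring
  obtain ⟨ρ, hρ, hball⟩ := Metric.eventually_nhds_iff_ball.mp ha.summable
  let r : NNReal := ⟨min ρ (1 / (2 * R)), by positivity⟩
  have hr : (0 : ℝ) < r := by change 0 < min ρ (1 / (2 * R)); positivity
  refine ⟨p, r, ?_, by exact_mod_cast hr, ?_⟩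
  · refine p.le_radius_of_bound C fun n => ?_
    calc _ ≤ C * (2 * R) ^ n * (1 / (2 * R)) ^ n := by
          gcongr
          · exact hpn n
          · exact min_le_right _ _
      _ = C := by rw [mul_assoc, ← mul_pow, mul_one_div_cancel (by positivity), one_pow, mul_one]
  · intro z hz
    rw [zero_add]
    have hz' : z ∈ Metric.ball (0 : ℂ × ℂ) ρ := by
      have : ‖z‖ < r := by simpa using hz
      rw [mem_ball_zero_iff]
      exact this.trans_le (min_le_left _ _)
    exact hasSum_of_forall_eq (hasSum_antidiagonal (hball z hz').hasSum) fun n => (hpz n z).symm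

/-- An analytic function that vanishes on the first axis is divisible by the second coordinate. -/
lemma exists_eq_snd_mul {f : ℂ × ℂ → ℂ} (hf : AnalyticAt ℂ f 0)
    (h0 : ∀ᶠ t : ℂ in 𝓝 0, f (t, 0) = 0) :
    ∃ q, AnalyticAt ℂ q 0 ∧ ∀ᶠ z in 𝓝 (0 : ℂ × ℂ), f z = z.2 * q z := by
  obtain ⟨a, ha, hs⟩ := exists_coeff hf
  have hb : GeometricBound fun j k => a j (k + 1) := by
    obtain ⟨C, R, hC, hR, h⟩ := ha
    exact ⟨C * R, R, by positivity, hR, fun j k => (h _ _).trans_eq (by ring)⟩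
  refine ⟨_, hb.analyticAt, ?_⟩
  have hc : Tendsto (fun z : ℂ × ℂ => (z.1, (0 : ℂ))) (𝓝 0) (𝓝 0) := by
    have : Continuous (fun z : ℂ × ℂ => (z.1, (0 : ℂ))) := by fun_prop
    exact this.tendsto' _ _ (by simp)
  have hc1 : Tendsto (fun z : ℂ × ℂ => z.1) (𝓝 0) (𝓝 0) := continuous_fst.tendsto 0
  filter_upwards [hs, hc.eventually hs, hc1.eventually h0, hb.summable] with z h1 h2 h3 h4
  -- Subtracting the series at `(z.1, 0)`, whose sum is zero, removes exactly the terms with `k =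
  -- 0`; the remaining ones are reindexed by `k + 1`.
  have h5 := h1.sub h2
  rw [h3, sub_zero] at h5
  have hinj : Function.Injective (fun x : ℕ × ℕ => (x.1, x.2 + 1)) := by
    rintro ⟨a, b⟩ ⟨c, d⟩ h; simpa using h
  rw [← hinj.hasSum_iff] at h5
  · refine h5.unique (hasSum_of_forall_eq (h4.hasSum.mul_left z.2) ?_)
    intro x
    simp [pow_succ]
    ring
  · rintro ⟨j, k⟩ hx
    rcases k with _ | k
    · simp
    · exact absurd ⟨(j, k), rfl⟩ hx

/-- The sum of the conjugates of an analytic function under `t ↦ ζ t` is a function of `tⁿ`. -/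
lemma exists_trace {f : ℂ × ℂ → ℂ} (hf : AnalyticAt ℂ f 0) {n : ℕ} (hn : n ≠ 0) {ζ : ℂ}
    (hζ : IsPrimitiveRoot ζ n) :
    ∃ g, AnalyticAt ℂ g 0 ∧ ∀ᶠ z in 𝓝 (0 : ℂ × ℂ),
      ∑ m ∈ Finset.range n, f (ζ ^ m * z.1, z.2) = g (z.1 ^ n, z.2) := by
  obtain ⟨a, ha, hs⟩ := exists_coeff hf
  -- Summation over the conjugates multiplies the coefficient of `t ^ j` by `n` if `n ∣ j` and by
  -- zero otherwise.
  have hb : GeometricBound fun j k => n * a (n * j) k := by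
    obtain ⟨C, R, hC, hR, h⟩ := ha
    have hn' : (0 : ℝ) < n := by exact_mod_cast Nat.pos_of_ne_zero hn
    -- The base is `1 + R` rather than `R` so that the exponent `n * j + k` may be raised to `n * (j
    -- + k)`.
    refine ⟨n * C, (1 + R) ^ n, by positivity, by positivity, fun j k => ?_⟩
    rw [norm_mul, Complex.norm_natCast, mul_assoc]
    gcongr
    refine (h _ _).trans ?_
    gcongr
    rw [← pow_mul, mul_add]
    calc R ^ (n * j + k) ≤ (1 + R) ^ (n * j + k) := by gcongr; linarith
      _ ≤ (1 + R) ^ (n * j + n * k) := by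
        gcongr
        · linarith
        · exact Nat.le_mul_of_pos_left _ (Nat.pos_of_ne_zero hn)
  refine ⟨_, hb.analyticAt, ?_⟩
  have hc : ∀ m ∈ Finset.range n, ∀ᶠ z : ℂ × ℂ in 𝓝 0,
      HasSum (fun jk : ℕ × ℕ => a jk.1 jk.2 * (ζ ^ m * z.1) ^ jk.1 * z.2 ^ jk.2)
        (f (ζ ^ m * z.1, z.2)) := by
    intro m _
    have : Continuous (fun z : ℂ × ℂ => (ζ ^ m * z.1, z.2)) := by fun_prop
    exact (this.tendsto' 0 0 (by simp)).eventually hs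
  have hp : Tendsto (fun z : ℂ × ℂ => (z.1 ^ n, z.2)) (𝓝 0) (𝓝 0) := by
    have : Continuous (fun z : ℂ × ℂ => (z.1 ^ n, z.2)) := by fun_prop
    exact this.tendsto' _ _ (by simp [hn])
  filter_upwards [(Filter.eventually_all_finset _).mpr hc, hp.eventually hb.summable] with z h1 h2
  have h3 := hasSum_sum h1
  have hinj : Function.Injective (fun x : ℕ × ℕ => (n * x.1, x.2)) := by
    rintro ⟨a, b⟩ ⟨c, d⟩ h; simpa [hn] using h
  have key : ∀ j : ℕ, ∑ m ∈ Finset.range n, (ζ ^ m) ^ j = if n ∣ j then (n : ℂ) else 0 := by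
    intro j
    simp_rw [← pow_mul, mul_comm _ j, pow_mul]
    split_ifs with hj
    · rw [(hζ.pow_eq_one_iff_dvd j).mpr hj]; simp
    · have h1 : ζ ^ j ≠ 1 := fun h => hj ((hζ.pow_eq_one_iff_dvd j).mp h)
      rw [geom_sum_eq h1, ← pow_mul, mul_comm, pow_mul, hζ.pow_eq_one, one_pow, sub_self, zero_div]
  have h4 : ∀ jk : ℕ × ℕ, ∑ m ∈ Finset.range n, a jk.1 jk.2 * (ζ ^ m * z.1) ^ jk.1 * z.2 ^ jk.2
      = (if n ∣ jk.1 then (n : ℂ) else 0) * (a jk.1 jk.2 * z.1 ^ jk.1 * z.2 ^ jk.2) := by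
    intro jk
    rw [← key, Finset.sum_mul]
    refine Finset.sum_congr rfl fun m _ => ?_
    rw [mul_pow]; ring
  simp_rw [h4] at h3
  rw [← hinj.hasSum_iff] at h3
  · refine h3.unique (hasSum_of_forall_eq h2.hasSum ?_)
    intro x
    simp [← pow_mul]
    ring
  · rintro ⟨j, k⟩ hx
    have : ¬ n ∣ j := by
      rintro ⟨i, rfl⟩
      exact hx ⟨(i, k), rfl⟩
    simp [this]

/-! ### Weierstrass polynomials of parametrized branches `t ↦ (tⁿ, y(t))` -/

/-- The derivative of `f` at `z` in the direction `v`. -/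
noncomputable def pd (v : ℂ × ℂ) (f : ℂ × ℂ → ℂ) (z : ℂ × ℂ) : ℂ := fderiv ℂ f z v

lemma analyticAt_pd {f : ℂ × ℂ → ℂ} {z : ℂ × ℂ} (hf : AnalyticAt ℂ f z) (v : ℂ × ℂ) :
    AnalyticAt ℂ (pd v f) z :=
  (ContinuousLinearMap.apply ℂ ℂ v).analyticAt _ |>.comp hf.fderiv

lemma tendsto_zero {E F : Type*} [NormedAddCommGroup E] [NormedSpace ℂ E] [NormedAddCommGroup F]
    [NormedSpace ℂ F] {f : E → F} {x : E} (hf : AnalyticAt ℂ f x) (h : f x = 0) :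
    Tendsto f (𝓝 x) (𝓝 0) := h ▸ hf.continuousAt.tendsto

/-- `f` generates the ideal of the germs of functions that vanish on the image of `δ`. -/
structure IsEqn (f : ℂ × ℂ → ℂ) (δ : ℂ → ℂ × ℂ) : Prop where
  analyticAt : AnalyticAt ℂ f 0
  vanish : ∀ᶠ t in 𝓝 (0 : ℂ), f (δ t) = 0
  dvd : ∀ g : ℂ × ℂ → ℂ, AnalyticAt ℂ g 0 → (∀ᶠ t in 𝓝 (0 : ℂ), g (δ t) = 0) →
    ∃ q, AnalyticAt ℂ q 0 ∧ ∀ᶠ z in 𝓝 (0 : ℂ × ℂ), g z = f z * q z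

/-- The germ at the origin of the zero set of `f` is the image of `δ`. -/
def ZerosIn (f : ℂ × ℂ → ℂ) (δ : ℂ → ℂ × ℂ) : Prop :=
  ∀ U ∈ 𝓝 (0 : ℂ), ∀ᶠ z in 𝓝 (0 : ℂ × ℂ), f z = 0 → ∃ t ∈ U, δ t = z

/-- `t ↦ (tⁿ, y(t))` is a primitive parametrization of a branch, `ζ` a primitive root of unity. -/
structure NormalArc (n : ℕ) (ζ : ℂ) (y : ℂ → ℂ) : Prop where
  ne_zero : n ≠ 0
  root : IsPrimitiveRoot ζ n
  analyticAt : AnalyticAt ℂ y 0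
  map_zero : y 0 = 0
  sep : ∀ i < n, ∀ j < n, i ≠ j → ∀ᶠ t in 𝓝[≠] (0 : ℂ), y (ζ ^ i * t) ≠ y (ζ ^ j * t)

/-- Meant for products over all conjugates: replacing `t` by `ζ ^ k * t` only shifts the index
cyclically. -/
lemma prod_range_shift {M : Type*} [CommMonoid M] {n : ℕ} {G : ℕ → M} (hG : ∀ m, G (m + n) = G m)
    (k : ℕ) : ∏ m ∈ Finset.range n, G (m + k) = ∏ m ∈ Finset.range n, G m := by
  induction k with
  | zero => rfl
  | succ k ih =>
    rw [← ih]
    rcases n with _ | n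
    · rfl
    · rw [Finset.prod_range_succ, Finset.prod_range_succ' (fun m => G (m + k))]
      congr 1
      · exact Finset.prod_congr rfl fun m _ => by congr 1; ring
      · rw [← hG (0 + k)]; congr 1; ring

/-- Small numbers have small `n`-th roots, so identities proved near the origin of the cover `(t, w)
↦ (t ^ n, w)` descend to the plane. -/
lemma eventually_exists_root {Q : ℂ × ℂ → Prop} (hQ : ∀ᶠ z in 𝓝 (0 : ℂ × ℂ), Q z) {n : ℕ}
    (hn : n ≠ 0) : ∀ᶠ w in 𝓝 (0 : ℂ × ℂ), ∃ t, t ^ n = w.1 ∧ Q (t, w.2) := by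
  obtain ⟨ρ, hρ, h⟩ := Metric.eventually_nhds_iff_ball.mp hQ
  have h1 : Metric.ball (0 : ℂ × ℂ) (min (ρ ^ n) ρ) ∈ 𝓝 (0 : ℂ × ℂ) :=
    Metric.ball_mem_nhds _ (by positivity)
  filter_upwards [h1] with w hw
  rw [mem_ball_zero_iff, Prod.norm_def, max_lt_iff, lt_min_iff, lt_min_iff] at hw
  obtain ⟨t, ht⟩ := IsAlgClosed.exists_pow_nat_eq w.1 (Nat.pos_of_ne_zero hn)
  refine ⟨t, ht, h _ ?_⟩
  rw [mem_ball_zero_iff, Prod.norm_def, max_lt_iff]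
  refine ⟨?_, hw.2.2⟩
  have := hw.1.1
  rw [← ht, norm_pow] at this
  exact lt_of_pow_lt_pow_left₀ n hρ.le this

/-- An analytic function vanishing on a graph is divisible by the equation of the graph. -/
lemma exists_eq_sub_mul {f : ℂ × ℂ → ℂ} (hf : AnalyticAt ℂ f 0) {y : ℂ → ℂ}
    (hy : AnalyticAt ℂ y 0) (hy0 : y 0 = 0) (h0 : ∀ᶠ t : ℂ in 𝓝 0, f (t, y t) = 0) :
    ∃ q, AnalyticAt ℂ q 0 ∧ ∀ᶠ z in 𝓝 (0 : ℂ × ℂ), f z = (z.2 - y z.1) * q z := by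
  have hy1 : AnalyticAt ℂ (fun z : ℂ × ℂ => y z.1) 0 := AnalyticAt.comp (g := y) hy analyticAt_fst
  have h1 : AnalyticAt ℂ (fun z : ℂ × ℂ => (z.1, z.2 + y z.1)) 0 :=
    analyticAt_fst.prod (analyticAt_snd.add hy1)
  have h2 : AnalyticAt ℂ (fun z : ℂ × ℂ => (z.1, z.2 - y z.1)) 0 :=
    analyticAt_fst.prod (analyticAt_snd.sub hy1)
  obtain ⟨q, hq, hfq⟩ := exists_eq_snd_mul (f := f ∘ fun z => (z.1, z.2 + y z.1))
    (hf.comp_of_eq h1 (by simp [hy0])) (by simpa using h0)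
  refine ⟨q ∘ fun z => (z.1, z.2 - y z.1), hq.comp_of_eq h2 (by simp [hy0]), ?_⟩
  have h3 := tendsto_zero h2 (by simp [hy0])
  filter_upwards [h3.eventually hfq] with z hz
  simpa using hz

section

variable {n : ℕ} {ζ : ℂ} {y : ℂ → ℂ}

lemma tendsto_const_mul_zero (c : ℂ) : Tendsto (fun t => c * t) (𝓝 (0 : ℂ)) (𝓝 0) :=
  (continuous_const_mul c).tendsto' _ _ (mul_zero c)

lemma NormalArc.analyticAt_conj (h : NormalArc n ζ y) (i : ℕ) :
    AnalyticAt ℂ (fun t => y (ζ ^ i * t)) 0 :=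
  h.analyticAt.fun_comp_of_eq (analyticAt_const.mul analyticAt_id) (by simp)

lemma NormalArc.analyticAt_conj_fst (h : NormalArc n ζ y) (i : ℕ) :
    AnalyticAt ℂ (fun z : ℂ × ℂ => y (ζ ^ i * z.1)) 0 :=
  AnalyticAt.comp (g := fun t => y (ζ ^ i * t)) (h.analyticAt_conj i) analyticAt_fst

lemma NormalArc.analyticAt_prod (h : NormalArc n ζ y) (s : Finset ℕ) :
    AnalyticAt ℂ (fun z : ℂ × ℂ => ∏ m ∈ s, (z.2 - y (ζ ^ m * z.1))) 0 :=
  Finset.analyticAt_fun_prod _ fun m _ => analyticAt_snd.sub (h.analyticAt_conj_fst m)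

lemma NormalArc.prod_conj (h : NormalArc n ζ y) (k : ℕ) (t w : ℂ) :
    ∏ m ∈ Finset.range n, (w - y (ζ ^ m * (ζ ^ k * t))) =
      ∏ m ∈ Finset.range n, (w - y (ζ ^ m * t)) := by
  have hG : ∀ m, (fun m => w - y (ζ ^ m * t)) (m + n) = (fun m => w - y (ζ ^ m * t)) m := by
    intro m
    simp [pow_add, h.root.pow_eq_one]
  refine Eq.trans ?_ (prod_range_shift hG k)
  exact Finset.prod_congr rfl fun m _ => by simp only [pow_add, mul_assoc]

/-- An analytic function invariant under `t ↦ ζ t` is a function of `tⁿ`. -/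
lemma exists_descent {f : ℂ × ℂ → ℂ} (hf : AnalyticAt ℂ f 0) (hn : n ≠ 0)
    (hζ : IsPrimitiveRoot ζ n)
    (hinv : ∀ m, ∀ᶠ z in 𝓝 (0 : ℂ × ℂ), f (ζ ^ m * z.1, z.2) = f z) :
    ∃ g, AnalyticAt ℂ g 0 ∧ ∀ᶠ z in 𝓝 (0 : ℂ × ℂ), f z = g (z.1 ^ n, z.2) := by
  obtain ⟨g, hg, h⟩ := exists_trace hf hn hζ
  refine ⟨fun z => (n : ℂ)⁻¹ * g z, analyticAt_const.mul hg, ?_⟩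
  have h1 := (Filter.eventually_all_finset (Finset.range n)).mpr fun m _ => hinv m
  filter_upwards [h, h1] with z hz hz1
  rw [← hz, Finset.sum_congr rfl hz1]
  simp [hn]

/-- The Weierstrass polynomial of a branch. -/
lemma NormalArc.exists_weierstrass (h : NormalArc n ζ y) :
    ∃ W, AnalyticAt ℂ W 0 ∧ ∀ᶠ z in 𝓝 (0 : ℂ × ℂ),
      W (z.1 ^ n, z.2) = ∏ m ∈ Finset.range n, (z.2 - y (ζ ^ m * z.1)) := by
  obtain ⟨g, hg, hW⟩ := exists_descent (h.analyticAt_prod (Finset.range n)) h.ne_zero h.root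
    (fun m => Eventually.of_forall fun z => h.prod_conj m z.1 z.2)
  exact ⟨g, hg, hW.mono fun z hz => hz.symm⟩

lemma NormalArc.tendsto_graph (h : NormalArc n ζ y) (i : ℕ) :
    Tendsto (fun t => (t, y (ζ ^ i * t))) (𝓝 0) (𝓝 (0 : ℂ × ℂ)) :=
  tendsto_zero (analyticAt_id.prod (h.analyticAt_conj i)) (by simp [h.map_zero])

/-- The linear factors are split off one at a time. On the next graph the factors already removed
are nonzero for `t ≠ 0`, because conjugates are distinct, so the quotient vanishes there and, by the
identity theorem, also at `t = 0`. -/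
lemma NormalArc.exists_eq_prod_mul (h : NormalArc n ζ y) {g : ℂ × ℂ → ℂ} (hg : AnalyticAt ℂ g 0)
    (s : Finset ℕ) (hs : s ⊆ Finset.range n)
    (h0 : ∀ i ∈ s, ∀ᶠ t in 𝓝 (0 : ℂ), g (t, y (ζ ^ i * t)) = 0) :
    ∃ q, AnalyticAt ℂ q 0 ∧
      ∀ᶠ z in 𝓝 (0 : ℂ × ℂ), g z = (∏ m ∈ s, (z.2 - y (ζ ^ m * z.1))) * q z := by
  classical
  induction s using Finset.induction_on with
  | empty => exact ⟨g, hg, by simp⟩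
  | insert i s his ih =>
    obtain ⟨q, hq, hgq⟩ := ih ((Finset.subset_insert _ _).trans hs)
      fun j hj => h0 j (Finset.mem_insert_of_mem hj)
    have hi := h0 i (Finset.mem_insert_self _ _)
    have h1 : AnalyticAt ℂ (fun t => q (t, y (ζ ^ i * t))) 0 :=
      hq.fun_comp_of_eq (analyticAt_id.prod (h.analyticAt_conj i)) (by simp [h.map_zero])
    have h2 : ∀ᶠ t in 𝓝[≠] (0 : ℂ), q (t, y (ζ ^ i * t)) = 0 := by
      have h3 : ∀ j ∈ s, ∀ᶠ t in 𝓝[≠] (0 : ℂ), y (ζ ^ i * t) ≠ y (ζ ^ j * t) := fun j hj =>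
        h.sep i (Finset.mem_range.mp (hs (Finset.mem_insert_self _ _))) j
          (Finset.mem_range.mp (hs (Finset.mem_insert_of_mem hj))) (by rintro rfl; exact his hj)
      filter_upwards [(Filter.eventually_all_finset s).mpr h3, nhdsWithin_le_nhds hi,
        nhdsWithin_le_nhds ((h.tendsto_graph i).eventually hgq)] with t h4 h5 h6
      rw [h5] at h6
      refine (mul_eq_zero.mp h6.symm).resolve_left ?_
      exact Finset.prod_ne_zero_iff.mpr fun j hj => sub_ne_zero.mpr (h4 j hj)
    have h4 := h1.frequently_zero_iff_eventually_zero.mp h2.frequently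
    obtain ⟨q', hq', hqq⟩ := exists_eq_sub_mul hq (h.analyticAt_conj i) (by simp [h.map_zero]) h4
    refine ⟨q', hq', ?_⟩
    filter_upwards [hgq, hqq] with z h5 h6
    rw [h5, h6, Finset.prod_insert his]
    ring

lemma tendsto_pow_fst (hn : n ≠ 0) :
    Tendsto (fun z : ℂ × ℂ => (z.1 ^ n, z.2)) (𝓝 0) (𝓝 0) := by
  have : Continuous (fun z : ℂ × ℂ => (z.1 ^ n, z.2)) := by fun_prop
  exact this.tendsto' _ _ (by simp [hn])

lemma analyticAt_comp_pow_fst {g : ℂ × ℂ → ℂ} (hg : AnalyticAt ℂ g 0) (hn : n ≠ 0) :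
    AnalyticAt ℂ (fun z : ℂ × ℂ => g (z.1 ^ n, z.2)) 0 :=
  hg.fun_comp_of_eq ((analyticAt_fst.pow n).prod analyticAt_snd) (by simp [hn])

lemma NormalArc.conj_pow (h : NormalArc n ζ y) (i : ℕ) (t : ℂ) : (ζ ^ i * t) ^ n = t ^ n := by
  rw [mul_pow, ← pow_mul, mul_comm i, pow_mul, h.root.pow_eq_one, one_pow, one_mul]

/-- Pulled back to the cover, a function vanishing on the branch vanishes on all conjugate graphs,
hence is divisible by the product. The product is invariant under conjugation, so the quotient may
be averaged over the conjugates, and the average descends to the plane. -/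
lemma NormalArc.isEqn (h : NormalArc n ζ y) {W : ℂ × ℂ → ℂ} (hW : AnalyticAt ℂ W 0)
    (hWp : ∀ᶠ z in 𝓝 (0 : ℂ × ℂ),
      W (z.1 ^ n, z.2) = ∏ m ∈ Finset.range n, (z.2 - y (ζ ^ m * z.1))) :
    IsEqn W (fun t => (t ^ n, y t)) where
  analyticAt := hW
  vanish := by
    have := (h.tendsto_graph 0).eventually hWp
    filter_upwards [this] with t ht
    simp only [pow_zero, one_mul] at ht
    rw [ht]
    exact Finset.prod_eq_zero (Finset.mem_range.mpr (Nat.pos_of_ne_zero h.ne_zero)) (by simp)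
  dvd := by
    intro g hg hg0
    obtain ⟨q, hq, hgq⟩ := h.exists_eq_prod_mul (analyticAt_comp_pow_fst hg h.ne_zero)
      (Finset.range n) subset_rfl (fun i _ => by
        filter_upwards [(tendsto_const_mul_zero (ζ ^ i)).eventually hg0] with t ht
        rwa [h.conj_pow] at ht)
    obtain ⟨r, hr, hqr⟩ := exists_trace hq h.ne_zero h.root
    refine ⟨fun z => (n : ℂ)⁻¹ * r z, analyticAt_const.mul hr, ?_⟩
    have h1 : ∀ m ∈ Finset.range n, ∀ᶠ z in 𝓝 (0 : ℂ × ℂ), g (z.1 ^ n, z.2) =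
        (∏ m ∈ Finset.range n, (z.2 - y (ζ ^ m * z.1))) * q (ζ ^ m * z.1, z.2) := by
      intro m _
      have h2 : Tendsto (fun z : ℂ × ℂ => (ζ ^ m * z.1, z.2)) (𝓝 0) (𝓝 0) := by
        have : Continuous (fun z : ℂ × ℂ => (ζ ^ m * z.1, z.2)) := by fun_prop
        exact this.tendsto' _ _ (by simp)
      filter_upwards [h2.eventually hgq] with z hz
      rwa [h.conj_pow, h.prod_conj] at hz
    have h3 : ∀ᶠ z in 𝓝 (0 : ℂ × ℂ), g (z.1 ^ n, z.2) =
        W (z.1 ^ n, z.2) * ((n : ℂ)⁻¹ * r (z.1 ^ n, z.2)) := by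
      filter_upwards [(Filter.eventually_all_finset _).mpr h1, hWp, hqr] with z h4 h5 h6
      rw [← h6, h5, Finset.mul_sum, Finset.mul_sum]
      have hn : (n : ℂ) ≠ 0 := by exact_mod_cast h.ne_zero
      rw [Finset.sum_congr rfl (fun m hm => by rw [mul_left_comm, ← h4 m hm])]
      simp [hn]
    filter_upwards [eventually_exists_root h3 h.ne_zero] with w ⟨t, ht, hw⟩
    rwa [ht] at hw

lemma NormalArc.zerosIn (h : NormalArc n ζ y) {W : ℂ × ℂ → ℂ}
    (hWp : ∀ᶠ z in 𝓝 (0 : ℂ × ℂ),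
      W (z.1 ^ n, z.2) = ∏ m ∈ Finset.range n, (z.2 - y (ζ ^ m * z.1))) :
    ZerosIn W (fun t => (t ^ n, y t)) := by
  intro U hU
  have h1 : ∀ m ∈ Finset.range n, ∀ᶠ z in 𝓝 (0 : ℂ × ℂ), ζ ^ m * z.1 ∈ U := by
    intro m _
    have : Continuous (fun z : ℂ × ℂ => ζ ^ m * z.1) := by fun_prop
    exact (this.tendsto' 0 0 (by simp)).eventually hU
  filter_upwards [eventually_exists_root
    (hWp.and ((Filter.eventually_all_finset _).mpr h1)) h.ne_zero] with w ⟨t, ht, hw, hU⟩ h0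
  rw [ht] at hw
  rw [show (w.1, w.2) = w from rfl, h0, eq_comm, Finset.prod_eq_zero_iff] at hw
  obtain ⟨m, hm, h2⟩ := hw
  refine ⟨ζ ^ m * t, hU m hm, ?_⟩
  rw [h.conj_pow, ht, ← sub_eq_zero.mp h2]

/-- The different of a branch. -/
lemma NormalArc.pd_eq (h : NormalArc n ζ y) {W : ℂ × ℂ → ℂ} (hW : AnalyticAt ℂ W 0)
    (hWp : ∀ᶠ z in 𝓝 (0 : ℂ × ℂ),
      W (z.1 ^ n, z.2) = ∏ m ∈ Finset.range n, (z.2 - y (ζ ^ m * z.1))) :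
    ∀ᶠ t in 𝓝 (0 : ℂ), pd (0, 1) W (t ^ n, y t) =
      ∏ m ∈ (Finset.range n).erase 0, (y t - y (ζ ^ m * t)) := by
  have h1 : ∀ᶠ z in 𝓝 (0 : ℂ × ℂ), DifferentiableAt ℂ W (z.1 ^ n, z.2) :=
    (tendsto_pow_fst h.ne_zero).eventually
      (hW.eventually_analyticAt.mono fun z hz => hz.differentiableAt)
  have h2 := (h.tendsto_graph 0).eventually (h1.and hWp.eventually_nhds)
  filter_upwards [h2] with t ht
  simp only [pow_zero, one_mul] at ht
  obtain ⟨hd, he⟩ := ht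
  have h3 : Tendsto (fun s : ℂ => (t, s)) (𝓝 (y t)) (𝓝 (t, y t)) :=
    (Continuous.prodMk_right t).tendsto _
  have h4 := h3.eventually he
  have h5 : HasDerivAt (fun s : ℂ => W (t ^ n, s)) (pd (0, 1) W (t ^ n, y t)) (y t) := by
    have := hd.hasFDerivAt.comp_hasDerivAt (y t)
      (HasDerivAt.prodMk (hasDerivAt_const (y t) (t ^ n)) (hasDerivAt_id (y t)))
    exact this
  have h6 : HasDerivAt (fun s : ℂ => ∏ m ∈ Finset.range n, (s - y (ζ ^ m * t)))
      (∏ m ∈ (Finset.range n).erase 0, (y t - y (ζ ^ m * t))) (y t) := by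
    have h0 : 0 ∈ Finset.range n := Finset.mem_range.mpr (Nat.pos_of_ne_zero h.ne_zero)
    have h7 : DifferentiableAt ℂ
        (fun s : ℂ => ∏ m ∈ (Finset.range n).erase 0, (s - y (ζ ^ m * t))) (y t) := by
      fun_prop
    -- The factor with `m = 0` vanishes at `s = y t`, so only the term in which this factor is
    -- differentiated survives.
    have h8 := ((hasDerivAt_id (y t)).sub_const (y t)).mul h7.hasDerivAt
    simp only [id, sub_self, zero_mul, add_zero, one_mul] at h8
    refine h8.congr_of_eventuallyEq (Eventually.of_forall fun s => ?_)
    dsimp only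
    rw [← Finset.mul_prod_erase _ _ h0]
    simp
  exact h5.unique (h6.congr_of_eventuallyEq h4)

lemma NormalArc.pd_ne_zero (h : NormalArc n ζ y) {W : ℂ × ℂ → ℂ} (hW : AnalyticAt ℂ W 0)
    (hWp : ∀ᶠ z in 𝓝 (0 : ℂ × ℂ),
      W (z.1 ^ n, z.2) = ∏ m ∈ Finset.range n, (z.2 - y (ζ ^ m * z.1))) :
    ∀ᶠ t in 𝓝[≠] (0 : ℂ), pd (0, 1) W (t ^ n, y t) ≠ 0 := by
  have h3 : ∀ j ∈ (Finset.range n).erase 0, ∀ᶠ t in 𝓝[≠] (0 : ℂ), y t ≠ y (ζ ^ j * t) := by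
    intro j hj
    rw [Finset.mem_erase, Finset.mem_range] at hj
    simpa using h.sep 0 (Nat.pos_of_ne_zero h.ne_zero) j hj.2 hj.1.symm
  filter_upwards [(Filter.eventually_all_finset _).mpr h3,
    nhdsWithin_le_nhds (h.pd_eq hW hWp)] with t h1 h2
  rw [h2]
  exact Finset.prod_ne_zero_iff.mpr fun j hj => sub_ne_zero.mpr (h1 j hj)

/-- Lagrange interpolation along a branch. -/
lemma NormalArc.exists_interpolation (h : NormalArc n ζ y) {g : ℂ → ℂ} (hg : AnalyticAt ℂ g 0) :
    ∃ F, AnalyticAt ℂ F 0 ∧ ∀ᶠ t in 𝓝 (0 : ℂ), F (t ^ n, y t) =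
      g t * ∏ m ∈ (Finset.range n).erase 0, (y t - y (ζ ^ m * t)) := by
  have h1 : AnalyticAt ℂ (fun z : ℂ × ℂ => g z.1 *
      ∏ m ∈ (Finset.range n).erase 0, (z.2 - y (ζ ^ m * z.1))) 0 :=
    (hg.fun_comp_of_eq analyticAt_fst rfl).mul (h.analyticAt_prod _)
  obtain ⟨F, hF, hFs⟩ := exists_trace h1 h.ne_zero h.root
  refine ⟨F, hF, ?_⟩
  have h0 : 0 ∈ Finset.range n := Finset.mem_range.mpr (Nat.pos_of_ne_zero h.ne_zero)
  filter_upwards [(h.tendsto_graph 0).eventually hFs] with t ht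
  simp only [pow_zero, one_mul] at ht
  rw [← ht, ← Finset.add_sum_erase _ _ h0, Finset.sum_eq_zero, add_zero]
  · simp
  · intro k hk
    rw [Finset.mem_erase, Finset.mem_range] at hk
    -- In the `k`-th conjugate the factor with index `n - k` is `y t - y (ζ ^ n * t) = 0`; only the
    -- conjugate `k = 0` contributes.
    refine mul_eq_zero_of_right _ (Finset.prod_eq_zero (i := n - k) ?_ ?_)
    · rw [Finset.mem_erase, Finset.mem_range]; omega
    · rw [← mul_assoc, ← pow_add, Nat.sub_add_cancel hk.2.le, h.root.pow_eq_one, one_mul, sub_self]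

end

/-! ### Primitive parametrizations and changes of parameter -/

/-- A primitive parametrized arc at the origin. -/
structure IsArc (δ : ℂ → ℂ × ℂ) : Prop where
  analyticAt : AnalyticAt ℂ δ 0
  map_zero : δ 0 = 0
  inj : ∃ U ∈ 𝓝 (0 : ℂ), Set.InjOn δ U

/-- A local change of parameter. -/
structure Reparam (l : ℂ → ℂ) : Prop where
  analyticAt : AnalyticAt ℂ l 0
  map_zero : l 0 = 0
  deriv_ne_zero : deriv l 0 ≠ 0

lemma Reparam.map_nhds {l : ℂ → ℂ} (hl : Reparam l) : map l (𝓝 0) = 𝓝 0 := by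
  have := hl.analyticAt.hasStrictDerivAt.map_nhds_eq hl.deriv_ne_zero
  rwa [hl.map_zero] at this

lemma Reparam.tendsto {l : ℂ → ℂ} (hl : Reparam l) : Tendsto l (𝓝 0) (𝓝 0) := hl.map_nhds.le

lemma Reparam.eventually {l : ℂ → ℂ} (hl : Reparam l) {P : ℂ → Prop} :
    (∀ᶠ t in 𝓝 (0 : ℂ), P (l t)) ↔ ∀ᶠ t in 𝓝 (0 : ℂ), P t := by
  conv_rhs => rw [← hl.map_nhds]
  rfl

lemma Reparam.exists_inverse {l : ℂ → ℂ} (hl : Reparam l) :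
    ∃ m, Reparam m ∧ (∀ᶠ t in 𝓝 (0 : ℂ), l (m t) = t) ∧ ∀ᶠ t in 𝓝 (0 : ℂ), m (l t) = t := by
  let m := hl.analyticAt.hasStrictDerivAt.localInverse _ _ _ hl.deriv_ne_zero
  have hm : AnalyticAt ℂ m (l 0) := hl.analyticAt.analyticAt_localInverse hl.deriv_ne_zero
  have h1 : ∀ᶠ t in 𝓝 (l 0), l (m t) = t :=
    HasStrictDerivAt.eventually_right_inverse hl.analyticAt.hasStrictDerivAt hl.deriv_ne_zero
  have h2 : ∀ᶠ t in 𝓝 (0 : ℂ), m (l t) = t :=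
    HasStrictDerivAt.eventually_left_inverse hl.analyticAt.hasStrictDerivAt hl.deriv_ne_zero
  have h3 : HasStrictDerivAt m (deriv l 0)⁻¹ (l 0) :=
    hl.analyticAt.hasStrictDerivAt.to_localInverse hl.deriv_ne_zero
  rw [hl.map_zero] at hm h1 h3
  refine ⟨m, ⟨hm, ?_, ?_⟩, h1, h2⟩
  · have := h2.self_of_nhds
    rwa [hl.map_zero] at this
  · rw [h3.hasDerivAt.deriv]
    exact inv_ne_zero hl.deriv_ne_zero

lemma Reparam.order {l : ℂ → ℂ} (hl : Reparam l) (F : ℂ → ℂ) :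
    analyticOrderAt (fun t => F (l t)) 0 = analyticOrderAt F 0 := by
  have := analyticOrderAt_comp_of_deriv_ne_zero (f := F) hl.analyticAt hl.deriv_ne_zero
  rwa [hl.map_zero] at this

lemma Reparam.injOn {l : ℂ → ℂ} (hl : Reparam l) : ∃ U ∈ 𝓝 (0 : ℂ), Set.InjOn l U := by
  obtain ⟨m, -, -, h⟩ := hl.exists_inverse
  exact ⟨_, h, fun a ha b hb hab => by rw [← show m (l a) = a from ha, hab]; exact hb⟩

section

variable {δ : ℂ → ℂ × ℂ} {l : ℂ → ℂ} {f : ℂ × ℂ → ℂ}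

lemma IsArc.tendsto (h : IsArc δ) : Tendsto δ (𝓝 0) (𝓝 0) := tendsto_zero h.analyticAt h.map_zero

lemma IsArc.comp (h : IsArc δ) (hl : Reparam l) : IsArc (fun t => δ (l t)) where
  analyticAt := h.analyticAt.fun_comp_of_eq hl.analyticAt hl.map_zero
  map_zero := by simp [hl.map_zero, h.map_zero]
  inj := by
    obtain ⟨U, hU, hi⟩ := h.inj
    obtain ⟨V, hV, hj⟩ := hl.injOn
    refine ⟨l ⁻¹' U ∩ V, inter_mem (hl.tendsto hU) hV, fun a ha b hb hab => ?_⟩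
    exact hj ha.2 hb.2 (hi ha.1 hb.1 hab)

lemma IsArc.swap (h : IsArc δ) : IsArc (fun t => (δ t).swap) where
  analyticAt := by
    have h1 : AnalyticAt ℂ (fun t => ((δ t).2, (δ t).1)) 0 :=
      (analyticAt_snd.comp h.analyticAt).prod (analyticAt_fst.comp h.analyticAt)
    exact h1
  map_zero := by simp [h.map_zero]
  inj := by
    obtain ⟨U, hU, hi⟩ := h.inj
    exact ⟨U, hU, fun a ha b hb hab => hi ha hb (Prod.swap_injective hab)⟩

lemma IsArc.fst_analyticAt (h : IsArc δ) : AnalyticAt ℂ (fun t => (δ t).1) 0 :=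
  analyticAt_fst.comp h.analyticAt

lemma IsArc.snd_analyticAt (h : IsArc δ) : AnalyticAt ℂ (fun t => (δ t).2) 0 :=
  analyticAt_snd.comp h.analyticAt

lemma IsArc.ne_zero (h : IsArc δ) : ∀ᶠ t in 𝓝[≠] (0 : ℂ), δ t ≠ 0 := by
  obtain ⟨U, hU, hi⟩ := h.inj
  filter_upwards [nhdsWithin_le_nhds hU, self_mem_nhdsWithin] with t ht h0 h1
  exact h0 (hi ht (mem_of_mem_nhds hU) (h1.trans h.map_zero.symm))

/-- An arc is not contained in both coordinate axes. -/
lemma IsArc.not_both (h : IsArc δ) (h1 : ∀ᶠ t in 𝓝 (0 : ℂ), (δ t).1 = 0)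
    (h2 : ∀ᶠ t in 𝓝 (0 : ℂ), (δ t).2 = 0) : False := by
  have h3 : ∀ᶠ t in 𝓝[≠] (0 : ℂ), δ t = 0 := nhdsWithin_le_nhds <| by
    filter_upwards [h1, h2] with t a b
    exact Prod.ext a b
  obtain ⟨t, ht⟩ := (h3.and h.ne_zero).exists
  exact ht.2 ht.1

lemma IsEqn.congr {δ' : ℂ → ℂ × ℂ} (h : IsEqn f δ) (he : ∀ᶠ t in 𝓝 (0 : ℂ), δ t = δ' t) :
    IsEqn f δ' where
  analyticAt := h.analyticAt
  vanish := by filter_upwards [h.vanish, he] with t h1 h2; rwa [← h2]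
  dvd g hg h0 := h.dvd g hg (by filter_upwards [h0, he] with t h1 h2; rwa [h2])

lemma IsEqn.comp_iff (hl : Reparam l) : IsEqn f (fun t => δ (l t)) ↔ IsEqn f δ := by
  have h1 : ∀ g : ℂ × ℂ → ℂ, (∀ᶠ t in 𝓝 (0 : ℂ), g (δ (l t)) = 0) ↔
      ∀ᶠ t in 𝓝 (0 : ℂ), g (δ t) = 0 := fun g => hl.eventually (P := fun t => g (δ t) = 0)
  exact ⟨fun h => ⟨h.analyticAt, (h1 f).mp h.vanish, fun g hg h0 => h.dvd g hg ((h1 g).mpr h0)⟩,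
    fun h => ⟨h.analyticAt, (h1 f).mpr h.vanish, fun g hg h0 => h.dvd g hg ((h1 g).mp h0)⟩⟩

lemma ZerosIn.of_comp (hl : Reparam l) (h : ZerosIn f (fun t => δ (l t))) : ZerosIn f δ := by
  intro U hU
  filter_upwards [h _ (hl.tendsto hU)] with z hz h0
  obtain ⟨t, ht, rfl⟩ := hz h0
  exact ⟨l t, ht, rfl⟩

lemma ZerosIn.congr {δ' : ℂ → ℂ × ℂ} (h : ZerosIn f δ) (he : ∀ᶠ t in 𝓝 (0 : ℂ), δ t = δ' t) :
    ZerosIn f δ' := by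
  intro U hU
  filter_upwards [h _ (inter_mem hU he)] with z hz h0
  obtain ⟨t, ht, rfl⟩ := hz h0
  exact ⟨t, ht.1, ht.2.symm⟩

lemma analyticAt_swap_comp (hf : AnalyticAt ℂ f 0) : AnalyticAt ℂ (fun z : ℂ × ℂ => f z.swap) 0 := by
  have h1 : AnalyticAt ℂ (fun z : ℂ × ℂ => (z.2, z.1)) 0 := analyticAt_snd.prod analyticAt_fst
  exact hf.fun_comp_of_eq h1 rfl

lemma tendsto_swap : Tendsto (Prod.swap : ℂ × ℂ → ℂ × ℂ) (𝓝 0) (𝓝 0) :=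
  continuous_swap.tendsto' _ _ rfl

lemma IsEqn.swap (h : IsEqn f δ) : IsEqn (fun z => f z.swap) (fun t => (δ t).swap) where
  analyticAt := analyticAt_swap_comp h.analyticAt
  vanish := by simpa using h.vanish
  dvd g hg h0 := by
    obtain ⟨q, hq, hgq⟩ := h.dvd (fun z => g z.swap) (analyticAt_swap_comp hg) h0
    refine ⟨fun z => q z.swap, analyticAt_swap_comp hq, ?_⟩
    filter_upwards [tendsto_swap.eventually hgq] with z hz
    simpa using hz

lemma ZerosIn.of_swap (h : ZerosIn (fun z => f z.swap) (fun t => (δ t).swap)) : ZerosIn f δ := by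
  intro U hU
  filter_upwards [tendsto_swap.eventually (h U hU)] with z hz h0
  obtain ⟨t, ht, h1⟩ := hz (by simpa using h0)
  exact ⟨t, ht, Prod.swap_injective h1⟩

/-- Two equations of the same arc differ by a unit. -/
lemma IsEqn.unique {g : ℂ × ℂ → ℂ} (hf : IsEqn f δ) (hg : IsEqn g δ) :
    ∃ u, AnalyticAt ℂ u 0 ∧ u 0 ≠ 0 ∧ ∀ᶠ z in 𝓝 (0 : ℂ × ℂ), g z = f z * u z := by
  obtain ⟨q, hq, h1⟩ := hf.dvd g hg.analyticAt hg.vanish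
  obtain ⟨r, hr, h2⟩ := hg.dvd f hf.analyticAt hf.vanish
  by_cases h0 : q 0 = 0
  -- If `q 0 = 0`, then `1 - q * r` is a unit that annihilates `f`; so both functions vanish near
  -- the origin and any unit will do.
  · refine ⟨1, analyticAt_const, one_ne_zero, ?_⟩
    have h3 : Tendsto (fun z => 1 - q z * r z) (𝓝 0) (𝓝 (1 - q 0 * r 0)) :=
      (tendsto_const_nhds.sub (hq.continuousAt.mul hr.continuousAt))
    have h4 : ∀ᶠ z in 𝓝 (0 : ℂ × ℂ), 1 - q z * r z ≠ 0 :=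
      h3.eventually_ne (by simp [h0])
    filter_upwards [h1, h2, h4] with z h1 h2 h4
    have h5 : f z * (1 - q z * r z) = 0 := by rw [mul_sub, ← mul_assoc, ← h1, ← h2]; ring
    have h6 := (mul_eq_zero.mp h5).resolve_right h4
    rw [h1, h6]; simp
  · exact ⟨q, hq, h0, h1⟩

lemma IsEqn.mul_unit {g u : ℂ × ℂ → ℂ} (hf : IsEqn f δ) (hg : AnalyticAt ℂ g 0)
    (hδ : Tendsto δ (𝓝 0) (𝓝 0)) (hu : AnalyticAt ℂ u 0)
    (hu0 : u 0 ≠ 0) (h : ∀ᶠ z in 𝓝 (0 : ℂ × ℂ), g z = f z * u z) : IsEqn g δ where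
  analyticAt := hg
  vanish := by
    filter_upwards [hf.vanish, hδ.eventually h] with t h1 h2
    rw [h2, h1, zero_mul]
  dvd k hk h0 := by
    obtain ⟨q, hq, h1⟩ := hf.dvd k hk h0
    refine ⟨fun z => q z * (u z)⁻¹, hq.mul (hu.inv hu0), ?_⟩
    filter_upwards [h, h1, hu.continuousAt.eventually_ne hu0] with z h2 h3 h4
    rw [h2, h3]; field_simp

lemma order_eq_zero_of_ne {u : ℂ → ℂ} (h : u 0 ≠ 0) : analyticOrderAt u 0 = 0 :=
  analyticOrderAt_eq_zero.mpr (Or.inr h)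

lemma order_mul_unit {a u : ℂ → ℂ} (ha : AnalyticAt ℂ a 0) (hu : AnalyticAt ℂ u 0) (h : u 0 ≠ 0) :
    analyticOrderAt (fun t => a t * u t) 0 = analyticOrderAt a 0 := by
  have := analyticOrderAt_mul ha hu
  rw [order_eq_zero_of_ne h, add_zero] at this
  exact this

/-- Orders along an arc do not depend on the choice of the equation. -/
lemma IsEqn.order_pd_eq {g : ℂ × ℂ → ℂ} (hδ : AnalyticAt ℂ δ 0) (hδ0 : δ 0 = 0)
    (hf : IsEqn f δ) (hg : IsEqn g δ) (v : ℂ × ℂ) :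
    analyticOrderAt (fun t => pd v g (δ t)) 0 = analyticOrderAt (fun t => pd v f (δ t)) 0 := by
  obtain ⟨u, hu, hu0, h⟩ := hf.unique hg
  have ht := tendsto_zero hδ hδ0
  rw [← order_mul_unit (u := fun t => u (δ t)) ((analyticAt_pd hf.analyticAt v).fun_comp_of_eq hδ hδ0)
    (hu.fun_comp_of_eq hδ hδ0) (by simpa [hδ0] using hu0)]
  refine analyticOrderAt_congr ?_
  filter_upwards [ht.eventually h.eventually_nhds, hf.vanish,
    ht.eventually hf.analyticAt.eventually_analyticAt,
    ht.eventually hu.eventually_analyticAt] with t h1 h2 h3 h4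
  -- In the product rule the term `f * du` vanishes along the arc.
  have h5 : fderiv ℂ g (δ t) = fderiv ℂ (fun z => f z * u z) (δ t) := Filter.EventuallyEq.fderiv_eq h1
  rw [pd, pd, h5, fderiv_fun_mul h3.differentiableAt h4.differentiableAt]
  simp [h2, mul_comm]

lemma IsEqn.order_eq {g : ℂ × ℂ → ℂ} {ε : ℂ → ℂ × ℂ} (hε : AnalyticAt ℂ ε 0) (hε0 : ε 0 = 0)
    (hf : IsEqn f δ) (hg : IsEqn g δ) :
    analyticOrderAt (fun t => g (ε t)) 0 = analyticOrderAt (fun t => f (ε t)) 0 := by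
  obtain ⟨u, hu, hu0, h⟩ := hf.unique hg
  rw [← order_mul_unit (u := fun t => u (ε t)) (hf.analyticAt.fun_comp_of_eq hε hε0)
    (hu.fun_comp_of_eq hε hε0) (by simpa [hε0] using hu0)]
  exact analyticOrderAt_congr ((tendsto_zero hε hε0).eventually h)

/-- The quotient of analytic functions is analytic if the orders allow it. -/
lemma exists_eq_mul_of_order_le {D H : ℂ → ℂ} (hD : AnalyticAt ℂ D 0) (hH : AnalyticAt ℂ H 0)
    (h : analyticOrderAt D 0 ≤ analyticOrderAt H 0) (hD0 : analyticOrderAt D 0 ≠ ⊤) :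
    ∃ g, AnalyticAt ℂ g 0 ∧ ∀ᶠ t in 𝓝 (0 : ℂ), H t = g t * D t := by
  obtain ⟨n, hn⟩ := ENat.ne_top_iff_exists.mp hD0
  obtain ⟨d, hd, hd0, h1⟩ := (hD.analyticOrderAt_eq_natCast).mp hn.symm
  rw [← hn] at h
  obtain ⟨k, hk, h2⟩ := (natCast_le_analyticOrderAt hH).mp h
  refine ⟨fun t => k t * (d t)⁻¹, hk.mul (hd.inv hd0), ?_⟩
  filter_upwards [h1, h2, hd.continuousAt.eventually_ne hd0] with t h1 h2 h3
  rw [h1, h2, smul_eq_mul, smul_eq_mul]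
  field_simp

/-- The normal form of an arc not contained in the vertical axis. -/
lemma IsArc.exists_normal (h : IsArc δ) (hx : ¬ ∀ᶠ t in 𝓝 (0 : ℂ), (δ t).1 = 0) :
    ∃ n ζ y l, NormalArc n ζ y ∧ Reparam l ∧ (∀ᶠ s in 𝓝 (0 : ℂ), δ (l s) = (s ^ n, y s)) ∧
      analyticOrderAt (fun t => (δ t).1) 0 = n := by
  have hx1 := h.fst_analyticAt
  obtain ⟨n, hn⟩ := ENat.ne_top_iff_exists.mp (mt analyticOrderAt_eq_top.mp hx)
  obtain ⟨g, hg, hg0, hxg⟩ := hx1.analyticOrderAt_eq_natCast.mp hn.symm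
  have hn0 : n ≠ 0 := by
    rintro rfl
    refine (hx1.analyticOrderAt_eq_zero.mp hn.symm) (by simp [h.map_zero])
  have hnC : (n : ℂ) ≠ 0 := by exact_mod_cast hn0
  obtain ⟨c, hc⟩ := IsAlgClosed.exists_pow_nat_eq (g 0) (Nat.pos_of_ne_zero hn0)
  have hc0 : c ≠ 0 := by rintro rfl; exact hg0 (by rw [← hc, zero_pow hn0])
  -- This is an analytic `n`-th root of `g`, where the first coordinate is `t ^ n * g t`. Dividing
  -- by `g 0` brings the argument of the logarithm close to one, away from the cut. The new
  -- parameter is then `t * r t`.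
  let r : ℂ → ℂ := fun t => c * Complex.exp (Complex.log (g t / g 0) / n)
  have hgd : AnalyticAt ℂ (fun t => g t / g 0) 0 := hg.div analyticAt_const hg0
  have hr : AnalyticAt ℂ r 0 :=
    analyticAt_const.mul (((hgd.clog (by simp [hg0])).div analyticAt_const hnC).cexp)
  have hr0 : r 0 ≠ 0 := mul_ne_zero hc0 (Complex.exp_ne_zero _)
  have hrn : ∀ᶠ t in 𝓝 (0 : ℂ), r t ^ n = g t := by
    filter_upwards [hg.continuousAt.eventually_ne hg0] with t ht
    simp only [r]
    rw [mul_pow, hc, ← Complex.exp_nat_mul, mul_div_cancel₀ _ hnC,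
      Complex.exp_log (div_ne_zero ht hg0), mul_div_cancel₀ _ hg0]
  have hψ : Reparam (fun t => t * r t) := by
    refine ⟨analyticAt_id.mul hr, by simp, ?_⟩
    have := (hasDerivAt_id (0 : ℂ)).mul hr.differentiableAt.hasDerivAt
    have h2 : deriv (fun t => t * r t) 0 = _ := this.deriv
    rw [h2]
    simpa using hr0
  obtain ⟨l, hl, hl1, hl2⟩ := hψ.exists_inverse
  have hζ := Complex.isPrimitiveRoot_exp n hn0
  have ha := h.comp hl
  refine ⟨n, _, fun s => (δ (l s)).2, l, ⟨hn0, hζ, ha.snd_analyticAt, by simp [ha.map_zero], ?_⟩,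
    hl, ?_, hn.symm⟩
  swap
  · filter_upwards [hl.tendsto.eventually hxg, hl.tendsto.eventually hrn, hl1] with s h1 h2 h3
    refine Prod.ext ?_ rfl
    dsimp only
    rw [h1, smul_eq_mul, sub_zero, ← h2, ← mul_pow, h3]
  · intro i hi j hj hij
    have key : ∀ᶠ s in 𝓝 (0 : ℂ), (δ (l s)).1 = s ^ n := by
      filter_upwards [hl.tendsto.eventually hxg, hl.tendsto.eventually hrn, hl1] with s h1 h2 h3
      rw [h1, smul_eq_mul, sub_zero, ← h2, ← mul_pow, h3]
    obtain ⟨U, hU, hinj⟩ := ha.inj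
    set ζ := Complex.exp (2 * Real.pi * Complex.I / n)
    have hm : ∀ k, ∀ᶠ t in 𝓝[≠] (0 : ℂ), ζ ^ k * t ∈ U ∧ (δ (l (ζ ^ k * t))).1 = (ζ ^ k * t) ^ n :=
      fun k => nhdsWithin_le_nhds ((tendsto_const_mul_zero (ζ ^ k)).eventually
        (Filter.Eventually.and hU key))
    filter_upwards [hm i, hm j, self_mem_nhdsWithin] with t h1 h2 h0 h3
    have hp : ∀ k, (ζ ^ k * t) ^ n = t ^ n := fun k => by
      rw [mul_pow, ← pow_mul, mul_comm k, pow_mul, hζ.pow_eq_one, one_pow, one_mul]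
    -- Conjugate parameters have the same first coordinate, so equal second coordinates would
    -- contradict the injectivity of the arc.
    have h4 := hinj h1.1 h2.1 (Prod.ext (by rw [h1.2, h2.2, hp, hp]) h3)
    exact hij (hζ.pow_inj hi hj (mul_right_cancel₀ h0 h4))

end

/-! ### Equations of arcs and the extension of functions from a single branch. -/

section

variable {δ : ℂ → ℂ × ℂ} {f : ℂ × ℂ → ℂ}

lemma IsArc.exists_isEqn_of_fst (h : IsArc δ) (hx : ¬ ∀ᶠ t in 𝓝 (0 : ℂ), (δ t).1 = 0) :
    ∃ f, IsEqn f δ ∧ ZerosIn f δ := by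
  obtain ⟨n, ζ, y, l, hN, hl, he, -⟩ := h.exists_normal hx
  obtain ⟨W, hW, hWp⟩ := hN.exists_weierstrass
  exact ⟨W, (IsEqn.comp_iff hl).mp ((hN.isEqn hW hWp).congr (he.mono fun _ => Eq.symm)),
    ((hN.zerosIn hWp).congr (he.mono fun _ => Eq.symm)).of_comp hl⟩

/-- Every arc has an equation. -/
lemma IsArc.exists_isEqn (h : IsArc δ) : ∃ f, IsEqn f δ ∧ ZerosIn f δ := by
  by_cases hx : ∀ᶠ t in 𝓝 (0 : ℂ), (δ t).1 = 0
  · obtain ⟨f, hf, hz⟩ := h.swap.exists_isEqn_of_fst fun hy => h.not_both hx hy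
    exact ⟨fun z => f z.swap, by simpa using hf.swap, ZerosIn.of_swap (by simpa using hz)⟩
  · exact h.exists_isEqn_of_fst hx

/-- The zero set of the equation of an arc is the image of the arc. -/
lemma IsEqn.zerosIn (hf : IsEqn f δ) (h : IsArc δ) : ZerosIn f δ := by
  obtain ⟨g, hg, hz⟩ := h.exists_isEqn
  obtain ⟨u, hu, hu0, hgu⟩ := hf.unique hg
  intro U hU
  filter_upwards [hz U hU, hgu] with z h1 h2 h3
  exact h1 (by rw [h2, h3, zero_mul])

/-- In the normal form, the derivative of the Weierstrass polynomial along the branch is the product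
of the differences of conjugates, which is not identically zero. A datum of at least this order is
`g` times the product, and `g` is fed into the interpolation. -/
lemma IsArc.exists_lift_of_snd (h : IsArc δ) (hf : IsEqn f δ)
    (hx : ¬ ∀ᶠ t in 𝓝 (0 : ℂ), (δ t).1 = 0) :
    analyticOrderAt (fun t => pd (0, 1) f (δ t)) 0 ≠ ⊤ ∧ ∀ k : ℂ → ℂ, AnalyticAt ℂ k 0 →
      analyticOrderAt (fun t => pd (0, 1) f (δ t)) 0 ≤ analyticOrderAt k 0 →
      ∃ F, AnalyticAt ℂ F 0 ∧ ∀ᶠ t in 𝓝 (0 : ℂ), F (δ t) = k t := by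
  obtain ⟨n, ζ, y, l, hN, hl, he, -⟩ := h.exists_normal hx
  obtain ⟨W, hW, hWp⟩ := hN.exists_weierstrass
  have hWδ : IsEqn W δ :=
    (IsEqn.comp_iff hl).mp ((hN.isEqn hW hWp).congr (he.mono fun _ => Eq.symm))
  have hord : analyticOrderAt (fun t => pd (0, 1) f (δ t)) 0 =
      analyticOrderAt (fun s => pd (0, 1) W (s ^ n, y s)) 0 := by
    rw [IsEqn.order_pd_eq h.analyticAt h.map_zero hWδ hf,
      ← hl.order (fun t => pd (0, 1) W (δ t))]
    exact analyticOrderAt_congr (he.mono fun s hs => by simp only [hs])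
  have hne : analyticOrderAt (fun s => pd (0, 1) W (s ^ n, y s)) 0 ≠ ⊤ := by
    intro h1
    obtain ⟨t, ht⟩ := (((analyticOrderAt_eq_top.mp h1).filter_mono nhdsWithin_le_nhds).and
      (hN.pd_ne_zero hW hWp)).exists
    exact ht.2 ht.1
  have han : AnalyticAt ℂ (fun s => pd (0, 1) W (s ^ n, y s)) 0 :=
    (analyticAt_pd hW _).fun_comp_of_eq ((analyticAt_id.pow n).prod hN.analyticAt)
      (by simp [hN.map_zero, hN.ne_zero])
  rw [hord]
  refine ⟨hne, fun k hk hle => ?_⟩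
  obtain ⟨g, hg, hkg⟩ := exists_eq_mul_of_order_le (H := fun s => k (l s)) han
    (hk.fun_comp_of_eq hl.analyticAt hl.map_zero) (by rwa [hl.order]) hne
  obtain ⟨F, hF, hFi⟩ := hN.exists_interpolation hg
  refine ⟨F, hF, hl.eventually.mp ?_⟩
  filter_upwards [hkg, hFi, he, hN.pd_eq hW hWp] with s h1 h2 h3 h4
  rw [h1, h3, h2, h4]

/-- The relation between the partial derivatives of a function along an arc on which it vanishes. -/
lemma pd_relation (hf : AnalyticAt ℂ f 0) (hδ : AnalyticAt ℂ δ 0) (hδ0 : δ 0 = 0)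
    (h0 : ∀ᶠ t in 𝓝 (0 : ℂ), f (δ t) = 0) :
    analyticOrderAt (fun t => pd (1, 0) f (δ t)) 0 + analyticOrderAt (fun t => (δ t).1) 0 =
      analyticOrderAt (fun t => pd (0, 1) f (δ t)) 0 + analyticOrderAt (fun t => (δ t).2) 0 := by
  have h1 : AnalyticAt ℂ (fun t => (δ t).1) 0 := analyticAt_fst.comp hδ
  have h2 : AnalyticAt ℂ (fun t => (δ t).2) 0 := analyticAt_snd.comp hδ
  have e1 := h1.analyticOrderAt_deriv_add_one
  have e2 := h2.analyticOrderAt_deriv_add_one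
  simp only [hδ0, Prod.fst_zero, Prod.snd_zero, sub_zero] at e1 e2
  have k1 : AnalyticAt ℂ (fun t => pd (1, 0) f (δ t)) 0 :=
    (analyticAt_pd hf _).fun_comp_of_eq hδ hδ0
  have k2 : AnalyticAt ℂ (fun t => pd (0, 1) f (δ t)) 0 :=
    (analyticAt_pd hf _).fun_comp_of_eq hδ hδ0
  -- Differentiating `f (δ t) = 0` gives `f_x x' = - f_y y'`. The orders of `x'` and `y'` are one
  -- less than those of `x` and `y`, so one is added on both sides.
  rw [← e1, ← e2, ← add_assoc, ← add_assoc, ← analyticOrderAt_mul k1 h1.deriv,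
    ← analyticOrderAt_mul k2 h2.deriv]
  congr 1
  rw [← analyticOrderAt_neg]
  refine analyticOrderAt_congr ?_
  filter_upwards [h0.eventually_nhds, (tendsto_zero hδ hδ0).eventually hf.eventually_analyticAt,
    hδ.eventually_analyticAt] with t ht hft hδt
  have d0 : HasDerivAt δ (deriv δ t) t := hδt.differentiableAt.hasDerivAt
  have d1 : HasDerivAt (fun t => (δ t).1) (deriv δ t).1 t :=
    (ContinuousLinearMap.fst ℂ ℂ ℂ).hasFDerivAt.comp_hasDerivAt t d0
  have d2 : HasDerivAt (fun t => (δ t).2) (deriv δ t).2 t :=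
    (ContinuousLinearMap.snd ℂ ℂ ℂ).hasFDerivAt.comp_hasDerivAt t d0
  have d3 : HasDerivAt (fun t => f (δ t)) (fderiv ℂ f (δ t) (deriv δ t)) t :=
    hft.differentiableAt.hasFDerivAt.comp_hasDerivAt t d0
  have d4 : fderiv ℂ f (δ t) (deriv δ t) = 0 :=
    d3.unique ((hasDerivAt_const t (0 : ℂ)).congr_of_eventuallyEq ht)
  have d5 : deriv δ t = (deriv δ t).1 • ((1 : ℂ), (0 : ℂ)) + (deriv δ t).2 • ((0 : ℂ), (1 : ℂ)) := by
    ext <;> simp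
  rw [d5, map_add, map_smul, map_smul, smul_eq_mul, smul_eq_mul] at d4
  simp only [Pi.neg_apply, Pi.mul_apply, d1.deriv, d2.deriv, pd]
  linear_combination -d4

/-- The least order at which functions along an arc are seen to extend to the plane. -/
noncomputable def different (f : ℂ × ℂ → ℂ) (δ : ℂ → ℂ × ℂ) : ℕ∞ :=
  min (analyticOrderAt (fun t => pd (1, 0) f (δ t)) 0)
    (analyticOrderAt (fun t => pd (0, 1) f (δ t)) 0)

lemma pd_swap (v : ℂ × ℂ) {z : ℂ × ℂ} (hf : AnalyticAt ℂ f z) :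
    pd v.swap (fun w => f w.swap) z.swap = pd v f z := by
  have h1 : HasFDerivAt (Prod.swap : ℂ × ℂ → ℂ × ℂ)
      ((ContinuousLinearMap.snd ℂ ℂ ℂ).prod (ContinuousLinearMap.fst ℂ ℂ ℂ)) z.swap :=
    ((ContinuousLinearMap.snd ℂ ℂ ℂ).prod (ContinuousLinearMap.fst ℂ ℂ ℂ)).hasFDerivAt
  have h2 : HasFDerivAt f (fderiv ℂ f z) z.swap.swap := by
    simpa using hf.differentiableAt.hasFDerivAt
  have h3 := (h2.comp z.swap h1).fderiv
  have h4 : fderiv ℂ (fun w => f w.swap) z.swap = _ := h3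
  rw [pd, pd, h4]
  rfl

lemma order_pd_swap (v : ℂ × ℂ) (hf : AnalyticAt ℂ f 0) (h : IsArc δ) :
    analyticOrderAt (fun t => pd v.swap (fun w => f w.swap) (δ t).swap) 0 =
      analyticOrderAt (fun t => pd v f (δ t)) 0 := by
  refine analyticOrderAt_congr ?_
  filter_upwards [h.tendsto.eventually hf.eventually_analyticAt] with t ht
  exact pd_swap v ht

lemma order_pd_ne_top_or (h : IsArc δ) (hf : IsEqn f δ) : different f δ ≠ ⊤ := by
  by_cases hx : ∀ᶠ t in 𝓝 (0 : ℂ), (δ t).1 = 0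
  · have h1 := (h.swap.exists_lift_of_snd hf.swap fun hy => h.not_both hx hy).1
    rw [show ((0 : ℂ), (1 : ℂ)) = Prod.swap (1, 0) from rfl, order_pd_swap _ hf.analyticAt h] at h1
    exact fun h2 => h1 (top_le_iff.mp (h2 ▸ min_le_left _ _))
  · have h1 := (h.exists_lift_of_snd hf hx).1
    exact fun h2 => h1 (top_le_iff.mp (h2 ▸ min_le_right _ _))

lemma exists_lift_of_top {k : ℂ → ℂ} (hk : analyticOrderAt k 0 = ⊤) :
    ∃ F : ℂ × ℂ → ℂ, AnalyticAt ℂ F 0 ∧ ∀ᶠ t in 𝓝 (0 : ℂ), F (δ t) = k t :=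
  ⟨0, analyticAt_const, (analyticOrderAt_eq_top.mp hk).mono fun t ht => by simp [ht]⟩

lemma IsArc.exists_lift_snd (h : IsArc δ) (hf : IsEqn f δ) {k : ℂ → ℂ} (hk : AnalyticAt ℂ k 0)
    (hle : analyticOrderAt (fun t => pd (0, 1) f (δ t)) 0 ≤ analyticOrderAt k 0) :
    ∃ F, AnalyticAt ℂ F 0 ∧ ∀ᶠ t in 𝓝 (0 : ℂ), F (δ t) = k t := by
  by_cases hx : ∀ᶠ t in 𝓝 (0 : ℂ), (δ t).1 = 0
  -- On the vertical axis the relation forces `f_y` to vanish identically along the arc, so the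
  -- order hypothesis leaves only the datum zero.
  · have h1 := pd_relation hf.analyticAt h.analyticAt h.map_zero hf.vanish
    rw [analyticOrderAt_eq_top.mpr hx, add_top, eq_comm, ENat.add_eq_top] at h1
    rcases h1 with h1 | h1
    · rw [h1, top_le_iff] at hle
      exact exists_lift_of_top hle
    · exact (h.not_both hx (analyticOrderAt_eq_top.mp h1)).elim
  · exact (h.exists_lift_of_snd hf hx).2 k hk hle

/-- Functions of sufficiently high order along an arc extend to the plane. -/
lemma IsArc.exists_lift (h : IsArc δ) (hf : IsEqn f δ) {k : ℂ → ℂ} (hk : AnalyticAt ℂ k 0)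
    (hle : different f δ ≤ analyticOrderAt k 0) :
    ∃ F, AnalyticAt ℂ F 0 ∧ ∀ᶠ t in 𝓝 (0 : ℂ), F (δ t) = k t := by
  rcases min_le_iff.mp hle with h1 | h1
  · rw [← order_pd_swap _ hf.analyticAt h] at h1
    obtain ⟨F, hF, he⟩ := h.swap.exists_lift_snd hf.swap hk h1
    exact ⟨fun z => F z.swap, analyticAt_swap_comp hF, he⟩
  · exact h.exists_lift_snd hf hk h1

end

/-! ### Equations of arcs under a blowing-up -/

/-- The coordinate of the chart in the direction `d` that defines the exceptional divisor. -/
def exc : Direction → ℂ × ℂ → ℂ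
  | .slope _, z => z.1
  | .vertical, z => z.2

lemma analyticAt_exc (d : Direction) (z : ℂ × ℂ) : AnalyticAt ℂ (exc d) z := by
  cases d
  · exact analyticAt_fst
  · exact analyticAt_snd

lemma analyticAt_blowUpChart (d : Direction) (z : ℂ × ℂ) : AnalyticAt ℂ (blowUpChart d) z := by
  cases d with
  | slope c => exact analyticAt_fst.prod (analyticAt_fst.mul (analyticAt_snd.add analyticAt_const))
  | vertical => exact (analyticAt_fst.mul analyticAt_snd).prod analyticAt_snd

@[simp] lemma blowUpChart_zero (d : Direction) : blowUpChart d 0 = 0 := by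
  cases d <;> simp [blowUpChart]

lemma blowUpChart_eq_zero_iff (d : Direction) (z : ℂ × ℂ) : blowUpChart d z = 0 ↔ exc d z = 0 := by
  cases d <;> simp +contextual [blowUpChart, exc, Prod.ext_iff]

lemma blowUpChart_inj (d : Direction) {z w : ℂ × ℂ} (h : blowUpChart d z = blowUpChart d w)
    (hz : blowUpChart d z ≠ 0) : z = w := by
  have hz' := mt (blowUpChart_eq_zero_iff d z).mpr hz
  cases d with
  | slope c =>
    simp only [blowUpChart, Prod.mk.injEq, exc] at h hz'
    obtain ⟨h1, h2⟩ := h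
    rw [← h1] at h2
    exact Prod.ext h1 (add_right_cancel (mul_left_cancel₀ hz' h2))
  | vertical =>
    simp only [blowUpChart, Prod.mk.injEq, exc] at h hz'
    obtain ⟨h1, h2⟩ := h
    rw [← h2] at h1
    exact Prod.ext (mul_right_cancel₀ hz' h1) h2

/-- The exchange of coordinates turns the vertical chart into the chart of slope zero, so
computations can be carried out for slopes. -/
lemma blowUpChart_vertical (z : ℂ × ℂ) :
    (blowUpChart .vertical z).swap = blowUpChart (.slope 0) z.swap := by
  simp [blowUpChart, mul_comm]

/-- The order in `t` of an analytic function bounded by another one. -/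
lemma order_le_of_bound {G E : ℂ → ℂ} (hG : AnalyticAt ℂ G 0) (hE : AnalyticAt ℂ E 0) (K : ℝ)
    (h : ∀ᶠ t in 𝓝 (0 : ℂ), ‖G t‖ ≤ K * ‖E t‖) : analyticOrderAt E 0 ≤ analyticOrderAt G 0 := by
  by_cases hGt : analyticOrderAt G 0 = ⊤
  · rw [hGt]; exact le_top
  obtain ⟨a, ha⟩ := ENat.ne_top_iff_exists.mp hGt
  rw [← ha]
  by_contra! hlt
  have h1 : ((a + 1 : ℕ) : ℕ∞) ≤ analyticOrderAt E 0 := by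
    push_cast
    exact Order.add_one_le_of_lt hlt
  obtain ⟨g, hg, hg0, h2⟩ := hG.analyticOrderAt_eq_natCast.mp ha.symm
  obtain ⟨k, hk, h3⟩ := (natCast_le_analyticOrderAt hE).mp h1
  -- After division by `t ^ a` the left side tends to `‖g 0‖ ≠ 0`, while the right side tends to
  -- zero.
  have h4 : ∀ᶠ t in 𝓝[≠] (0 : ℂ), ‖g t‖ ≤ K * ‖t * k t‖ := by
    filter_upwards [nhdsWithin_le_nhds h, nhdsWithin_le_nhds h2, nhdsWithin_le_nhds h3,
      self_mem_nhdsWithin] with t h5 h6 h7 h8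
    rw [h6, h7, smul_eq_mul, smul_eq_mul, sub_zero, pow_succ, mul_assoc, norm_mul, norm_mul,
      mul_left_comm] at h5
    exact le_of_mul_le_mul_left h5 (norm_pos_iff.mpr (pow_ne_zero _ h8))
  have h5 : Tendsto (fun t => ‖g t‖) (𝓝[≠] 0) (𝓝 ‖g 0‖) :=
    hg.continuousAt.norm.tendsto.mono_left nhdsWithin_le_nhds
  have h6 : Tendsto (fun t => K * ‖t * k t‖) (𝓝[≠] 0) (𝓝 (K * ‖0 * k 0‖)) :=
    ((continuousAt_id.mul hk.continuousAt).norm.const_mul K).tendsto.mono_left nhdsWithin_le_nhds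
  have h7 := le_of_tendsto_of_tendsto h5 h6 h4
  simp at h7
  exact hg0 h7

lemma order_pow_mul {a b : ℂ → ℂ} (ha : AnalyticAt ℂ a 0) (hb : AnalyticAt ℂ b 0) (n : ℕ) :
    analyticOrderAt (fun t => a t ^ n * b t) 0 = n * analyticOrderAt a 0 + analyticOrderAt b 0 := by
  have h1 := analyticOrderAt_mul (ha.pow n) hb
  rw [analyticOrderAt_pow ha, nsmul_eq_mul] at h1
  exact h1

section

variable {ε : ℂ → ℂ × ℂ} {f g : ℂ × ℂ → ℂ}

lemma IsArc.exc_analyticAt (h : IsArc ε) (d : Direction) : AnalyticAt ℂ (fun t => exc d (ε t)) 0 :=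
  (analyticAt_exc d _).fun_comp_of_eq h.analyticAt rfl

lemma IsArc.exc_ne_zero (h : IsArc ε) {d : Direction} (hx : ¬ ∀ᶠ t in 𝓝 (0 : ℂ), exc d (ε t) = 0) :
    ∀ᶠ t in 𝓝[≠] (0 : ℂ), exc d (ε t) ≠ 0 :=
  (h.exc_analyticAt d).eventually_eq_zero_or_eventually_ne_zero.resolve_left hx

/-- Blowing down is injective off the exceptional divisor, which the arc meets only at `t = 0` near
the origin; this preserves primitivity. -/
lemma IsArc.blowUp (h : IsArc ε) {d : Direction} (hx : ¬ ∀ᶠ t in 𝓝 (0 : ℂ), exc d (ε t) = 0) :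
    IsArc (fun t => blowUpChart d (ε t)) where
  analyticAt := (analyticAt_blowUpChart d _).fun_comp_of_eq h.analyticAt rfl
  map_zero := by simp [h.map_zero]
  inj := by
    obtain ⟨U, hU, hi⟩ := h.inj
    have h1 := eventually_nhdsWithin_iff.mp (h.exc_ne_zero hx)
    have key : ∀ a ∈ U ∩ {t | t ∈ ({0}ᶜ : Set ℂ) → exc d (ε t) ≠ 0}, ∀ b ∈ U,
        blowUpChart d (ε a) = blowUpChart d (ε b) → a ≠ 0 → a = b := fun a ha b hb hab ha0 =>
      hi ha.1 hb (blowUpChart_inj d hab (mt (blowUpChart_eq_zero_iff d _).mp (ha.2 ha0)))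
    refine ⟨_, inter_mem hU h1, fun a ha b hb hab => ?_⟩
    by_cases ha0 : a = 0
    · by_cases hb0 : b = 0
      · rw [ha0, hb0]
      · exact (key b hb a ha.1 hab.symm hb0).symm
    · exact key a ha b hb.1 hab ha0

/-- A chart of finite slope keeps the first coordinate `s ^ n`, so `n` and `ζ` are unchanged, and
differences of conjugates are multiplied by `s ^ n`. -/
lemma NormalArc.blowUp {n : ℕ} {ζ : ℂ} {v : ℂ → ℂ} (h : NormalArc n ζ v) (c : ℂ) :
    NormalArc n ζ (fun s => s ^ n * (v s + c)) where
  ne_zero := h.ne_zero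
  root := h.root
  analyticAt := (analyticAt_id.pow n).mul (h.analyticAt.add analyticAt_const)
  map_zero := by simp [h.ne_zero]
  sep i hi j hj hij := by
    filter_upwards [h.sep i hi j hj hij, self_mem_nhdsWithin] with t h1 h0 h2
    rw [h.conj_pow, h.conj_pow] at h2
    exact h1 (add_right_cancel (mul_left_cancel₀ (pow_ne_zero n h0) h2))

/-- Substituting the chart into the Weierstrass polynomial below turns each of its `n` factors into
`z.1` times the corresponding factor above. The exponent is therefore the order of the first
coordinate. -/
lemma IsArc.exists_isEqn_slope (h : IsArc ε) (c : ℂ) (hx : ¬ ∀ᶠ t in 𝓝 (0 : ℂ), (ε t).1 = 0) :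
    ∃ f g, ∃ m : ℕ, IsEqn f (fun t => blowUpChart (.slope c) (ε t)) ∧ IsEqn g ε ∧
      analyticOrderAt (fun t => (ε t).1) 0 = m ∧
      ∀ᶠ z in 𝓝 (0 : ℂ × ℂ), f (blowUpChart (.slope c) z) = z.1 ^ m * g z := by
  obtain ⟨n, ζ, v, l, hN, hl, he, hn⟩ := h.exists_normal hx
  obtain ⟨V, hV, hVp⟩ := hN.exists_weierstrass
  obtain ⟨W, hW, hWp⟩ := (hN.blowUp c).exists_weierstrass
  refine ⟨W, V, n, (IsEqn.comp_iff hl).mp (((hN.blowUp c).isEqn hW hWp).congr ?_),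
    (IsEqn.comp_iff hl).mp ((hN.isEqn hV hVp).congr (he.mono fun _ => Eq.symm)), hn, ?_⟩
  · filter_upwards [he] with s hs
    rw [hs]; rfl
  · have h1 : Tendsto (fun z : ℂ × ℂ => (z.1, z.1 ^ n * (z.2 + c))) (𝓝 0) (𝓝 0) := by
      have : Continuous (fun z : ℂ × ℂ => (z.1, z.1 ^ n * (z.2 + c))) := by fun_prop
      exact this.tendsto' _ _ (by simp [hN.ne_zero])
    filter_upwards [eventually_exists_root ((h1.eventually hWp).and hVp) hN.ne_zero]
      with z ⟨t, ht, hw, hv⟩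
    rw [ht] at hw hv
    rw [show V z = _ from hv, show W (blowUpChart (.slope c) z) = _ from hw]
    have : ∀ m ∈ Finset.range n, z.1 * (z.2 + c) - (ζ ^ m * t) ^ n * (v (ζ ^ m * t) + c) =
        z.1 * (z.2 - v (ζ ^ m * t)) := fun m _ => by rw [hN.conj_pow, ht]; ring
    rw [Finset.prod_congr rfl this, Finset.prod_mul_distrib]
    simp

/-- The equation of an arc and the equation of its strict transform by a blowing-up. -/
lemma IsArc.exists_isEqn_blowUp (h : IsArc ε) (d : Direction)
    (hx : ¬ ∀ᶠ t in 𝓝 (0 : ℂ), exc d (ε t) = 0) :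
    ∃ f g, ∃ m : ℕ, IsEqn f (fun t => blowUpChart d (ε t)) ∧ IsEqn g ε ∧
      analyticOrderAt (fun t => exc d (ε t)) 0 = m ∧
      ∀ᶠ z in 𝓝 (0 : ℂ × ℂ), f (blowUpChart d z) = exc d z ^ m * g z := by
  cases d with
  | slope c => exact h.exists_isEqn_slope c hx
  | vertical =>
    obtain ⟨f, g, m, hf, hg, hm, he⟩ := h.swap.exists_isEqn_slope 0 hx
    refine ⟨fun z => f z.swap, fun z => g z.swap, m, ?_, by simpa using hg.swap, hm, ?_⟩
    · refine hf.swap.congr (Eventually.of_forall fun t => ?_)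
      rw [← blowUpChart_vertical, Prod.swap_swap]
    · filter_upwards [tendsto_swap.eventually he] with z hz
      rwa [blowUpChart_vertical]

/-- `c` is the exponent of the conductor of the arc `δ` with the equation `f`. -/
def HasConductor (f : ℂ × ℂ → ℂ) (δ : ℂ → ℂ × ℂ) (c : ℕ) : Prop :=
  analyticOrderAt (fun t => pd (0, 1) f (δ t)) 0 + 1 = c + analyticOrderAt (fun t => (δ t).1) 0 ∧
  analyticOrderAt (fun t => pd (1, 0) f (δ t)) 0 + 1 = c + analyticOrderAt (fun t => (δ t).2) 0

/-- By `pd_relation` the two equalities of `HasConductor` are equivalent once the order of the first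
coordinate is finite and can be cancelled. -/
lemma IsEqn.hasConductor_of_fst {δ : ℂ → ℂ × ℂ} (hf : IsEqn f δ) (h : IsArc δ) {c : ℕ}
    (hx : analyticOrderAt (fun t => (δ t).1) 0 ≠ ⊤)
    (h1 : analyticOrderAt (fun t => pd (0, 1) f (δ t)) 0 + 1 =
      c + analyticOrderAt (fun t => (δ t).1) 0) : HasConductor f δ c := by
  refine ⟨h1, ?_⟩
  have h2 := pd_relation hf.analyticAt h.analyticAt h.map_zero hf.vanish
  rw [← ENat.add_left_injective_of_ne_top hx |>.eq_iff]
  rw [add_right_comm, h2, add_right_comm, h1]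
  ring

lemma HasConductor.swap {δ : ℂ → ℂ × ℂ} {c : ℕ} (h : HasConductor f δ c) (hδ : IsArc δ)
    (hf : AnalyticAt ℂ f 0) : HasConductor (fun z => f z.swap) (fun t => (δ t).swap) c := by
  refine ⟨?_, ?_⟩
  · rw [show ((0 : ℂ), (1 : ℂ)) = Prod.swap (1, 0) from rfl, order_pd_swap _ hf hδ]
    exact h.2
  · rw [show ((1 : ℂ), (0 : ℂ)) = Prod.swap (0, 1) from rfl, order_pd_swap _ hf hδ]
    exact h.1

lemma HasConductor.of_isEqn {δ : ℂ → ℂ × ℂ} {c : ℕ} (h : HasConductor f δ c) (hδ : IsArc δ)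
    (hf : IsEqn f δ) (hg : IsEqn g δ) : HasConductor g δ c := by
  rw [HasConductor, hf.order_pd_eq hδ.analyticAt hδ.map_zero hg,
    hf.order_pd_eq hδ.analyticAt hδ.map_zero hg]
  exact h

/-- Differentiating `f (x, x (v + c)) = x ^ m * g (x, v)` with respect to `v` gives `x * f_y = x ^ m
* g_v`. Since `x` has order `m` along the arc, the order of the derivative grows by `m (m - 1)`. -/
lemma HasConductor.blowUp_slope (h : IsArc ε) {c : ℂ} (hx : ¬ ∀ᶠ t in 𝓝 (0 : ℂ), (ε t).1 = 0)
    (hf : IsEqn f (fun t => blowUpChart (.slope c) (ε t))) (hg : IsEqn g ε) {m k : ℕ}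
    (hm : analyticOrderAt (fun t => (ε t).1) 0 = m) (hk : HasConductor g ε k) :
    HasConductor f (fun t => blowUpChart (.slope c) (ε t)) (m * (m - 1) + k) := by
  have hδ : IsArc (fun t => blowUpChart (.slope c) (ε t)) := h.blowUp hx
  obtain ⟨f', g', m', hf', hg', hm', he⟩ := h.exists_isEqn_slope c hx
  obtain rfl : m' = m := by exact_mod_cast hm'.symm.trans hm
  refine HasConductor.of_isEqn ?_ hδ hf' hf
  replace hk := (hk.of_isEqn h hg hg').1
  refine hf'.hasConductor_of_fst hδ (c := m' * (m' - 1) + k) ?_ ?_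
  · change analyticOrderAt (fun t => (ε t).1) 0 ≠ ⊤
    rw [hm]; exact ENat.natCast_ne_top _
  change _ = _ + analyticOrderAt (fun t => (ε t).1) 0
  rw [hm] at hk ⊢
  have hm0 : m' ≠ 0 := by
    rintro rfl
    exact h.fst_analyticAt.analyticOrderAt_eq_zero.mp hm (by simp [h.map_zero])
  have key : ∀ᶠ t in 𝓝 (0 : ℂ), (ε t).1 ^ 1 * pd (0, 1) f' (blowUpChart (.slope c) (ε t)) =
      (ε t).1 ^ m' * pd (0, 1) g' (ε t) := by
    filter_upwards [h.tendsto.eventually he.eventually_nhds,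
      h.tendsto.eventually hg'.analyticAt.eventually_analyticAt,
      hδ.tendsto.eventually hf'.analyticAt.eventually_analyticAt] with t h1 h2 h3
    have e1 : Tendsto (fun s : ℂ => ((ε t).1, s)) (𝓝 (ε t).2) (𝓝 (ε t)) :=
      (Continuous.prodMk_right (ε t).1).tendsto _
    have e2 : HasDerivAt (fun s : ℂ => (ε t).1 ^ m' * g' ((ε t).1, s))
        ((ε t).1 ^ m' * pd (0, 1) g' (ε t)) (ε t).2 := by
      have d1 : HasFDerivAt g' (fderiv ℂ g' (ε t)) ((ε t).1, (ε t).2) :=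
        h2.differentiableAt.hasFDerivAt
      exact (d1.comp_hasDerivAt (ε t).2 (HasDerivAt.prodMk (hasDerivAt_const _ _)
        (hasDerivAt_id _))).const_mul _
    have e3 : HasDerivAt (fun s : ℂ => f' ((ε t).1, (ε t).1 * (s + c)))
        (fderiv ℂ f' (blowUpChart (.slope c) (ε t)) (0, (ε t).1 * 1)) (ε t).2 := by
      have d1 : HasFDerivAt f' (fderiv ℂ f' (blowUpChart (.slope c) (ε t)))
        ((ε t).1, (ε t).1 * ((ε t).2 + c)) := h3.differentiableAt.hasFDerivAt
      exact d1.comp_hasDerivAt (ε t).2 (HasDerivAt.prodMk (hasDerivAt_const _ _)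
        (((hasDerivAt_id _).add_const c).const_mul _))
    have e4 := e3.unique (e2.congr_of_eventuallyEq (e1.eventually h1))
    rw [← e4, show ((0 : ℂ), (ε t).1 * 1) = (ε t).1 • ((0 : ℂ), (1 : ℂ)) by simp, map_smul, pow_one]
    rfl
  have h5 := analyticOrderAt_congr key
  rw [order_pow_mul h.fst_analyticAt
      ((analyticAt_pd hf'.analyticAt _).fun_comp_of_eq hδ.analyticAt hδ.map_zero),
    order_pow_mul h.fst_analyticAt
      ((analyticAt_pd hg'.analyticAt _).fun_comp_of_eq h.analyticAt h.map_zero), hm] at h5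
  rw [← ENat.add_left_injective_of_ne_top (ENat.natCast_ne_top m') |>.eq_iff]
  calc _ = (1 : ℕ) * (m' : ℕ∞) + analyticOrderAt (fun t => pd (0, 1) f' (blowUpChart (.slope c) (ε t))) 0 + 1 := by
        push_cast; ring
    _ = m' * m' + (k + m') := by rw [h5, add_assoc, hk]
    _ = _ := by
      obtain ⟨j, rfl⟩ := Nat.exists_eq_succ_of_ne_zero hm0
      simp only [Nat.succ_eq_add_one, Nat.add_sub_cancel]
      push_cast; ring

/-- The conductor grows by `m (m - 1)` under a blowing-down, where `m` is the multiplicity. -/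
lemma HasConductor.blowUp (h : IsArc ε) {d : Direction} (hx : ¬ ∀ᶠ t in 𝓝 (0 : ℂ), exc d (ε t) = 0)
    (hf : IsEqn f (fun t => blowUpChart d (ε t))) (hg : IsEqn g ε) {m k : ℕ}
    (hm : analyticOrderAt (fun t => exc d (ε t)) 0 = m) (hk : HasConductor g ε k) :
    HasConductor f (fun t => blowUpChart d (ε t)) (m * (m - 1) + k) := by
  cases d with
  | slope c => exact HasConductor.blowUp_slope h hx hf hg hm hk
  | vertical =>
    have hδ := h.blowUp hx
    have h1 := HasConductor.blowUp_slope h.swap (c := 0) hx (f := fun z => f z.swap)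
      (hf.swap.congr (Eventually.of_forall fun t => blowUpChart_vertical _)) hg.swap hm
      (hk.swap h hg.analyticAt)
    have h2 := h1.swap (h.swap.blowUp hx) (analyticAt_swap_comp hf.analyticAt)
    simp only [← blowUpChart_vertical, Prod.swap_swap] at h2
    exact h2

lemma order_eq_one_of_deriv {a : ℂ → ℂ} (ha : AnalyticAt ℂ a 0) (h0 : a 0 = 0)
    (h1 : deriv a 0 ≠ 0) : analyticOrderAt a 0 = 1 :=
  ha.analyticOrderAt_eq_one_of_zero_deriv_ne_zero h0 h1

lemma deriv_fst_snd (ha : AnalyticAt ℂ ε 0) :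
    deriv ε 0 = (deriv (fun t => (ε t).1) 0, deriv (fun t => (ε t).2) 0) := by
  have d0 : HasDerivAt ε (deriv ε 0) 0 := ha.differentiableAt.hasDerivAt
  have d1 : HasDerivAt (fun t => (ε t).1) (deriv ε 0).1 0 :=
    (ContinuousLinearMap.fst ℂ ℂ ℂ).hasFDerivAt.comp_hasDerivAt 0 d0
  have d2 : HasDerivAt (fun t => (ε t).2) (deriv ε 0).2 0 :=
    (ContinuousLinearMap.snd ℂ ℂ ℂ).hasFDerivAt.comp_hasDerivAt 0 d0
  rw [d1.deriv, d2.deriv]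

/-- The order of the first coordinate is the number of conjugates; with a single one the Weierstrass
polynomial is `w - y(x)`, whose derivative in `w` is one. -/
lemma IsArc.hasConductor_zero_of_fst (h : IsArc ε) (hf : IsEqn f ε)
    (hx : analyticOrderAt (fun t => (ε t).1) 0 = 1) : HasConductor f ε 0 := by
  obtain ⟨n, ζ, y, l, hN, hl, he, hn⟩ := h.exists_normal
    (fun h1 => by rw [analyticOrderAt_eq_top.mpr h1] at hx; simp at hx)
  obtain rfl : n = 1 := by
    have := hn.symm.trans hx
    exact_mod_cast this
  obtain ⟨W, hW, hWp⟩ := hN.exists_weierstrass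
  have hWδ : IsEqn W ε :=
    (IsEqn.comp_iff hl).mp ((hN.isEqn hW hWp).congr (he.mono fun _ => Eq.symm))
  refine hf.hasConductor_of_fst h (by rw [hx]; simp) ?_
  have h1 : analyticOrderAt (fun t => pd (0, 1) f (ε t)) 0 = 0 := by
    rw [hWδ.order_pd_eq h.analyticAt h.map_zero hf, ← hl.order (fun t => pd (0, 1) W (ε t)),
      analyticOrderAt_congr (g := fun _ => (1 : ℂ))]
    · exact order_eq_zero_of_ne one_ne_zero
    · filter_upwards [he, hN.pd_eq hW hWp] with s h1 h2
      rw [h1, h2]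
      simp
  rw [h1, hx]
  simp

/-- A regular arc has the conductor zero. -/
lemma IsArc.hasConductor_zero (h : IsArc ε) (hf : IsEqn f ε) (hd : deriv ε 0 ≠ 0) :
    HasConductor f ε 0 := by
  by_cases h1 : deriv (fun t => (ε t).1) 0 = 0
  · have h2 : deriv (fun t => (ε t).2) 0 ≠ 0 := fun h2 =>
      hd (by rw [deriv_fst_snd h.analyticAt, h1, h2]; rfl)
    have h3 := h.swap.hasConductor_zero_of_fst hf.swap
      (order_eq_one_of_deriv h.snd_analyticAt (by simp [h.map_zero]) h2)
    simpa using h3.swap h.swap (analyticAt_swap_comp hf.analyticAt)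
  · exact h.hasConductor_zero_of_fst hf
      (order_eq_one_of_deriv h.fst_analyticAt (by simp [h.map_zero]) h1)

/-- Intersection multiplicities under a blowing-up of arcs with the same direction. -/
lemma order_blowUp_same {ε₁ : ℂ → ℂ × ℂ} (h : IsArc ε) (h₁ : IsArc ε₁) {d : Direction}
    (hx : ¬ ∀ᶠ t in 𝓝 (0 : ℂ), exc d (ε t) = 0)
    (hf : IsEqn f (fun t => blowUpChart d (ε t))) (hg : IsEqn g ε)
    (hx₁ : ¬ ∀ᶠ t in 𝓝 (0 : ℂ), exc d (ε₁ t) = 0) :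
    analyticOrderAt (fun t => f (blowUpChart d (ε₁ t))) 0 =
      analyticOrderAt (fun t => exc d (ε t)) 0 * analyticOrderAt (fun t => exc d (ε₁ t)) 0 +
        analyticOrderAt (fun t => g (ε₁ t)) 0 := by
  obtain ⟨f', g', m, hf', hg', hm, he⟩ := h.exists_isEqn_blowUp d hx
  have hδ₁ := h₁.blowUp hx₁
  rw [hf'.order_eq hδ₁.analyticAt hδ₁.map_zero hf, hg'.order_eq h₁.analyticAt h₁.map_zero hg, hm,
    ← order_pow_mul (h₁.exc_analyticAt d)
      (hg'.analyticAt.fun_comp_of_eq h₁.analyticAt h₁.map_zero)]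
  exact analyticOrderAt_congr (h₁.tendsto.eventually he)

/-- Along the arc `(e α, e β)` each of the `n` factors of the Weierstrass polynomial is `e` times a
quantity close to `β 0 - α 0 * c ≠ 0`. The factors involve a root of the first coordinate and need
not be analytic in the parameter, so the orders are compared through absolute values. Keeping `α`
and `β` general treats finite slopes and the vertical direction together. -/
lemma order_blowUp_ne_slope (h : IsArc ε) {c : ℂ} (hx : ¬ ∀ᶠ t in 𝓝 (0 : ℂ), (ε t).1 = 0)
    (hf : IsEqn f (fun t => blowUpChart (.slope c) (ε t))) {e α β : ℂ → ℂ}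
    (he : AnalyticAt ℂ e 0) (he0 : e 0 = 0) (hα : AnalyticAt ℂ α 0) (hβ : AnalyticAt ℂ β 0)
    (hne : β 0 - α 0 * c ≠ 0) :
    analyticOrderAt (fun t => f (e t * α t, e t * β t)) 0 =
      analyticOrderAt (fun t => (ε t).1) 0 * analyticOrderAt e 0 := by
  obtain ⟨n, ζ, v, l, hN, hl, hel, hn⟩ := h.exists_normal hx
  obtain ⟨W, hW, hWp⟩ := (hN.blowUp c).exists_weierstrass
  have hWδ : IsEqn W (fun t => blowUpChart (.slope c) (ε t)) := by
    refine (IsEqn.comp_iff hl).mp (((hN.blowUp c).isEqn hW hWp).congr ?_)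
    filter_upwards [hel] with s hs
    rw [hs]; rfl
  have ha1 : AnalyticAt ℂ (fun t => (e t * α t, e t * β t)) 0 := (he.mul hα).prod (he.mul hβ)
  have ha0 : (fun t => (e t * α t, e t * β t)) 0 = 0 := by simp [he0]
  rw [hWδ.order_eq ha1 ha0 hf, hn]
  have hen : AnalyticAt ℂ (fun t => e t ^ n) 0 := he.pow n
  have h1 : (n : ℕ∞) * analyticOrderAt e 0 = analyticOrderAt (fun t => e t ^ n) 0 := by
    have := analyticOrderAt_pow he n
    rw [nsmul_eq_mul] at this
    exact this.symm
  rw [h1]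
  set κ := ‖β 0 - α 0 * c‖ with hκ
  have hκ0 : 0 < κ := norm_pos_iff.mpr hne
  have hcont : Tendsto (fun p : ℂ × ℂ => ‖β p.1 - α p.1 * (c + p.2)‖) (𝓝 ((0 : ℂ), (0 : ℂ))) (𝓝 κ) := by
    have hβ' : ContinuousAt (fun p : ℂ × ℂ => β p.1) (0, 0) :=
      ContinuousAt.comp (f := Prod.fst) (g := β) hβ.continuousAt continuousAt_fst
    have hα' : ContinuousAt (fun p : ℂ × ℂ => α p.1) (0, 0) :=
      ContinuousAt.comp (f := Prod.fst) (g := α) hα.continuousAt continuousAt_fst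
    have := (hβ'.sub (hα'.mul (continuousAt_const.add continuousAt_snd))).norm.tendsto (x := ((0 : ℂ), (0 : ℂ)))
      (f := fun p : ℂ × ℂ => ‖β p.1 - α p.1 * (c + p.2)‖)
    simpa [hκ] using this
  have hb := hcont.eventually (Ioo_mem_nhds (half_lt_self hκ0) (lt_two_mul_self hκ0))
  rw [nhds_prod_eq, Filter.eventually_prod_iff] at hb
  obtain ⟨pa, hpa, pb, hpb, hb⟩ := hb
  have h2 : ∀ m ∈ Finset.range n, ∀ᶠ z in 𝓝 (0 : ℂ × ℂ), pb (v (ζ ^ m * z.1)) := fun m _ =>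
    (tendsto_zero (hN.analyticAt_conj_fst m) (by simp [hN.map_zero])).eventually hpb
  have h3 := (tendsto_zero ha1 ha0).eventually (eventually_exists_root
    (hWp.and ((Filter.eventually_all_finset _).mpr h2)) hN.ne_zero)
  have key : ∀ᶠ τ in 𝓝 (0 : ℂ), (κ / 2) ^ n * ‖e τ ^ n‖ ≤ ‖W (e τ * α τ, e τ * β τ)‖ ∧
      ‖W (e τ * α τ, e τ * β τ)‖ ≤ (2 * κ) ^ n * ‖e τ ^ n‖ := by
    filter_upwards [h3, hpa] with τ ⟨t, ht, hw, hv⟩ hτ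
    rw [ht] at hw
    have h4 : ∀ m ∈ Finset.range n, e τ * β τ - (ζ ^ m * t) ^ n * (v (ζ ^ m * t) + c) =
        e τ * (β τ - α τ * (c + v (ζ ^ m * t))) := fun m _ => by rw [hN.conj_pow, ht]; ring
    rw [hw, Finset.prod_congr rfl h4, Finset.prod_mul_distrib, Finset.prod_const, Finset.card_range,
      norm_mul, mul_comm _ ‖e τ ^ n‖, mul_comm _ ‖e τ ^ n‖, norm_prod]
    have h5 : ∀ m ∈ Finset.range n, κ / 2 ≤ ‖β τ - α τ * (c + v (ζ ^ m * t))‖ ∧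
        ‖β τ - α τ * (c + v (ζ ^ m * t))‖ ≤ 2 * κ := fun m hm =>
      ⟨(hb hτ (hv m hm)).1.le, (hb hτ (hv m hm)).2.le⟩
    constructor
    · gcongr
      calc _ = ∏ m ∈ Finset.range n, κ / 2 := by rw [Finset.prod_const, Finset.card_range]
        _ ≤ _ := Finset.prod_le_prod (fun _ _ => by positivity) fun m hm => (h5 m hm).1
    · gcongr
      calc _ ≤ ∏ m ∈ Finset.range n, 2 * κ :=
            Finset.prod_le_prod (fun _ _ => norm_nonneg _) fun m hm => (h5 m hm).2
        _ = _ := by rw [Finset.prod_const, Finset.card_range]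
  have hWa : AnalyticAt ℂ (fun t => W (e t * α t, e t * β t)) 0 := hW.fun_comp_of_eq ha1 ha0
  refine le_antisymm (order_le_of_bound hen hWa ((κ / 2) ^ n)⁻¹ ?_)
    (order_le_of_bound hWa hen _ (key.mono fun t ht => ht.2))
  filter_upwards [key] with t ht
  rw [le_inv_mul_iff₀ (by positivity)]
  exact ht.1

/-- The intersection multiplicity of arcs with distinct directions. -/
lemma order_blowUp_ne {ε₁ : ℂ → ℂ × ℂ} (h : IsArc ε) (h₁ : IsArc ε₁) {d d₁ : Direction} (hd : d₁ ≠ d)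
    (hx : ¬ ∀ᶠ t in 𝓝 (0 : ℂ), exc d (ε t) = 0)
    (hf : IsEqn f (fun t => blowUpChart d (ε t))) :
    analyticOrderAt (fun t => f (blowUpChart d₁ (ε₁ t))) 0 =
      analyticOrderAt (fun t => exc d (ε t)) 0 * analyticOrderAt (fun t => exc d₁ (ε₁ t)) 0 := by
  have hz1 : (ε₁ 0).1 = 0 := by simp [h₁.map_zero]
  have hz2 : (ε₁ 0).2 = 0 := by simp [h₁.map_zero]
  cases d with
  | slope c =>
    cases d₁ with
    | slope c₁ =>
      have := order_blowUp_ne_slope h hx hf (e := fun t => (ε₁ t).1) (α := fun _ => 1)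
        (β := fun t => (ε₁ t).2 + c₁) h₁.fst_analyticAt hz1 analyticAt_const
        (h₁.snd_analyticAt.add analyticAt_const)
        (by
          simp only [hz2, zero_add, one_mul]
          exact sub_ne_zero.mpr fun h => hd (by rw [h]))
      simp only [mul_one] at this
      exact this
    | vertical =>
      have := order_blowUp_ne_slope h hx hf (e := fun t => (ε₁ t).2) (α := fun t => (ε₁ t).1)
        (β := fun _ => 1) h₁.snd_analyticAt hz2 h₁.fst_analyticAt analyticAt_const
        (by simp [hz1])
      refine Eq.trans (congrArg (analyticOrderAt · 0) (funext fun t => ?_)) this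
      simp [blowUpChart, mul_comm]
  | vertical =>
    cases d₁ with
    | slope c₁ =>
      have hf' : IsEqn (fun z => f z.swap) (fun t => blowUpChart (.slope 0) (ε t).swap) :=
        hf.swap.congr (Eventually.of_forall fun t => blowUpChart_vertical _)
      have := order_blowUp_ne_slope h.swap hx hf' (e := fun t => (ε₁ t).1) (β := fun _ => 1)
        (α := fun t => (ε₁ t).2 + c₁) h₁.fst_analyticAt hz1
        (h₁.snd_analyticAt.add analyticAt_const) analyticAt_const (by simp)
      simp only [mul_one, Prod.swap_prod_mk] at this
      exact this
    | vertical => exact absurd rfl hd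

end

/-! ### Infinitely near points -/

lemma proj_cons (d : Direction) (p : NearPoint) (z : ℂ × ℂ) :
    NearPoint.proj (d :: p) z = blowUpChart d (NearPoint.proj p z) := rfl

lemma proj_nil (z : ℂ × ℂ) : NearPoint.proj [] z = z := rfl

lemma proj_append (p s : NearPoint) (z : ℂ × ℂ) :
    NearPoint.proj (p ++ s) z = NearPoint.proj p (NearPoint.proj s z) := by
  induction p with
  | nil => rfl
  | cons d p ih => rw [List.cons_append, proj_cons, ih, proj_cons]

@[simp] lemma proj_zero (p : NearPoint) : NearPoint.proj p 0 = 0 := by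
  induction p with
  | nil => rfl
  | cons d p ih => rw [proj_cons, ih, blowUpChart_zero]

lemma analyticAt_proj (p : NearPoint) (z : ℂ × ℂ) : AnalyticAt ℂ (NearPoint.proj p) z := by
  induction p with
  | nil => exact analyticAt_id
  | cons d p ih => exact (analyticAt_blowUpChart d _).comp ih

lemma continuous_proj (p : NearPoint) : Continuous (NearPoint.proj p) :=
  continuous_iff_continuousAt.mpr fun z => (analyticAt_proj p z).continuousAt

lemma tendsto_proj (p : NearPoint) : Tendsto (NearPoint.proj p) (𝓝 0) (𝓝 0) :=
  (continuous_proj p).tendsto' _ _ (proj_zero p)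

lemma proj_inj (p : NearPoint) {z w : ℂ × ℂ} (h : p.proj z = p.proj w) (hz : p.proj z ≠ 0) :
    z = w := by
  induction p with
  | nil => exact h
  | cons d p ih =>
    rw [proj_cons] at hz
    have h1 := blowUpChart_inj d h hz
    exact ih h1 fun h2 => hz (by rw [h2, blowUpChart_zero])

/-- A nonzero common image would have a direction close to two different points of the projective
line. -/
lemma blowUpChart_separated {d e : Direction} (h : d ≠ e) :
    ∃ U ∈ 𝓝 (0 : ℂ × ℂ), ∀ z ∈ U, ∀ w ∈ U, blowUpChart d z = blowUpChart e w →
      blowUpChart d z = 0 := by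
  have aux : ∀ c : ℂ, ∃ U ∈ 𝓝 (0 : ℂ × ℂ), ∀ z ∈ U, ∀ w ∈ U,
      blowUpChart (.slope c) z = blowUpChart .vertical w → blowUpChart (.slope c) z = 0 := by
    intro c
    have h1 : Tendsto (fun x : (ℂ × ℂ) × (ℂ × ℂ) => x.2.1 * (x.1.2 + c)) (𝓝 (0, 0)) (𝓝 0) := by
      have : Continuous (fun x : (ℂ × ℂ) × (ℂ × ℂ) => x.2.1 * (x.1.2 + c)) := by fun_prop
      exact this.tendsto' _ _ (by simp)
    have h2 := h1.eventually_ne (zero_ne_one (α := ℂ))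
    rw [nhds_prod_eq, Filter.eventually_prod_iff] at h2
    obtain ⟨P, hP, Q, hQ, h2⟩ := h2
    refine ⟨_, Filter.Eventually.and hP hQ, fun z hz w hw he => ?_⟩
    simp only [blowUpChart, Prod.mk.injEq] at he ⊢
    have h3 := h2 hz.1 hw.2
    dsimp only at h3
    have h4 : w.2 * (1 - w.1 * (z.2 + c)) = 0 := by
      rw [mul_sub, mul_one, ← mul_assoc, mul_comm w.2, ← he.1, he.2, sub_self]
    have h5 : w.2 = 0 := (mul_eq_zero.mp h4).resolve_right (sub_ne_zero.mpr (Ne.symm h3))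
    rw [he.2, h5, he.1, h5, mul_zero]; rfl
  cases d with
  | slope c =>
    cases e with
    | slope c' =>
      have hc : c' - c ≠ 0 := sub_ne_zero.mpr fun h1 => h (by rw [h1])
      have h1 : Tendsto (fun x : (ℂ × ℂ) × (ℂ × ℂ) => x.1.2 - x.2.2) (𝓝 (0, 0)) (𝓝 0) := by
        have : Continuous (fun x : (ℂ × ℂ) × (ℂ × ℂ) => x.1.2 - x.2.2) := by fun_prop
        exact this.tendsto' _ _ (by simp)
      have h2 := h1.eventually_ne hc.symm
      rw [nhds_prod_eq, Filter.eventually_prod_iff] at h2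
      obtain ⟨P, hP, Q, hQ, h2⟩ := h2
      refine ⟨_, Filter.Eventually.and hP hQ, fun z hz w hw he => ?_⟩
      simp only [blowUpChart, Prod.mk.injEq] at he ⊢
      have h3 := h2 hz.1 hw.2
      dsimp only at h3
      obtain ⟨e1, e2⟩ := he
      rw [← e1] at e2
      have h4 : z.1 * ((z.2 - w.2) - (c' - c)) = 0 := by linear_combination e2
      have h5 : z.1 = 0 := (mul_eq_zero.mp h4).resolve_right (sub_ne_zero.mpr h3)
      rw [h5, zero_mul]; rfl
    | vertical => exact aux c
  | vertical =>
    cases e with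
    | slope c =>
      obtain ⟨U, hU, hs⟩ := aux c
      exact ⟨U, hU, fun z hz w hw he => by rw [he]; exact hs w hw z hz he.symm⟩
    | vertical => exact absurd rfl h

/-- Infinitely near points none of which lies over the other one have disjoint neighbourhoods. -/
lemma proj_separated {p q : NearPoint} (h1 : ¬ p <+: q) (h2 : ¬ q <+: p) :
    ∃ U ∈ 𝓝 (0 : ℂ × ℂ), ∀ z ∈ U, ∀ w ∈ U, p.proj z = q.proj w → p.proj z = 0 := by
  induction p generalizing q with
  | nil => exact absurd (List.nil_prefix) h1
  | cons d p ih =>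
    cases q with
    | nil => exact absurd (List.nil_prefix) h2
    | cons e q =>
      by_cases hd : d = e
      · subst hd
        obtain ⟨U, hU, h⟩ := ih (q := q) (fun h => h1 (by simpa using h))
          (fun h => h2 (by simpa using h))
        refine ⟨U, hU, fun z hz w hw he => ?_⟩
        rw [proj_cons, proj_cons] at he
        by_contra h0
        rw [proj_cons] at h0
        exact h0 (by rw [h z hz w hw (blowUpChart_inj d he h0), blowUpChart_zero])
      · obtain ⟨U, hU, h⟩ := blowUpChart_separated hd
        refine ⟨_, inter_mem (tendsto_proj p hU) (tendsto_proj q hU), fun z hz w hw he => ?_⟩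
        exact h _ hz.1 _ hw.2 he

/-! ### Multiplicities, conductors and intersection multiplicities of arcs given at infinitely near
points. -/

section

variable {γ γ' : ℂ → ℂ × ℂ} {p q : NearPoint}

/-- A regular parametrized arc. -/
structure IsRegular (γ : ℂ → ℂ × ℂ) : Prop where
  analyticAt : AnalyticAt ℂ γ 0
  map_zero : γ 0 = 0
  deriv_ne_zero : deriv γ 0 ≠ 0

lemma IsRegular.fst_or_snd (h : IsRegular γ) :
    Reparam (fun t => (γ t).1) ∨ Reparam (fun t => (γ t).2) := by
  by_cases h1 : deriv (fun t => (γ t).1) 0 = 0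
  · right
    refine ⟨analyticAt_snd.comp h.analyticAt, by simp [h.map_zero], fun h2 => ?_⟩
    exact h.deriv_ne_zero (by rw [deriv_fst_snd h.analyticAt, h1, h2]; rfl)
  · exact Or.inl ⟨analyticAt_fst.comp h.analyticAt, by simp [h.map_zero], h1⟩

lemma IsRegular.isArc (h : IsRegular γ) : IsArc γ where
  analyticAt := h.analyticAt
  map_zero := h.map_zero
  inj := by
    rcases h.fst_or_snd with h1 | h1
    · obtain ⟨U, hU, hi⟩ := h1.injOn
      exact ⟨U, hU, fun a ha b hb hab => hi ha hb (congrArg Prod.fst hab)⟩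
    · obtain ⟨U, hU, hi⟩ := h1.injOn
      exact ⟨U, hU, fun a ha b hb hab => hi ha hb (congrArg Prod.snd hab)⟩

lemma isRegular_of_fst (ha : AnalyticAt ℂ γ 0) (h0 : γ 0 = 0)
    (h1 : deriv (fun t => (γ t).1) 0 ≠ 0) : IsRegular γ :=
  ⟨ha, h0, fun h => h1 (by rw [deriv_fst_snd ha] at h; exact congrArg Prod.fst h)⟩

lemma isRegular_of_snd (ha : AnalyticAt ℂ γ 0) (h0 : γ 0 = 0)
    (h1 : deriv (fun t => (γ t).2) 0 ≠ 0) : IsRegular γ :=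
  ⟨ha, h0, fun h => h1 (by rw [deriv_fst_snd ha] at h; exact congrArg Prod.snd h)⟩

/-- The arc `γ` at the point `p` is not contained in the exceptional divisor. -/
def OffExceptional (p : NearPoint) (γ : ℂ → ℂ × ℂ) : Prop :=
  ∀ᶠ t in 𝓝[≠] (0 : ℂ), p.proj (γ t) ≠ 0

lemma OffExceptional.of_cons {d : Direction} (h : OffExceptional (d :: p) γ) :
    OffExceptional p γ := by
  filter_upwards [h] with t ht h0
  exact ht (by rw [proj_cons, h0, blowUpChart_zero])

lemma OffExceptional.exc {d : Direction} (h : OffExceptional (d :: p) γ) :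
    ¬ ∀ᶠ t in 𝓝 (0 : ℂ), exc d (p.proj (γ t)) = 0 := by
  intro h1
  obtain ⟨t, h2, h3⟩ := (h.and (h1.filter_mono nhdsWithin_le_nhds)).exists
  exact h2 ((blowUpChart_eq_zero_iff d _).mpr h3)

lemma OffExceptional.isArc (h : OffExceptional p γ) (hγ : IsArc γ) :
    IsArc (fun t => p.proj (γ t)) := by
  induction p with
  | nil => exact hγ
  | cons d p ih => exact (ih h.of_cons).blowUp h.exc

/-- The orders of the equations of the exceptional divisors along `γ` and `γ'`, at `q` and at the
points over which `q` lies, are the same. -/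
def SameOrders (q : NearPoint) (γ γ' : ℂ → ℂ × ℂ) : Prop :=
  ∀ d (s : NearPoint), d :: s <:+ q →
    analyticOrderAt (fun t => exc d (s.proj (γ t))) 0 =
      analyticOrderAt (fun t => exc d (s.proj (γ' t))) 0

lemma SameOrders.of_suffix (h : SameOrders q γ γ') (hp : p <:+ q) : SameOrders p γ γ' :=
  fun d s hs => h d s (hs.trans hp)

/-- A regular arc has conductor zero, and each blowing-down adds `m (m - 1)`, where `m` is the order
of the exceptional coordinate. These orders agree for the two arcs. -/
lemma HasConductor.exists_common (hγ : IsRegular γ) (hγ' : IsRegular γ')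
    (ho : OffExceptional q γ) (ho' : OffExceptional q γ') (hs : SameOrders q γ γ')
    {f f' : ℂ × ℂ → ℂ} (hf : IsEqn f (fun t => q.proj (γ t)))
    (hf' : IsEqn f' (fun t => q.proj (γ' t))) :
    ∃ c, HasConductor f (fun t => q.proj (γ t)) c ∧ HasConductor f' (fun t => q.proj (γ' t)) c := by
  induction q generalizing f f' with
  | nil => exact ⟨0, hγ.isArc.hasConductor_zero hf hγ.deriv_ne_zero,
      hγ'.isArc.hasConductor_zero hf' hγ'.deriv_ne_zero⟩
  | cons d q ih =>
    have ha := ho.of_cons.isArc hγ.isArc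
    have ha' := ho'.of_cons.isArc hγ'.isArc
    obtain ⟨g, hg, -⟩ := ha.exists_isEqn
    obtain ⟨g', hg', -⟩ := ha'.exists_isEqn
    obtain ⟨c, hc, hc'⟩ := ih ho.of_cons ho'.of_cons (hs.of_suffix (List.suffix_cons _ _)) hg hg'
    obtain ⟨m, hm⟩ := ENat.ne_top_iff_exists.mp (mt analyticOrderAt_eq_top.mp ho.exc)
    have hm' := hs d q List.suffix_rfl
    exact ⟨_, HasConductor.blowUp ha ho.exc hf hg hm.symm hc,
      HasConductor.blowUp ha' ho'.exc hf' hg' (hm'.symm.trans hm.symm) hc'⟩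

/-- The multiplicity of a parametrized arc. -/
noncomputable def mult (δ : ℂ → ℂ × ℂ) : ℕ∞ :=
  min (analyticOrderAt (fun t => (δ t).1) 0) (analyticOrderAt (fun t => (δ t).2) 0)

/-- Both coordinates of the chart are multiples of the exceptional one, and one of them is equal to
it. -/
lemma mult_blowUp {ε : ℂ → ℂ × ℂ} (h : IsArc ε) (d : Direction) :
    mult (fun t => blowUpChart d (ε t)) = analyticOrderAt (fun t => exc d (ε t)) 0 := by
  cases d with
  | slope c =>
    have := analyticOrderAt_mul h.fst_analyticAt
      (h.snd_analyticAt.add (analyticAt_const (v := c)))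
    refine min_eq_left ?_
    change _ ≤ analyticOrderAt ((fun t => (ε t).1) * ((fun t => (ε t).2) + fun _ => c)) 0
    rw [this]
    exact le_self_add
  | vertical =>
    have := analyticOrderAt_mul h.fst_analyticAt h.snd_analyticAt
    refine min_eq_right ?_
    change _ ≤ analyticOrderAt ((fun t => (ε t).1) * (fun t => (ε t).2)) 0
    rw [this]
    exact le_add_self

lemma IsRegular.mult_eq_one (h : IsRegular γ) : mult γ = 1 := by
  have h1 : 1 ≤ analyticOrderAt (fun t => (γ t).1) 0 := Order.one_le_iff_ne_zero.mpr
    (h.isArc.fst_analyticAt.analyticOrderAt_ne_zero.mpr (by simp [h.map_zero]))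
  have h2 : 1 ≤ analyticOrderAt (fun t => (γ t).2) 0 := Order.one_le_iff_ne_zero.mpr
    (h.isArc.snd_analyticAt.analyticOrderAt_ne_zero.mpr (by simp [h.map_zero]))
  rcases h.fst_or_snd with h3 | h3
  · rw [mult, order_eq_one_of_deriv h3.analyticAt h3.map_zero h3.deriv_ne_zero]
    exact min_eq_left h2
  · rw [mult, order_eq_one_of_deriv h3.analyticAt h3.map_zero h3.deriv_ne_zero]
    exact min_eq_right h1

lemma deriv_ne_zero_of_order {a : ℂ → ℂ} (ha : AnalyticAt ℂ a 0) (h0 : a 0 = 0)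
    (h1 : analyticOrderAt a 0 = 1) : deriv a 0 ≠ 0 := by
  have h2 := ha.analyticOrderAt_deriv_add_one
  simp only [h0, sub_zero] at h2
  rw [h1] at h2
  have h3 : analyticOrderAt (deriv a) 0 = 0 := by
    have : analyticOrderAt (deriv a) 0 + 1 = 0 + 1 := by rw [h2, zero_add]
    exact (ENat.add_left_injective_of_ne_top ENat.one_ne_top) this
  exact ha.deriv.analyticOrderAt_eq_zero.mp h3

lemma IsArc.isRegular_of_mult (h : IsArc γ) (h1 : mult γ = 1) : IsRegular γ := by
  rw [mult, min_eq_iff] at h1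
  rcases h1 with h1 | h1
  · exact isRegular_of_fst h.analyticAt h.map_zero
      (deriv_ne_zero_of_order h.fst_analyticAt (by simp [h.map_zero]) h1.1)
  · exact isRegular_of_snd h.analyticAt h.map_zero
      (deriv_ne_zero_of_order h.snd_analyticAt (by simp [h.map_zero]) h1.1)

lemma SameOrders.mult_eq (hγ : IsRegular γ) (hγ' : IsRegular γ')
    (ho : OffExceptional q γ) (ho' : OffExceptional q γ') (hs : SameOrders q γ γ') :
    mult (fun t => q.proj (γ t)) = mult (fun t => q.proj (γ' t)) := by
  cases q with
  | nil => exact hγ.mult_eq_one.trans hγ'.mult_eq_one.symm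
  | cons d q =>
    have h1 := mult_blowUp (ho.of_cons.isArc hγ.isArc) d
    have h2 := mult_blowUp (ho'.of_cons.isArc hγ'.isArc) d
    exact h1.trans ((hs d q List.suffix_rfl).trans h2.symm)

/-- Each partial derivative is paired with the coordinate of the other index, so taking the minimum
on both sides yields a formula without preferred coordinates. -/
lemma HasConductor.different_add_one {f : ℂ × ℂ → ℂ} {δ : ℂ → ℂ × ℂ} {c : ℕ}
    (h : HasConductor f δ c) : different f δ + 1 = c + mult δ := by
  rw [different, mult, ← min_add_add_right, ← min_add_add_left, h.1, h.2, min_comm]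

/-- The different only depends on the infinitely near points of the arc. -/
lemma SameOrders.different_eq (hγ : IsRegular γ) (hγ' : IsRegular γ')
    (ho : OffExceptional q γ) (ho' : OffExceptional q γ') (hs : SameOrders q γ γ')
    {f f' : ℂ × ℂ → ℂ} (hf : IsEqn f (fun t => q.proj (γ t)))
    (hf' : IsEqn f' (fun t => q.proj (γ' t))) :
    different f (fun t => q.proj (γ t)) = different f' (fun t => q.proj (γ' t)) := by
  obtain ⟨c, hc, hc'⟩ := HasConductor.exists_common hγ hγ' ho ho' hs hf hf'
  have h := hc.different_add_one.trans
    ((congrArg _ (hs.mult_eq hγ hγ' ho ho')).trans hc'.different_add_one.symm)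
  exact (ENat.add_left_injective_of_ne_top ENat.one_ne_top) h

/-- The intersection multiplicities only depend on the infinitely near points of the arcs. -/
lemma SameOrders.order_eq {η η' : ℂ → ℂ × ℂ} (h1 : ¬ p <+: q) (h2 : ¬ q <+: p)
    (hγ : IsArc γ) (hγ' : IsArc γ') (hη : IsArc η) (hη' : IsArc η')
    (ho : OffExceptional p γ) (ho' : OffExceptional p γ') (hs : SameOrders p γ γ')
    (hq : OffExceptional q η) (hq' : OffExceptional q η') (ht : SameOrders q η η')
    {f f' : ℂ × ℂ → ℂ} (hf : IsEqn f (fun t => p.proj (γ t)))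
    (hf' : IsEqn f' (fun t => p.proj (γ' t))) :
    analyticOrderAt (fun t => f (q.proj (η t))) 0 =
      analyticOrderAt (fun t => f' (q.proj (η' t))) 0 := by
  induction p generalizing q f f' with
  | nil => exact absurd List.nil_prefix h1
  | cons d p ih =>
    cases q with
    | nil => exact absurd List.nil_prefix h2
    | cons e q =>
      have ha := ho.of_cons.isArc hγ
      have ha' := ho'.of_cons.isArc hγ'
      have hb := hq.of_cons.isArc hη
      have hb' := hq'.of_cons.isArc hη'
      have e1 := hs d p List.suffix_rfl
      have e2 := ht e q List.suffix_rfl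
      -- Noether's formula: at a common point the product of the multiplicities is added and the
      -- recursion goes on, while at a point where the directions part it is the whole contribution.
      -- As neither point lies over the other one, the directions do part.
      by_cases hd : e = d
      · subst hd
        obtain ⟨g, hg, -⟩ := ha.exists_isEqn
        obtain ⟨g', hg', -⟩ := ha'.exists_isEqn
        have e3 := ih (q := q) (fun h => h1 (by simpa using h)) (fun h => h2 (by simpa using h))
          ho.of_cons ho'.of_cons (hs.of_suffix (List.suffix_cons _ _)) hq.of_cons hq'.of_cons
          (ht.of_suffix (List.suffix_cons _ _)) hg hg'
        have e4 := order_blowUp_same ha hb ho.exc hf hg hq.exc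
        have e5 := order_blowUp_same ha' hb' ho'.exc hf' hg' hq'.exc
        rw [e1, e2, e3] at e4
        exact e4.trans e5.symm
      · have e4 := order_blowUp_ne ha hb hd ho.exc hf
        have e5 := order_blowUp_ne ha' hb' hd ho'.exc hf'
        rw [e1, e2] at e4
        exact e4.trans e5.symm

end

/-! ### Irreducible germs and their branches -/

lemma toGerm_mul {f g : ℂ × ℂ → ℂ} (hf : AnalyticAt ℂ f 0) (hg : AnalyticAt ℂ g 0)
    {k : ℂ × ℂ → ℂ} (hk : AnalyticAt ℂ k 0) (h : ∀ᶠ z in 𝓝 (0 : ℂ × ℂ), k z = f z * g z) :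
    toGerm k hk = toGerm f hf * toGerm g hg :=
  Subtype.ext (Germ.coe_eq.mpr h)

lemma isUnit_toGerm {f : ℂ × ℂ → ℂ} (hf : AnalyticAt ℂ f 0) : IsUnit (toGerm f hf) ↔ f 0 ≠ 0 := by
  constructor
  · rintro h h0
    obtain ⟨⟨_, g, hg, rfl⟩, h1⟩ := h.exists_right_inv
    have h2 : (((f * g : ℂ × ℂ → ℂ) : Germ (𝓝 (0 : ℂ × ℂ)) ℂ)) = ((1 : ℂ × ℂ → ℂ) : Germ _ ℂ) :=
      congrArg Subtype.val h1
    have h3 := (Germ.coe_eq.mp h2).self_of_nhds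
    simp [h0] at h3
  · intro h0
    refine IsUnit.of_mul_eq_one (toGerm (fun z => (f z)⁻¹) (hf.inv h0)) ?_
    refine Subtype.ext (Germ.coe_eq.mpr ?_)
    filter_upwards [hf.continuousAt.eventually_ne h0] with z hz
    simp [hz]

/-- An irreducible function that vanishes on an arc is an equation of the arc. -/
lemma IsArc.isEqn_of_irreducible {δ : ℂ → ℂ × ℂ} (h : IsArc δ) {f : ℂ × ℂ → ℂ}
    (hf : AnalyticAt ℂ f 0) (hi : Irreducible (toGerm f hf))
    (h0 : ∀ᶠ t in 𝓝 (0 : ℂ), f (δ t) = 0) : IsEqn f δ := by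
  obtain ⟨g, hg, -⟩ := h.exists_isEqn
  obtain ⟨q, hq, he⟩ := hg.dvd f hf h0
  have hg0 : g 0 = 0 := by simpa [h.map_zero] using hg.vanish.self_of_nhds
  rcases hi.isUnit_or_isUnit (toGerm_mul hg.analyticAt hq hf he) with h1 | h1
  · exact absurd hg0 ((isUnit_toGerm _).mp h1)
  · exact hg.mul_unit hf h.tendsto hq ((isUnit_toGerm _).mp h1) he

/-- Irreducible functions with a common branch are associated. -/
lemma IsEqn.associated {δ : ℂ → ℂ × ℂ} {f g : ℂ × ℂ → ℂ} (h : IsEqn f δ)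
    (hg : AnalyticAt ℂ g 0) (hfi : Irreducible (toGerm f h.analyticAt))
    (hgi : Irreducible (toGerm g hg)) (h0 : ∀ᶠ t in 𝓝 (0 : ℂ), g (δ t) = 0) :
    Associated (toGerm f h.analyticAt) (toGerm g hg) := by
  obtain ⟨q, hq, he⟩ := h.dvd g hg h0
  have h1 := toGerm_mul h.analyticAt hq hg he
  obtain ⟨u, hu⟩ := (hgi.isUnit_or_isUnit h1).resolve_left hfi.not_isUnit
  exact ⟨u, by rw [hu, h1]⟩

/-! ### Regular branches of strict transforms. -/

section

variable {f : ℂ × ℂ → ℂ} {p q : NearPoint} {γ ε : ℂ → ℂ × ℂ}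

/-- `γ` parametrizes a regular branch of the strict transform of `f = 0` at the point `p`. -/
structure IsLift (f : ℂ × ℂ → ℂ) (p : NearPoint) (γ : ℂ → ℂ × ℂ) : Prop where
  isRegular : IsRegular γ
  off : OffExceptional p γ
  vanish : ∀ᶠ t in 𝓝 (0 : ℂ), f (p.proj (γ t)) = 0

lemma IsLift.isArc (h : IsLift f p γ) : IsArc (fun t => p.proj (γ t)) :=
  h.off.isArc h.isRegular.isArc

/-- The normal form of the arc `(l t, 0)` has second coordinate zero. If `l` had order `n ≥ 2`, two
distinct conjugates of zero would have to differ. -/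
lemma reparam_of_injOn {l : ℂ → ℂ} (hl : AnalyticAt ℂ l 0) (h0 : l 0 = 0)
    (hi : ∃ U ∈ 𝓝 (0 : ℂ), Set.InjOn l U) : Reparam l := by
  refine ⟨hl, h0, deriv_ne_zero_of_order hl h0 ?_⟩
  have ha : IsArc (fun t => (l t, (0 : ℂ))) := by
    refine ⟨hl.prod analyticAt_const, by simp [h0], ?_⟩
    obtain ⟨U, hU, hi⟩ := hi
    exact ⟨U, hU, fun a ha b hb hab => hi ha hb (congrArg Prod.fst hab)⟩
  obtain ⟨n, ζ, y, r, hN, -, he, hn⟩ := ha.exists_normal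
    (fun h => ha.not_both h (Eventually.of_forall fun _ => rfl))
  have hy : ∀ᶠ t in 𝓝 (0 : ℂ), y t = 0 := he.mono fun t ht => (congrArg Prod.snd ht).symm
  by_contra hne
  have hn1 : n ≠ 1 := by
    rintro rfl
    exact hne (by simpa using hn)
  have h2 := hN.sep 0 (Nat.pos_of_ne_zero hN.ne_zero) 1
    (lt_of_le_of_ne (Nat.one_le_iff_ne_zero.mpr hN.ne_zero) (Ne.symm hn1)) (by simp)
  have h3 := fun i : ℕ => ((tendsto_const_mul_zero (ζ ^ i)).eventually hy).filter_mono
    (nhdsWithin_le_nhds (s := {0}ᶜ))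
  obtain ⟨t, ⟨h4, h5⟩, h6⟩ := ((h2.and (h3 0)).and (h3 1)).exists
  exact h4 (h5.trans h6.symm)

/-- Any other parametrization of a regular branch factors through a change of parameter if it is
injective. -/
lemma IsLift.exists_reparam (h : IsLift f p γ) (hf : IsEqn f (fun t => p.proj (γ t)))
    (hε : IsArc ε) (ho : OffExceptional p ε) (h0 : ∀ᶠ t in 𝓝 (0 : ℂ), f (p.proj (ε t)) = 0) :
    ∃ l, Reparam l ∧ ∀ᶠ t in 𝓝 (0 : ℂ), ε t = γ (l t) := by
  have hz := hf.zerosIn h.isArc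
  -- Here `c` is a coordinate that serves as a local parameter on `γ`; with `m` the inverse of `c ∘
  -- γ`, the change of parameter is `m (c (ε t))`.
  have aux : ∀ c : ℂ × ℂ → ℂ, (∀ z, AnalyticAt ℂ c z) → c 0 = 0 → Reparam (fun t => c (γ t)) →
      ∃ l, Reparam l ∧ ∀ᶠ t in 𝓝 (0 : ℂ), ε t = γ (l t) := by
    intro c hc hc0 hr
    obtain ⟨m, hm, -, hm2⟩ := hr.exists_inverse
    have hca : AnalyticAt ℂ (fun t => c (ε t)) 0 := (hc _).fun_comp_of_eq hε.analyticAt rfl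
    have hl : AnalyticAt ℂ (fun t => m (c (ε t))) 0 :=
      hm.analyticAt.fun_comp_of_eq hca (by simp [hε.map_zero, hc0])
    have hl0 : m (c (ε 0)) = 0 := by rw [hε.map_zero, hc0, hm.map_zero]
    have key : ∀ᶠ t in 𝓝 (0 : ℂ), ε t = γ (m (c (ε t))) := by
      have h1 := ((tendsto_proj p).comp hε.tendsto).eventually (hz _ hm2)
      have h2 := eventually_nhdsWithin_iff.mp ho
      filter_upwards [h1, h2, h0] with t h3 h4 h5
      by_cases ht : t = 0
      · rw [ht, hl0, hε.map_zero, h.isRegular.map_zero]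
      · obtain ⟨τ, hτ, he⟩ := h3 h5
        have he' : γ τ = ε t := proj_inj p he (by rw [he]; exact h4 ht)
        have : m (c (γ τ)) = τ := hτ
        rw [← he', this]
    refine ⟨_, reparam_of_injOn hl hl0 ?_, key⟩
    obtain ⟨U, hU, hi⟩ := hε.inj
    refine ⟨_, inter_mem hU key, fun a ha b hb hab => hi ha.1 hb.1 ?_⟩
    dsimp only at hab
    rw [show ε a = _ from ha.2, hab]
    exact hb.2.symm
  rcases h.isRegular.fst_or_snd with h1 | h1
  · exact aux Prod.fst (fun _ => analyticAt_fst) rfl h1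
  · exact aux Prod.snd (fun _ => analyticAt_snd) rfl h1

/-- The germ of the strict transform of an irreducible curve is the image of any branch. -/
lemma map_nhds_eq_strictTransform (hγ : IsArc γ) (ho : OffExceptional p γ)
    (hf : IsEqn f (fun t => p.proj (γ t))) :
    map γ (𝓝 0) = 𝓝[strictTransform p {z | f z = 0}] 0 := by
  have hz := hf.zerosIn (ho.isArc hγ)
  set A := p.proj ⁻¹' {z | f z = 0} \ exceptional p with hA
  have hmem : ∀ᶠ t in 𝓝[≠] (0 : ℂ), γ t ∈ A := by
    filter_upwards [ho, hf.vanish.filter_mono nhdsWithin_le_nhds] with t h1 h2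
    exact ⟨h2, h1⟩
  apply le_antisymm
  · refine tendsto_nhdsWithin_iff.mpr ⟨hγ.tendsto, ?_⟩
    filter_upwards [eventually_nhdsWithin_iff.mp hmem] with t ht
    by_cases h0 : t = 0
    · rw [h0, hγ.map_zero]
      exact mem_closure_of_tendsto (hγ.tendsto.mono_left nhdsWithin_le_nhds) hmem
    · exact subset_closure (ht h0)
  · intro V hV
    have hV' : {t | γ t ∈ V} ∈ 𝓝 (0 : ℂ) := hV
    have hc : ∀ᶠ t in 𝓝 (0 : ℂ), ContinuousAt γ t :=
      hγ.analyticAt.eventually_analyticAt.mono fun t ht => ht.continuousAt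
    obtain ⟨r, hr, hball⟩ := Metric.nhds_basis_closedBall.mem_iff.mp (inter_mem hV' hc)
    -- Compactness makes this image closed, so it also contains the limit points that the closure in
    -- `strictTransform` may add.
    have hcomp : IsCompact (γ '' Metric.closedBall 0 r) :=
      (isCompact_closedBall _ _).image_of_continuousOn
        fun t ht => (hball ht).2.continuousWithinAt
    have h1 : ∀ᶠ z in 𝓝 (0 : ℂ × ℂ), z ∈ A → z ∈ γ '' Metric.closedBall 0 r := by
      filter_upwards [(tendsto_proj p).eventually (hz _ (Metric.closedBall_mem_nhds 0 hr))]
        with z hz1 hzA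
      obtain ⟨t, ht, he⟩ := hz1 hzA.1
      exact ⟨t, ht, proj_inj p he (by rw [he]; exact hzA.2)⟩
    obtain ⟨O, hO, hOo, h0O⟩ := mem_nhds_iff.mp h1
    refine mem_nhdsWithin.mpr ⟨O, hOo, h0O, ?_⟩
    rintro z ⟨hzO, hzc⟩
    have h2 : z ∈ closure (O ∩ A) := hOo.inter_closure ⟨hzO, hzc⟩
    have h3 : O ∩ A ⊆ γ '' Metric.closedBall 0 r := fun w hw => hO hw.1 hw.2
    obtain ⟨t, ht, rfl⟩ := (closure_minimal h3 hcomp.isClosed) h2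
    exact (hball ht).1

lemma IsLift.isRegularParam (h : IsLift f p γ) (hf : IsEqn f (fun t => p.proj (γ t))) :
    IsRegularParam (strictTransform p {z | f z = 0}) γ :=
  ⟨h.isRegular.analyticAt, h.isRegular.map_zero, h.isRegular.deriv_ne_zero,
    map_nhds_eq_strictTransform h.isRegular.isArc h.off hf⟩

lemma exists_of_mem_strictTransform {C : Set (ℂ × ℂ)} (h0 : (0 : ℂ × ℂ) ∈ strictTransform p C)
    {U : Set (ℂ × ℂ)} (hU : U ∈ 𝓝 (0 : ℂ × ℂ)) : ∃ z ∈ U, p.proj z ∈ C ∧ p.proj z ≠ 0 := by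
  obtain ⟨z, hz, hz1⟩ := mem_closure_iff_nhds.mp h0 U hU
  exact ⟨z, hz, hz1.1, hz1.2⟩

lemma mem_strictTransform_iff {C : Set (ℂ × ℂ)} : (0 : ℂ × ℂ) ∈ strictTransform p C ↔
    ∀ U ∈ 𝓝 (0 : ℂ × ℂ), ∃ z ∈ U, p.proj z ∈ C ∧ p.proj z ≠ 0 :=
  ⟨fun h _ hU => exists_of_mem_strictTransform h hU, fun h => mem_closure_iff_nhds.mpr fun U hU => by
    obtain ⟨z, hz, h1, h2⟩ := h U hU
    exact ⟨z, hz, h1, h2⟩⟩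

lemma IsLift.mem_strictTransform (h : IsLift f p γ) :
    (0 : ℂ × ℂ) ∈ strictTransform p {z | f z = 0} := by
  rw [mem_strictTransform_iff]
  intro U hU
  obtain ⟨t, ⟨h1, h2⟩, h3⟩ := ((h.off.and (h.vanish.filter_mono nhdsWithin_le_nhds)).and
    ((h.isRegular.isArc.tendsto.eventually hU).filter_mono nhdsWithin_le_nhds)).exists
  exact ⟨_, h3, h2, h1⟩

/-- A regular parametrization of the strict transform is a lift. -/
lemma IsRegularParam.isLift (hf : AnalyticAt ℂ f 0)
    (h0 : (0 : ℂ × ℂ) ∈ strictTransform p {z | f z = 0})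
    (h : IsRegularParam (strictTransform p {z | f z = 0}) γ) : IsLift f p γ := by
  obtain ⟨ha, hz, hd, hm⟩ := h
  have hreg : IsRegular γ := ⟨ha, hz, hd⟩
  have hpa : AnalyticAt ℂ (fun t => p.proj (γ t)) 0 := (analyticAt_proj p _).fun_comp_of_eq ha rfl
  have hmem : ∀ᶠ t in 𝓝 (0 : ℂ), γ t ∈ strictTransform p {z | f z = 0} := by
    have h1 : ∀ᶠ z in map γ (𝓝 0), z ∈ strictTransform p {z | f z = 0} := by
      rw [hm]; exact self_mem_nhdsWithin
    exact h1
  refine ⟨hreg, ?_, ?_⟩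
  · refine hpa.eventually_eq_zero_or_eventually_ne_zero.resolve_left fun h1 => ?_
    -- If `γ` stayed in the exceptional divisor, so would the strict transform near the origin,
    -- although it is the closure of points off the divisor.
    have h2 : ∀ᶠ z in 𝓝[strictTransform p {z | f z = 0}] 0, p.proj z = 0 := by
      rw [← hm]; exact h1
    rw [eventually_nhdsWithin_iff] at h2
    obtain ⟨z, hz, hz1⟩ := mem_closure_iff_nhds.mp h0 _ h2
    exact hz1.2 (hz (subset_closure hz1))
  · have h1 : ∀ᶠ z in 𝓝 (0 : ℂ × ℂ), ContinuousAt (fun z => f (p.proj z)) z := by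
      have : AnalyticAt ℂ (fun z => f (p.proj z)) 0 :=
        hf.fun_comp_of_eq (analyticAt_proj p 0) (proj_zero p)
      exact this.eventually_analyticAt.mono fun z hz => hz.continuousAt
    filter_upwards [hmem, hreg.isArc.tendsto.eventually h1] with t h2 h3
    by_contra hne
    obtain ⟨z, hz, hz1⟩ := mem_closure_iff_nhds.mp h2 _ (h3.eventually_ne hne)
    exact hz hz1.1

/-- A branch passes only through points that lie over each other. -/
lemma IsEqn.comparable (hγ : IsArc γ) (ho : OffExceptional q γ)
    (hf : IsEqn f (fun t => q.proj (γ t)))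
    (h0 : (0 : ℂ × ℂ) ∈ strictTransform p {z | f z = 0}) : p <+: q ∨ q <+: p := by
  by_contra! h
  obtain ⟨U, hU, hs⟩ := proj_separated h.1 h.2
  have h1 := (tendsto_proj p).eventually (hf.zerosIn (ho.isArc hγ) _ (hγ.tendsto hU))
  obtain ⟨z, hz, hz1, hz2⟩ := exists_of_mem_strictTransform h0 (inter_mem hU h1)
  obtain ⟨t, ht, he⟩ := hz.2 hz1
  exact hz2 (hs z hz.1 _ ht he.symm)

/-- Regular arcs lift to regular arcs under a blowing-up. -/
lemma IsRegular.exists_blowUp (h : IsRegular γ) :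
    ∃ d γ', IsRegular γ' ∧ ∀ᶠ t in 𝓝 (0 : ℂ), blowUpChart d (γ' t) = γ t := by
  have ha1 := h.isArc.fst_analyticAt
  have ha2 := h.isArc.snd_analyticAt
  have hz1 : (γ 0).1 = 0 := by simp [h.map_zero]
  have hz2 : (γ 0).2 = 0 := by simp [h.map_zero]
  by_cases h1 : deriv (fun t => (γ t).1) 0 = 0
  · have h2 : deriv (fun t => (γ t).2) 0 ≠ 0 := fun h2 =>
      h.deriv_ne_zero (by rw [deriv_fst_snd h.analyticAt, h1, h2]; rfl)
    have h3 := order_eq_one_of_deriv ha2 hz2 h2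
    obtain ⟨g, hg, he⟩ := exists_eq_mul_of_order_le ha2 ha1
      (by rw [h3]; exact Order.one_le_iff_ne_zero.mpr (ha1.analyticOrderAt_ne_zero.mpr hz1))
      (by rw [h3]; exact ENat.one_ne_top)
    have hg0 : g 0 = 0 := by
      have e1 : deriv (fun t => (γ t).1) 0 = deriv (fun t => g t * (γ t).2) 0 :=
        Filter.EventuallyEq.deriv_eq he
      rw [h1, deriv_fun_mul hg.differentiableAt ha2.differentiableAt, hz2, mul_zero, zero_add] at e1
      exact (mul_eq_zero.mp e1.symm).resolve_right h2
    refine ⟨.vertical, fun t => (g t, (γ t).2), isRegular_of_snd (hg.prod ha2) ?_ h2, ?_⟩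
    · rw [hg0, hz2]; rfl
    · filter_upwards [he] with t ht
      exact Prod.ext ht.symm rfl
  · have h3 := order_eq_one_of_deriv ha1 hz1 h1
    obtain ⟨g, hg, he⟩ := exists_eq_mul_of_order_le ha1 ha2
      (by rw [h3]; exact Order.one_le_iff_ne_zero.mpr (ha2.analyticOrderAt_ne_zero.mpr hz2))
      (by rw [h3]; exact ENat.one_ne_top)
    refine ⟨.slope (g 0), fun t => ((γ t).1, g t - g 0),
      isRegular_of_fst (ha1.prod (hg.sub analyticAt_const)) (by simp [hz1]) h1, ?_⟩
    filter_upwards [he] with t ht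
    refine Prod.ext rfl ?_
    simp only [blowUpChart, sub_add_cancel]
    rw [ht, mul_comm]

/-- A regular branch stays regular under blowing up, so it can be followed through arbitrarily many
further points. -/
lemma IsLift.exists_append (h : IsLift f p γ) (n : ℕ) :
    ∃ s : NearPoint, s.length = n ∧ ∃ γ', IsLift f (p ++ s) γ' := by
  induction n with
  | zero => exact ⟨[], rfl, γ, by simpa using h⟩
  | succ n ih =>
    obtain ⟨s, hs, γ₁, h1⟩ := ih
    obtain ⟨d, γ₂, h2, he⟩ := h1.isRegular.exists_blowUp
    have he' : ∀ᶠ t in 𝓝 (0 : ℂ), NearPoint.proj (p ++ (s ++ [d])) (γ₂ t) =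
        NearPoint.proj (p ++ s) (γ₁ t) := by
      filter_upwards [he] with t ht
      rw [← List.append_assoc, proj_append, proj_cons, proj_nil, ht]
    refine ⟨s ++ [d], by simp [hs], γ₂, h2, ?_, ?_⟩
    · filter_upwards [h1.off, he'.filter_mono nhdsWithin_le_nhds] with t a b
      rwa [b]
    · filter_upwards [h1.vanish, he'] with t a b
      rwa [b]

/-- The strict transform of a regular branch is regular. -/
lemma IsLift.exists_lift_of_prefix (h : IsLift f q γ) (hf : AnalyticAt ℂ f 0)
    (hi : Irreducible (toGerm f hf)) (hqp : q <+: p)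
    (h0 : (0 : ℂ × ℂ) ∈ strictTransform p {z | f z = 0}) : ∃ γ', IsLift f p γ' := by
  -- The branch is followed up to the length of `p`. The point reached is comparable with `p`, hence
  -- equal to it.
  obtain ⟨s, hs, γ', h1⟩ := h.exists_append (p.length - q.length)
  have h2 := h1.isArc.isEqn_of_irreducible hf hi h1.vanish
  have h3 := h2.comparable h1.isRegular.isArc h1.off h0
  have hlen : (q ++ s).length = p.length := by
    have := hqp.length_le
    simp [hs]; omega
  have h4 : q ++ s = p := by
    rcases h3 with h3 | h3
    · exact (h3.eq_of_length hlen.symm).symm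
    · exact h3.eq_of_length hlen
  exact ⟨γ', h4 ▸ h1⟩

/-- Brought down to `p`, the second parametrization differs from the first one by a change of
parameter, which preserves orders. -/
lemma IsLift.order_eq_of_prefix {γ' : ℂ → ℂ × ℂ} (hf : AnalyticAt ℂ f 0)
    (hi : Irreducible (toGerm f hf)) (h : IsLift f p γ) (h' : IsLift f q γ') (hpq : p <+: q)
    (g : ℂ × ℂ → ℂ) : analyticOrderAt (fun t => g (q.proj (γ' t))) 0 =
      analyticOrderAt (fun t => g (p.proj (γ t))) 0 := by
  obtain ⟨s, rfl⟩ := hpq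
  have hs : OffExceptional s γ' := by
    filter_upwards [h'.off] with t ht h0
    exact ht (by rw [proj_append, h0, proj_zero])
  obtain ⟨l, hl, he⟩ := h.exists_reparam (h.isArc.isEqn_of_irreducible hf hi h.vanish)
    (hs.isArc h'.isRegular.isArc)
    (by filter_upwards [h'.off] with t ht; rwa [proj_append] at ht)
    (by filter_upwards [h'.vanish] with t ht; rwa [proj_append] at ht)
  rw [← hl.order (fun t => g (p.proj (γ t)))]
  refine analyticOrderAt_congr ?_
  filter_upwards [he] with t ht
  rw [proj_append, ht]

/-- Orders along an irreducible curve do not depend on the parametrization. -/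
lemma IsLift.order_eq {γ' : ℂ → ℂ × ℂ} (hf : AnalyticAt ℂ f 0)
    (hi : Irreducible (toGerm f hf)) (h : IsLift f p γ) (h' : IsLift f q γ')
    (g : ℂ × ℂ → ℂ) : analyticOrderAt (fun t => g (q.proj (γ' t))) 0 =
      analyticOrderAt (fun t => g (p.proj (γ t))) 0 := by
  rcases (h.isArc.isEqn_of_irreducible hf hi h.vanish).comparable h.isRegular.isArc h.off
    h'.mem_strictTransform with h1 | h1
  · exact (h'.order_eq_of_prefix hf hi h h1 g).symm
  · exact h.order_eq_of_prefix hf hi h' h1 g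

end

/-! ### Points of the strict transform -/

section

variable {C : Set (ℂ × ℂ)} {p q : NearPoint}

lemma strictTransform_mem_of_append {s : NearPoint}
    (h : (0 : ℂ × ℂ) ∈ strictTransform (p ++ s) C) : (0 : ℂ × ℂ) ∈ strictTransform p C := by
  rw [mem_strictTransform_iff] at h ⊢
  intro U hU
  obtain ⟨z, hz, h1, h2⟩ := h _ (tendsto_proj s hU)
  rw [proj_append] at h1 h2
  exact ⟨_, hz, h1, h2⟩

lemma strictTransform_mem_of_prefix (hpq : p <+: q)
    (h : (0 : ℂ × ℂ) ∈ strictTransform q C) : (0 : ℂ × ℂ) ∈ strictTransform p C := by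
  obtain ⟨s, rfl⟩ := hpq
  exact strictTransform_mem_of_append h

lemma strictTransform_mem_of_tendsto {d : Direction} {z w : ℕ → ℂ × ℂ}
    (hw : Tendsto w atTop (𝓝 0)) (hzw : ∀ᶠ n in atTop, blowUpChart d (w n) = z n)
    (hz : ∀ n, p.proj (z n) ∈ C ∧ p.proj (z n) ≠ 0) :
    (0 : ℂ × ℂ) ∈ strictTransform (p ++ [d]) C := by
  rw [mem_strictTransform_iff]
  intro U hU
  obtain ⟨n, h1, h2⟩ := ((hw.eventually hU).and hzw).exists
  have h3 := hz n
  refine ⟨w n, h1, ?_⟩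
  rwa [proj_append, proj_cons, proj_nil, h2]

/-- A strict transform passes through some point of the exceptional line of a blowing-up. -/
lemma exists_direction (h : (0 : ℂ × ℂ) ∈ strictTransform p C) :
    ∃ d, (0 : ℂ × ℂ) ∈ strictTransform (p ++ [d]) C := by
  obtain ⟨z, hzmem, hz0⟩ := mem_closure_iff_seq_limit.mp h
  have hz : ∀ n, p.proj (z n) ∈ C ∧ p.proj (z n) ≠ 0 := fun n => ⟨(hzmem n).1, (hzmem n).2⟩
  have hne : ∀ n, z n ≠ 0 := fun n h0 => (hz n).2 (by rw [h0, proj_zero])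
  -- One of the ratios of the coordinates is bounded by one along a subsequence, so it converges
  -- along a further one; the limit is the direction sought.
  by_cases hf : ∃ᶠ n in atTop, ‖(z n).2‖ ≤ ‖(z n).1‖
  · obtain ⟨φ, hφ, hφle⟩ := Filter.extraction_of_frequently_atTop hf
    have hx : ∀ n, (z (φ n)).1 ≠ 0 := by
      intro n h0
      have h1 := hφle n
      rw [h0, norm_zero] at h1
      exact hne _ (Prod.ext h0 (norm_le_zero_iff.mp h1))
    have hb : ∀ n, (z (φ n)).2 / (z (φ n)).1 ∈ Metric.closedBall (0 : ℂ) 1 := by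
      intro n
      rw [mem_closedBall_zero_iff, norm_div]
      exact div_le_one_of_le₀ (hφle n) (norm_nonneg _)
    obtain ⟨c, -, ψ, hψ, hc⟩ := (isCompact_closedBall (0 : ℂ) 1).tendsto_subseq hb
    have hzt : Tendsto (fun n => z (φ (ψ n))) atTop (𝓝 0) :=
      hz0.comp (hφ.tendsto_atTop.comp hψ.tendsto_atTop)
    refine ⟨.slope c, strictTransform_mem_of_tendsto (z := fun n => z (φ (ψ n)))
      (w := fun n => ((z (φ (ψ n))).1, (z (φ (ψ n))).2 / (z (φ (ψ n))).1 - c)) ?_ ?_ fun n => hz _⟩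
    · have h1 : Tendsto (fun n => (z (φ (ψ n))).1) atTop (𝓝 0) :=
        (continuous_fst.tendsto' (0 : ℂ × ℂ) 0 rfl).comp hzt
      have h2 := hc.sub_const c
      rw [sub_self] at h2
      exact h1.prodMk_nhds h2
    · refine Eventually.of_forall fun n => Prod.ext rfl ?_
      simp only [blowUpChart, sub_add_cancel]
      exact mul_div_cancel₀ _ (hx _)
  · rw [Filter.not_frequently] at hf
    obtain ⟨φ, hφ, hφle⟩ := Filter.extraction_of_frequently_atTop hf.frequently
    have hlt : ∀ n, ‖(z (φ n)).1‖ < ‖(z (φ n)).2‖ := fun n => not_le.mp (hφle n)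
    have hy : ∀ n, (z (φ n)).2 ≠ 0 := fun n =>
      norm_pos_iff.mp ((norm_nonneg _).trans_lt (hlt n))
    have hb : ∀ n, (z (φ n)).1 / (z (φ n)).2 ∈ Metric.closedBall (0 : ℂ) 1 := by
      intro n
      rw [mem_closedBall_zero_iff, norm_div]
      exact div_le_one_of_le₀ (hlt n).le (norm_nonneg _)
    obtain ⟨c, -, ψ, hψ, hc⟩ := (isCompact_closedBall (0 : ℂ) 1).tendsto_subseq hb
    have hzt : Tendsto (fun n => z (φ (ψ n))) atTop (𝓝 0) :=
      hz0.comp (hφ.tendsto_atTop.comp hψ.tendsto_atTop)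
    by_cases hc0 : c = 0
    · subst hc0
      refine ⟨.vertical, strictTransform_mem_of_tendsto (z := fun n => z (φ (ψ n)))
        (w := fun n => ((z (φ (ψ n))).1 / (z (φ (ψ n))).2, (z (φ (ψ n))).2)) ?_ ?_ fun n => hz _⟩
      · exact hc.prodMk_nhds ((continuous_snd.tendsto' (0 : ℂ × ℂ) 0 rfl).comp hzt)
      · exact Eventually.of_forall fun n => Prod.ext (div_mul_cancel₀ _ (hy _)) rfl
    -- A nonzero limit `c` of `x / y` belongs to the line of slope `c⁻¹`; the vertical chart is
    -- needed only for the limit zero.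
    · refine ⟨.slope c⁻¹, strictTransform_mem_of_tendsto (z := fun n => z (φ (ψ n)))
        (w := fun n => ((z (φ (ψ n))).1, (z (φ (ψ n))).2 / (z (φ (ψ n))).1 - c⁻¹)) ?_ ?_
        fun n => hz _⟩
      · have h1 : Tendsto (fun n => (z (φ (ψ n))).1) atTop (𝓝 0) :=
          (continuous_fst.tendsto' (0 : ℂ × ℂ) 0 rfl).comp hzt
        have h2 := (hc.inv₀ hc0).sub_const c⁻¹
        rw [sub_self] at h2
        refine h1.prodMk_nhds (h2.congr fun n => ?_)
        simp [inv_div]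
      · filter_upwards [hc.eventually_ne hc0] with n hn
        have hx : (z (φ (ψ n))).1 ≠ 0 := fun h0 => hn (by simp [h0])
        refine Prod.ext rfl ?_
        simp only [blowUpChart, sub_add_cancel]
        exact mul_div_cancel₀ _ hx

lemma BlowUps.mem_centers_of_prefix (τ : BlowUps) {p q : NearPoint} (hpq : p <+: q)
    (hq : q ∈ τ.centers) : p ∈ τ.centers := by
  obtain ⟨s, rfl⟩ := hpq
  induction s using List.reverseRecOn with
  | nil => simpa using hq
  | append_singleton s d ih => exact ih (τ.mem_of_append _ d (by rwa [← List.append_assoc] at hq))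

lemma BlowUps.mem_points_of_append (τ : BlowUps) {p : NearPoint} {d : Direction}
    (hp : p ∈ τ.centers) (hd : p ++ [d] ∉ τ.centers) : p ++ [d] ∈ τ.points := by
  refine ⟨hd, fun q hq hne => τ.mem_centers_of_prefix ?_ hp⟩
  rcases List.prefix_concat_iff.mp hq with h | h
  · exact absurd h hne
  · exact h

lemma BlowUps.nil_mem (τ : BlowUps) (h : [] ∉ τ.centers) : [] ∈ τ.points :=
  ⟨h, fun _ hq hne => absurd (List.prefix_nil.mp hq) hne⟩

lemma BlowUps.mem_centers_or (τ : BlowUps) (p : NearPoint) :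
    p ∈ τ.centers ∨ ∃ q ∈ τ.points, q <+: p := by
  induction p using List.reverseRecOn with
  | nil =>
    by_cases h : [] ∈ τ.centers
    · exact Or.inl h
    · exact Or.inr ⟨[], τ.nil_mem h, List.prefix_rfl⟩
  | append_singleton p d ih =>
    rcases ih with h | ⟨q, hq, hqp⟩
    · by_cases hd : p ++ [d] ∈ τ.centers
      · exact Or.inl hd
      · exact Or.inr ⟨_, τ.mem_points_of_append h hd, List.prefix_rfl⟩
    · exact Or.inr ⟨q, hq, hqp.trans (List.prefix_append _ _)⟩

lemma BlowUps.eq_of_prefix (τ : BlowUps) {p q : NearPoint} (hp : p ∈ τ.points) (hq : q ∈ τ.points)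
    (h : p <+: q) : p = q := by
  by_contra hne
  exact hp.1 (hq.2 p h hne)

/-- A strict transform at a point that is blown up passes through a point over it. -/
lemma BlowUps.exists_point (τ : BlowUps) (hp : p ∈ τ.centers)
    (h : (0 : ℂ × ℂ) ∈ strictTransform p C) :
    ∃ q ∈ τ.points, p <+: q ∧ (0 : ℂ × ℂ) ∈ strictTransform q C := by
  -- The lengths of the finitely many centers are bounded, so following the strict transform upwards
  -- must leave the centers.
  obtain ⟨L, hL⟩ : ∃ L, ∀ r ∈ τ.centers, r.length ≤ L :=
    ⟨τ.centers.sup List.length, fun r hr => Finset.le_sup (f := List.length) hr⟩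
  induction hn : L - p.length generalizing p with
  | zero =>
    obtain ⟨d, hd⟩ := exists_direction h
    by_cases hc : p ++ [d] ∈ τ.centers
    · have h1 := hL _ hc
      simp at h1
      omega
    · exact ⟨_, τ.mem_points_of_append hp hc, List.prefix_append _ _, hd⟩
  | succ n ih =>
    obtain ⟨d, hd⟩ := exists_direction h
    by_cases hc : p ++ [d] ∈ τ.centers
    · obtain ⟨q, hq, hpq, h0⟩ := ih hc hd (by simp; omega)
      exact ⟨q, hq, (List.prefix_append _ _).trans hpq, h0⟩
    · exact ⟨_, τ.mem_points_of_append hp hc, List.prefix_append _ _, hd⟩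

/-- The components of a curve that pass through the origin, not only by their equation. -/
def Curve.Active (S : Curve) (i : Fin S.k) : Prop :=
  (0 : ℂ × ℂ) ∈ strictTransform [] (S.component i)

lemma Curve.Active.exists_point {S : Curve} {i : Fin S.k} (h : S.Active i) (τ : BlowUps) :
    ∃ q ∈ τ.points, (0 : ℂ × ℂ) ∈ strictTransform q (S.component i) := by
  by_cases h0 : [] ∈ τ.centers
  · obtain ⟨q, hq, -, h1⟩ := τ.exists_point h0 h
    exact ⟨q, hq, h1⟩
  · exact ⟨[], τ.nil_mem h0, h⟩

lemma Curve.active_of_mem {S : Curve} {i : Fin S.k}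
    (h : (0 : ℂ × ℂ) ∈ strictTransform p (S.component i)) : S.Active i :=
  strictTransform_mem_of_prefix List.nil_prefix h

end

/-! ### Simultaneous extension from the branches -/

section

variable {S : Curve} {i : Fin S.k} {p q : NearPoint} {γ γ' : ℂ → ℂ × ℂ}

lemma IsLift.isEqn (h : IsLift (S.eqn i) p γ) : IsEqn (S.eqn i) (fun t => p.proj (γ t)) :=
  h.isArc.isEqn_of_irreducible (S.analyticAt i) (S.irreducible i) h.vanish

lemma IsLift.mem (h : IsLift (S.eqn i) p γ) : (0 : ℂ × ℂ) ∈ strictTransform p (S.component i) :=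
  h.mem_strictTransform

lemma IsLift.active (h : IsLift (S.eqn i) p γ) : S.Active i := Curve.active_of_mem h.mem

/-- Distinct components have no common branch. -/
lemma IsLift.eq_of_vanish (h : IsLift (S.eqn i) p γ) {j : Fin S.k}
    (h0 : ∀ᶠ t in 𝓝 (0 : ℂ), S.eqn j (p.proj (γ t)) = 0) : i = j := by
  by_contra hne
  exact S.not_associated i j hne
    (h.isEqn.associated (S.analyticAt j) (S.irreducible i) (S.irreducible j) h0)

open Classical in
/-- The order from which on functions on a branch extend by functions vanishing on the other
components. -/
noncomputable def Curve.bound (S : Curve) (i : Fin S.k) (δ : ℂ → ℂ × ℂ) : ℕ∞ :=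
  different (S.eqn i) δ +
    ∑ j ∈ {j | S.Active j ∧ j ≠ i}, analyticOrderAt (fun t => S.eqn j (δ t)) 0

lemma IsLift.bound_eq (h : IsLift (S.eqn i) p γ) (h' : IsLift (S.eqn i) q γ') :
    S.bound i (fun t => q.proj (γ' t)) = S.bound i (fun t => p.proj (γ t)) := by
  have h1 := h.order_eq (S.analyticAt i) (S.irreducible i) h'
  simp only [Curve.bound, different, h1]

lemma IsLift.bound_ne_top (h : IsLift (S.eqn i) p γ) : S.bound i (fun t => p.proj (γ t)) ≠ ⊤ := by
  classical
  rw [Curve.bound, Ne, ENat.add_eq_top, not_or]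
  refine ⟨order_pd_ne_top_or h.isArc h.isEqn, WithTop.sum_ne_top.mpr fun j hj h1 => ?_⟩
  exact (Finset.mem_filter.mp hj).2.2 (h.eq_of_vanish (analyticOrderAt_eq_top.mp h1)).symm

/-- Functions of sufficiently high orders on the branches of a curve extend simultaneously. -/
lemma Curve.exists_extension {P : Fin S.k → NearPoint} {Γ : Fin S.k → ℂ → ℂ × ℂ}
    (hL : ∀ i, S.Active i → IsLift (S.eqn i) (P i) (Γ i)) {k : Fin S.k → ℂ → ℂ}
    (hk : ∀ i, S.Active i → AnalyticAt ℂ (k i) 0)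
    (hle : ∀ i, S.Active i → S.bound i (fun t => (P i).proj (Γ i t)) ≤ analyticOrderAt (k i) 0) :
    ∃ F, AnalyticAt ℂ F 0 ∧ ∀ i, S.Active i → ∀ᶠ t in 𝓝 (0 : ℂ), F ((P i).proj (Γ i t)) = k i t := by
  classical
  let J : Fin S.k → Finset (Fin S.k) := fun i => {j | S.Active j ∧ j ≠ i}
  -- The datum is divided by the product of the other equations along the branch. By the choice of
  -- `bound` the quotient still has at least the order of the different, so it extends.
  have hJ : ∀ i, S.Active i → ∃ F, AnalyticAt ℂ F 0 ∧ ∀ᶠ t in 𝓝 (0 : ℂ),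
      F ((P i).proj (Γ i t)) * ∏ j ∈ J i, S.eqn j ((P i).proj (Γ i t)) = k i t := by
    intro i hi
    have h := hL i hi
    have ha : ∀ j, AnalyticAt ℂ (fun t => S.eqn j ((P i).proj (Γ i t))) 0 := fun j =>
      (S.analyticAt j).fun_comp_of_eq h.isArc.analyticAt h.isArc.map_zero
    have hprod : analyticOrderAt (fun t => ∏ j ∈ J i, S.eqn j ((P i).proj (Γ i t))) 0 =
        ∑ j ∈ J i, analyticOrderAt (fun t => S.eqn j ((P i).proj (Γ i t))) 0 := by
      induction J i using Finset.induction_on with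
      | empty => simpa using order_eq_zero_of_ne (u := fun _ => (1 : ℂ)) one_ne_zero
      | insert j s hj ih =>
        rw [Finset.sum_insert hj, ← ih]
        have h1 := analyticOrderAt_mul (ha j) (Finset.analyticAt_fun_prod s fun j _ => ha j)
        refine Eq.trans (congrArg (analyticOrderAt · 0) (funext fun t => ?_)) h1
        exact Finset.prod_insert hj
    have hpa : AnalyticAt ℂ (fun t => ∏ j ∈ J i, S.eqn j ((P i).proj (Γ i t))) 0 :=
      Finset.analyticAt_fun_prod _ fun j _ => ha j
    have hb := hle i hi
    have hne := h.bound_ne_top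
    rw [Curve.bound, ← hprod] at hb
    rw [Curve.bound, ← hprod, Ne, ENat.add_eq_top, not_or] at hne
    obtain ⟨g, hg, he⟩ := exists_eq_mul_of_order_le hpa (hk i hi) (le_add_self.trans hb) hne.2
    have hord := analyticOrderAt_mul hg hpa
    have h2 : analyticOrderAt (k i) 0 = _ := (analyticOrderAt_congr he).trans hord
    rw [h2] at hb
    obtain ⟨F, hF, hFe⟩ := h.isArc.exists_lift h.isEqn hg
      ((ENat.add_le_add_iff_right hne.2).mp hb)
    refine ⟨F, hF, ?_⟩
    filter_upwards [hFe, he] with t a b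
    rw [a, b]
  choose! F hF hFe using hJ
  -- On the `i`-th branch every summand except the `i`-th contains the factor `S.eqn i`.
  refine ⟨fun z => ∑ i ∈ {i | S.Active i}, F i z * ∏ j ∈ J i, S.eqn j z, ?_, ?_⟩
  · refine Finset.analyticAt_fun_sum _ fun i hi => ?_
    exact (hF i (Finset.mem_filter.mp hi).2).mul
      (Finset.analyticAt_fun_prod _ fun j _ => S.analyticAt j)
  · intro i hi
    filter_upwards [hFe i hi, (hL i hi).vanish] with t h1 h2
    rw [Finset.sum_eq_single i, h1]
    · intro j hj hji
      refine mul_eq_zero_of_right _ (Finset.prod_eq_zero (i := i) ?_ h2)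
      simp [J, hi, hji.symm]
    · intro h3
      exact absurd (by simpa using hi) h3

lemma BlowUps.MakesSmooth.exists_isLift {σ : BlowUps} (hσ : σ.MakesSmooth S) (hp : p ∈ σ.points)
    (h0 : (0 : ℂ × ℂ) ∈ strictTransform p (S.component i)) : ∃ γ, IsLift (S.eqn i) p γ := by
  obtain ⟨γ, hγ⟩ := hσ i p hp h0
  exact ⟨γ, IsRegularParam.isLift (S.analyticAt i) h0 hγ⟩

/-- All functions of order at least the bounds extend. -/
lemma BlowUps.lifts_of_bound_le {σ : BlowUps} {N : ℕ}
    (hN : ∀ i p γ, p ∈ σ.points → IsLift (S.eqn i) p γ → S.bound i (fun t => p.proj (γ t)) ≤ N) :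
    σ.Lifts S N := by
  intro f hf
  -- Only active components matter: the strict transform of any other one passes through no point
  -- over the origin.
  have h1 : ∀ i, S.Active i → ∃ p γ, p ∈ σ.points ∧
      (0 : ℂ × ℂ) ∈ strictTransform p (S.component i) ∧
      IsRegularParam (strictTransform p (S.component i)) γ ∧
      AnalyticAt ℂ (f i p ∘ γ) 0 ∧ (N : ℕ∞) ≤ analyticOrderAt (f i p ∘ γ) 0 := by
    intro i hi
    obtain ⟨p, hp, h0⟩ := hi.exists_point σ
    obtain ⟨γ, h1, h2, h3⟩ := hf i p hp h0
    exact ⟨p, γ, hp, h0, h1, h2, h3⟩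
  choose! P Γ hP h0 hΓ hk hN' using h1
  have hL : ∀ i, S.Active i → IsLift (S.eqn i) (P i) (Γ i) := fun i hi =>
    IsRegularParam.isLift (S.analyticAt i) (h0 i hi) (hΓ i hi)
  obtain ⟨F, hF, he⟩ := Curve.exists_extension hL hk
    fun i hi => (hN i _ _ (hP i hi) (hL i hi)).trans (hN' i hi)
  refine ⟨F, hF, fun i p hp h => ?_⟩
  have hi := Curve.active_of_mem h
  -- A branch meets the exceptional divisor of `σ` in only one point, since two such points would be
  -- comparable.
  have hpP : p = P i := by
    rcases (hL i hi).isEqn.comparable (hL i hi).isRegular.isArc (hL i hi).off h with h1 | h1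
    · exact σ.eq_of_prefix hp (hP i hi) h1
    · exact (σ.eq_of_prefix (hP i hi) hp h1).symm
  rw [hpP, ← (hΓ i hi).2.2.2]
  exact he i hi

end

/-! ### The exceptional divisor in local coordinates -/

/-- `F` is a monomial times a unit. -/
def IsMonomial (F : ℂ × ℂ → ℂ) : Prop :=
  ∃ (a b : ℕ) (U : ℂ × ℂ → ℂ), AnalyticAt ℂ U 0 ∧ U 0 ≠ 0 ∧
    ∀ᶠ z in 𝓝 (0 : ℂ × ℂ), F z = z.1 ^ a * z.2 ^ b * U z

lemma IsMonomial.mul {F G : ℂ × ℂ → ℂ} (hF : IsMonomial F) (hG : IsMonomial G) :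
    IsMonomial (fun z => F z * G z) := by
  obtain ⟨a, b, U, hU, hU0, h1⟩ := hF
  obtain ⟨c, d, V, hV, hV0, h2⟩ := hG
  refine ⟨a + c, b + d, fun z => U z * V z, hU.mul hV, mul_ne_zero hU0 hV0, ?_⟩
  filter_upwards [h1, h2] with z h1 h2
  rw [h1, h2]; ring

lemma isMonomial_unit {U : ℂ × ℂ → ℂ} (hU : AnalyticAt ℂ U 0) (h0 : U 0 ≠ 0) : IsMonomial U :=
  ⟨0, 0, U, hU, h0, by simp⟩

/-- Each chart multiplies one coordinate by the other or by the other plus a constant `c`; for `c ≠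
0` the latter is a unit at the origin. -/
lemma isMonomial_proj (q : NearPoint) :
    IsMonomial (fun z => (q.proj z).1) ∧ IsMonomial (fun z => (q.proj z).2) := by
  induction q with
  | nil =>
    exact ⟨⟨1, 0, fun _ => 1, analyticAt_const, one_ne_zero, Eventually.of_forall fun z => by
        simp [proj_nil]⟩,
      ⟨0, 1, fun _ => 1, analyticAt_const, one_ne_zero, Eventually.of_forall fun z => by
        simp [proj_nil]⟩⟩
  | cons d q ih =>
    cases d with
    | slope c =>
      refine ⟨ih.1, ih.1.mul ?_⟩
      by_cases hc : c = 0
      · subst hc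
        simpa using ih.2
      · exact isMonomial_unit (((analyticAt_snd.comp (analyticAt_proj q 0)).add analyticAt_const))
          (by simp [hc])
    | vertical => exact ⟨ih.1.mul ih.2, ih.2⟩

lemma isMonomial_exc (d : Direction) (q : NearPoint) : IsMonomial (fun z => exc d (q.proj z)) := by
  cases d
  · exact (isMonomial_proj q).1
  · exact (isMonomial_proj q).2

lemma proj_eq_zero_of_suffix {d : Direction} {s q : NearPoint} (h : d :: s <:+ q) {z : ℂ × ℂ}
    (h0 : exc d (s.proj z) = 0) : q.proj z = 0 := by
  obtain ⟨r, rfl⟩ := h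
  rw [proj_append, proj_cons, (blowUpChart_eq_zero_iff d _).mpr h0, proj_zero]

lemma tendsto_axis_fst : Tendsto (fun s : ℂ => (s, (0 : ℂ))) (𝓝 0) (𝓝 0) := by
  have : Continuous (fun s : ℂ => (s, (0 : ℂ))) := by fun_prop
  exact this.tendsto' _ _ rfl

lemma tendsto_axis_snd : Tendsto (fun s : ℂ => ((0 : ℂ), s)) (𝓝 0) (𝓝 0) := by
  have : Continuous (fun s : ℂ => ((0 : ℂ), s)) := by fun_prop
  exact this.tendsto' _ _ rfl

lemma order_monomial_eq {F : ℂ × ℂ → ℂ} {a b : ℕ} {U : ℂ × ℂ → ℂ} (hU : AnalyticAt ℂ U 0)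
    (hU0 : U 0 ≠ 0) (h : ∀ᶠ z in 𝓝 (0 : ℂ × ℂ), F z = z.1 ^ a * z.2 ^ b * U z)
    {γ : ℂ → ℂ × ℂ} (hγ : IsArc γ) : analyticOrderAt (fun t => F (γ t)) 0 =
      a * analyticOrderAt (fun t => (γ t).1) 0 + b * analyticOrderAt (fun t => (γ t).2) 0 := by
  have hUa : AnalyticAt ℂ (fun t => U (γ t)) 0 := hU.fun_comp_of_eq hγ.analyticAt hγ.map_zero
  have e : analyticOrderAt (fun t => F (γ t)) 0 =
      analyticOrderAt (fun t => (γ t).1 ^ a * (γ t).2 ^ b * U (γ t)) 0 :=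
    analyticOrderAt_congr (hγ.tendsto.eventually h)
  rw [e, order_mul_unit (a := fun t => (γ t).1 ^ a * (γ t).2 ^ b)
    ((hγ.fst_analyticAt.pow a).mul (hγ.snd_analyticAt.pow b)) hUa
    (by simpa [hγ.map_zero] using hU0)]
  have h1 := analyticOrderAt_mul (hγ.fst_analyticAt.pow a) (hγ.snd_analyticAt.pow b)
  rw [analyticOrderAt_pow hγ.fst_analyticAt, analyticOrderAt_pow hγ.snd_analyticAt, nsmul_eq_mul,
    nsmul_eq_mul] at h1
  exact h1

/-- One of the two coordinates. -/
noncomputable def coord : Bool → ℂ × ℂ →L[ℂ] ℂ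
  | false => ContinuousLinearMap.fst ℂ ℂ ℂ
  | true => ContinuousLinearMap.snd ℂ ℂ ℂ

/-- The exceptional divisor at `q` is the smooth curve on which the coordinate `c` vanishes. -/
def IsAxis (c : Bool) (q : NearPoint) : Prop :=
  ∀ᶠ z in 𝓝 (0 : ℂ × ℂ), q.proj z = 0 ↔ coord c z = 0

/-- The exceptional divisor is one of the axes, or both of them. -/
lemma isAxis_or_corner {q : NearPoint} (hq : q ≠ []) :
    (∃ c, IsAxis c q) ∨ ∀ᶠ z in 𝓝 (0 : ℂ × ℂ), q.proj z = 0 ↔ z.1 = 0 ∨ z.2 = 0 := by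
  obtain ⟨d, s, rfl⟩ := List.exists_cons_of_ne_nil hq
  obtain ⟨a, b, U, hU, hU0, h⟩ := isMonomial_exc d s
  have h1 : ∀ᶠ z in 𝓝 (0 : ℂ × ℂ), NearPoint.proj (d :: s) z = 0 ↔
      z.1 ^ a * z.2 ^ b = 0 := by
    filter_upwards [h, hU.continuousAt.eventually_ne hU0] with z hz hz1
    rw [proj_cons, blowUpChart_eq_zero_iff, hz]
    simp [hz1]
  by_cases ha : a = 0
  · by_cases hb : b = 0
    · have := h1.self_of_nhds
      simp [ha, hb] at this
    · left
      refine ⟨true, h1.mono fun z hz => hz.trans ?_⟩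
      simp [ha, hb, coord]
  · by_cases hb : b = 0
    · left
      refine ⟨false, h1.mono fun z hz => hz.trans ?_⟩
      simp [ha, hb, coord]
    · right
      refine h1.mono fun z hz => hz.trans ?_
      simp [ha, hb]

/-- Arcs transverse to the exceptional divisor. -/
lemma sameOrders_of_isAxis {c : Bool} {q : NearPoint} (hc : IsAxis c q) {γ γ' : ℂ → ℂ × ℂ}
    (hγ : IsArc γ) (hγ' : IsArc γ') (h : analyticOrderAt (fun t => coord c (γ t)) 0 = 1)
    (h' : analyticOrderAt (fun t => coord c (γ' t)) 0 = 1) : SameOrders q γ γ' := by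
  intro d s hs
  obtain ⟨a, b, U, hU, hU0, he⟩ := isMonomial_exc d s
  rw [order_monomial_eq hU hU0 he hγ, order_monomial_eq hU hU0 he hγ']
  -- The zeros of the monomial lie in the exceptional divisor, so only the coordinate `c` divides
  -- it. Along an arc on which `c` has order one, the order is just the exponent, whatever the arc.
  have key : ∀ᶠ z in 𝓝 (0 : ℂ × ℂ), z.1 ^ a * z.2 ^ b = 0 → coord c z = 0 := by
    filter_upwards [he, hc] with z h1 h2 h3
    exact h2.mp (proj_eq_zero_of_suffix hs (by rw [h1, h3, zero_mul]))
  cases c with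
  | false =>
    have hb : b = 0 := by
      by_contra hb
      obtain ⟨t, h1, h2⟩ := (((tendsto_axis_fst.eventually key).filter_mono
        nhdsWithin_le_nhds).and (self_mem_nhdsWithin (s := ({0}ᶜ : Set ℂ)))).exists
      exact h2 (h1 (by simp [hb]))
    change analyticOrderAt (fun t => (γ t).1) 0 = 1 at h
    change analyticOrderAt (fun t => (γ' t).1) 0 = 1 at h'
    rw [hb, h, h']; simp
  | true =>
    have ha : a = 0 := by
      by_contra ha
      obtain ⟨t, h1, h2⟩ := (((tendsto_axis_snd.eventually key).filter_mono
        nhdsWithin_le_nhds).and (self_mem_nhdsWithin (s := ({0}ᶜ : Set ℂ)))).exists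
      exact h2 (h1 (by simp [ha]))
    change analyticOrderAt (fun t => (γ t).2) 0 = 1 at h
    change analyticOrderAt (fun t => (γ' t).2) 0 = 1 at h'
    rw [ha, h, h']; simp

/-! ### Normal crossings -/

/-- A normal crossing or smooth curve consists of branches parametrized by the axes of the
coordinates. -/
lemma IsNormalCrossingAt.exists_axes {A : Set (ℂ × ℂ)} (h : IsNormalCrossingAt A) :
    ∃ (A₁ A₂ : ℂ → ℂ × ℂ) (G₁ G₂ : ℂ × ℂ → ℂ), IsRegular A₁ ∧ IsRegular A₂ ∧
      (∀ c : ℂ × ℂ →L[ℂ] ℂ, c ≠ 0 → c (deriv A₁ 0) = 0 → c (deriv A₂ 0) ≠ 0) ∧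
      AnalyticAt ℂ G₁ 0 ∧ AnalyticAt ℂ G₂ 0 ∧
      (∀ᶠ t in 𝓝 (0 : ℂ), G₁ (A₁ t) = 0 ∧ G₁ (A₂ t) = t ∧ G₂ (A₁ t) = t ∧ G₂ (A₂ t) = 0) ∧
      ∀ U ∈ 𝓝 (0 : ℂ), ∀ᶠ z in 𝓝 (0 : ℂ × ℂ), z ∈ A → ∃ t ∈ U, A₁ t = z ∨ A₂ t = z := by
  obtain ⟨Φ, hΦ, hΦ0, hbij, hA⟩ := h
  let i : (ℂ × ℂ) ≃L[ℂ] (ℂ × ℂ) := (LinearEquiv.ofBijective (fderiv ℂ Φ 0).toLinearMap hbij).toContinuousLinearEquiv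
  have hi : (i : ℂ × ℂ →L[ℂ] ℂ × ℂ) = fderiv ℂ Φ 0 := by ext <;> rfl
  have hs : HasStrictFDerivAt Φ (i : ℂ × ℂ →L[ℂ] ℂ × ℂ) 0 := by
    rw [hi]; exact hΦ.hasStrictFDerivAt
  let R := hs.toOpenPartialHomeomorph Φ
  have h0R : (0 : ℂ × ℂ) ∈ R.source := hs.mem_toOpenPartialHomeomorph_source
  have hΨa : AnalyticAt ℂ R.symm (Φ 0) := R.analyticAt_symm' h0R hΦ hi.symm
  have hr : ∀ᶠ w in 𝓝 (Φ 0), Φ (R.symm w) = w := R.eventually_right_inverse (R.map_source h0R)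
  have hl : ∀ᶠ z in 𝓝 (0 : ℂ × ℂ), R.symm (Φ z) = z := R.eventually_left_inverse h0R
  have hΨ0 : R.symm (Φ 0) = 0 := R.left_inv h0R
  rw [hΦ0] at hΨa hr hΨ0
  set Ψ : ℂ × ℂ → ℂ × ℂ := ⇑R.symm with hΨdef
  have hD : (fderiv ℂ Ψ 0).comp (fderiv ℂ Φ 0) = ContinuousLinearMap.id ℂ (ℂ × ℂ) := by
    have h1 : HasFDerivAt Ψ (fderiv ℂ Ψ 0) (Φ 0) := by
      rw [hΦ0]; exact hΨa.differentiableAt.hasFDerivAt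
    have h2 := h1.comp 0 hΦ.differentiableAt.hasFDerivAt
    exact h2.unique ((hasFDerivAt_id (0 : ℂ × ℂ)).congr_of_eventuallyEq hl)
  have hd : ∀ v : ℂ × ℂ, HasDerivAt (fun t : ℂ => Ψ (t • v)) (fderiv ℂ Ψ 0 v) 0 := by
    intro v
    have h1 : HasFDerivAt Ψ (fderiv ℂ Ψ 0) ((0 : ℂ) • v) := by
      rw [zero_smul]; exact hΨa.differentiableAt.hasFDerivAt
    have h2 := h1.comp_hasDerivAt (0 : ℂ) ((hasDerivAt_id (0 : ℂ)).smul_const v)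
    rw [one_smul] at h2
    exact h2
  have hreg : ∀ v : ℂ × ℂ, v ≠ 0 → IsRegular (fun t : ℂ => Ψ (t • v)) := by
    intro v hv
    refine ⟨hΨa.fun_comp_of_eq (analyticAt_id.smul analyticAt_const) (by simp), by simpa using hΨ0,
      ?_⟩
    rw [(hd v).deriv]
    intro h1
    obtain ⟨w, rfl⟩ := hbij.2 v
    have h2 := DFunLike.congr_fun hD w
    simp only [ContinuousLinearMap.comp_apply, ContinuousLinearMap.id_apply] at h2
    rw [h1] at h2
    exact hv (by rw [← h2, map_zero])
  have hsm : ∀ v : ℂ × ℂ, ∀ᶠ t in 𝓝 (0 : ℂ), Φ (Ψ (t • v)) = t • v := by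
    intro v
    have h1 : Tendsto (fun t : ℂ => t • v) (𝓝 0) (𝓝 0) := by
      have : Continuous (fun t : ℂ => t • v) := by fun_prop
      exact this.tendsto' _ _ (zero_smul _ _)
    exact h1.eventually hr
  -- These arcs are the axes `Φ₁ = 0` and `Φ₂ = 0`, parametrized by the other coordinate. In the
  -- smooth case the second axis is superfluous, but the covering property still holds.
  refine ⟨fun t => Ψ (t • (0, 1)), fun t => Ψ (t • (1, 0)), fun z => (Φ z).1, fun z => (Φ z).2,
    hreg _ (by simp), hreg _ (by simp), ?_, analyticAt_fst.comp hΦ, analyticAt_snd.comp hΦ, ?_, ?_⟩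
  · intro c hc h1 h2
    rw [(hd _).deriv] at h1 h2
    refine hc (ContinuousLinearMap.ext fun w => ?_)
    have h3 := DFunLike.congr_fun hD w
    simp only [ContinuousLinearMap.comp_apply, ContinuousLinearMap.id_apply] at h3
    set v := fderiv ℂ Φ 0 w
    have h4 : v = v.1 • ((1 : ℂ), (0 : ℂ)) + v.2 • ((0 : ℂ), (1 : ℂ)) := by ext <;> simp
    rw [← h3, h4, map_add, map_smul, map_smul, map_add, map_smul, map_smul, h1, h2]
    simp
  · filter_upwards [hsm (0, 1), hsm (1, 0)] with t h1 h2
    simp only [h1, h2]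
    simp
  · intro U hU
    have h1 : ∀ᶠ z in 𝓝 (0 : ℂ × ℂ), z ∈ A → (Φ z).1 = 0 ∨ (Φ z).2 = 0 := by
      rcases hA with h1 | h1
      · filter_upwards [h1] with z hz hzA
        exact Or.inl (hz.mp hzA)
      · filter_upwards [h1] with z hz hzA
        exact mul_eq_zero.mp (hz.mp hzA)
    have hΦt : Tendsto Φ (𝓝 0) (𝓝 0) := tendsto_zero hΦ hΦ0
    have h2 := hΦt.eventually ((continuous_fst.tendsto' (0 : ℂ × ℂ) 0 rfl).eventually hU)
    have h3 := hΦt.eventually ((continuous_snd.tendsto' (0 : ℂ × ℂ) 0 rfl).eventually hU)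
    filter_upwards [h1, h2, h3, hl] with z h4 h5 h6 h7 hzA
    rcases h4 hzA with h8 | h8
    · refine ⟨(Φ z).2, h6, Or.inl ?_⟩
      have : (Φ z).2 • ((0 : ℂ), (1 : ℂ)) = Φ z := Prod.ext (by simp [h8]) (by simp)
      rw [this, h7]
    · refine ⟨(Φ z).1, h5, Or.inr ?_⟩
      have : (Φ z).1 • ((1 : ℂ), (0 : ℂ)) = Φ z := Prod.ext (by simp) (by simp [h8])
      rw [this, h7]

/-! ### Transversality of the strict transform to the exceptional divisor. -/

section

variable {S : Curve} {q : NearPoint}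

lemma mem_strictTransform_support :
    (0 : ℂ × ℂ) ∈ strictTransform q S.support ↔
      ∃ i, (0 : ℂ × ℂ) ∈ strictTransform q (S.component i) := by
  have : strictTransform q S.support = ⋃ i, strictTransform q (S.component i) := by
    rw [strictTransform, Curve.support, Set.preimage_iUnion, Set.iUnion_sdiff,
      closure_iUnion_of_finite]
    rfl
  rw [this, Set.mem_iUnion]

lemma mem_fullTransform {i : Fin S.k} {z : ℂ × ℂ} (h : q.proj z ∈ S.component i)
    (h0 : q.proj z ≠ 0) : z ∈ fullTransform q S :=
  Or.inl (subset_closure ⟨Set.mem_iUnion.mpr ⟨i, h⟩, h0⟩)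

lemma analyticAt_proj_comp {γ : ℂ → ℂ × ℂ} (hγ : IsArc γ) :
    AnalyticAt ℂ (fun t => q.proj (γ t)) 0 :=
  (analyticAt_proj q _).fun_comp_of_eq hγ.analyticAt rfl

/-- An analytic function on an arc vanishes if it does so at points tending to the origin. -/
lemma eventually_zero_of_frequently {E : Type*} [NormedAddCommGroup E] [NormedSpace ℂ E]
    {F : ℂ → E} (hF : AnalyticAt ℂ F 0) (h : ∀ U ∈ 𝓝 (0 : ℂ), ∃ t ∈ U, t ≠ 0 ∧ F t = 0) :
    ∀ᶠ t in 𝓝 (0 : ℂ), F t = 0 := by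
  refine hF.frequently_zero_iff_eventually_zero.mp ?_
  rw [frequently_nhdsWithin_iff]
  intro hU
  obtain ⟨t, ht, h0, h1⟩ := h _ hU
  exact ht ⟨h1, h0⟩

/-- The exceptional divisor contains one of the axes. -/
lemma exists_axis_subset (hq : q ≠ []) : ∃ κ : ℂ → ℂ × ℂ, Tendsto κ (𝓝 0) (𝓝 0) ∧
    (∀ s, s ≠ 0 → κ s ≠ 0) ∧ ∀ᶠ s in 𝓝 (0 : ℂ), q.proj (κ s) = 0 := by
  rcases isAxis_or_corner hq with ⟨c, hc⟩ | hc
  · cases c with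
    | false =>
      exact ⟨_, tendsto_axis_snd, fun s hs h => hs (congrArg Prod.snd h),
        (tendsto_axis_snd.eventually hc).mono fun s hs => hs.mpr rfl⟩
    | true =>
      exact ⟨_, tendsto_axis_fst, fun s hs h => hs (congrArg Prod.fst h),
        (tendsto_axis_fst.eventually hc).mono fun s hs => hs.mpr rfl⟩
  · exact ⟨_, tendsto_axis_fst, fun s hs h => hs (congrArg Prod.fst h),
        (tendsto_axis_fst.eventually hc).mono fun s hs => hs.mpr (Or.inr rfl)⟩

/-- If two branches cover the exceptional divisor, one of them is contained in it. -/
lemma eventually_zero_or_of_axis (hq : q ≠ []) {A₁ A₂ : ℂ → ℂ × ℂ} (h₁ : IsArc A₁) (h₂ : IsArc A₂)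
    (hA : ∀ U ∈ 𝓝 (0 : ℂ), ∀ᶠ z in 𝓝 (0 : ℂ × ℂ), z ∈ fullTransform q S →
      ∃ t ∈ U, A₁ t = z ∨ A₂ t = z) :
    (∀ᶠ t in 𝓝 (0 : ℂ), q.proj (A₁ t) = 0) ∨ ∀ᶠ t in 𝓝 (0 : ℂ), q.proj (A₂ t) = 0 := by
  obtain ⟨κ, hκ, hκ0, hκz⟩ := exists_axis_subset hq
  by_contra hne
  rw [not_or] at hne
  have h3 := (analyticAt_proj_comp (q := q) h₁).eventually_eq_zero_or_eventually_ne_zero.resolve_left hne.1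
  have h4 := (analyticAt_proj_comp (q := q) h₂).eventually_eq_zero_or_eventually_ne_zero.resolve_left hne.2
  rw [eventually_nhdsWithin_iff] at h3 h4
  obtain ⟨s, ⟨h5, h6⟩, h7⟩ := (((hκ.eventually (hA _ (inter_mem h3 h4))).and hκz).filter_mono
    nhdsWithin_le_nhds |>.and (self_mem_nhdsWithin (s := ({0}ᶜ : Set ℂ)))).exists
  obtain ⟨t, ht, h8⟩ := h5 (Or.inr h6)
  have ht0 : t ≠ 0 := by
    rintro rfl
    rw [h₁.map_zero, h₂.map_zero, or_self] at h8
    exact hκ0 s h7 h8.symm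
  rcases h8 with h8 | h8
  · exact ht.1 ht0 (by rw [h8, h6])
  · exact ht.2 ht0 (by rw [h8, h6])

/-- The strict transform has points off the exceptional divisor arbitrarily close to the origin, and
the two arcs must cover them. -/
lemma not_both_exceptional {A₁ A₂ : ℂ → ℂ × ℂ}
    (hA : ∀ U ∈ 𝓝 (0 : ℂ), ∀ᶠ z in 𝓝 (0 : ℂ × ℂ), z ∈ fullTransform q S →
      ∃ t ∈ U, A₁ t = z ∨ A₂ t = z)
    {i : Fin S.k} (h0 : (0 : ℂ × ℂ) ∈ strictTransform q (S.component i))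
    (h1 : ∀ᶠ t in 𝓝 (0 : ℂ), q.proj (A₁ t) = 0) (h2 : ∀ᶠ t in 𝓝 (0 : ℂ), q.proj (A₂ t) = 0) :
    False := by
  obtain ⟨z, hz, hz1, hz2⟩ := exists_of_mem_strictTransform h0 (hA _ (inter_mem h1 h2))
  obtain ⟨t, ht, rfl | rfl⟩ := hz (mem_fullTransform hz1 hz2)
  · exact hz2 ht.1
  · exact hz2 ht.2

/-- Where the strict transform meets the exceptional divisor, their union is not smooth. -/
lemma not_isSmoothCurveAt_fullTransform (hq : q ≠ []) {i : Fin S.k}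
    (h0 : (0 : ℂ × ℂ) ∈ strictTransform q (S.component i)) :
    ¬ IsSmoothCurveAt (fullTransform q S) := by
  rintro ⟨γ, ha, hz, hd, hm⟩
  have hγ : IsArc γ := (IsRegular.mk ha hz hd).isArc
  have hA : ∀ U ∈ 𝓝 (0 : ℂ), ∀ᶠ z in 𝓝 (0 : ℂ × ℂ), z ∈ fullTransform q S →
      ∃ t ∈ U, γ t = z ∨ γ t = z := by
    intro U hU
    have h1 : γ '' U ∈ 𝓝[fullTransform q S] 0 := by rw [← hm]; exact image_mem_map hU
    filter_upwards [mem_nhdsWithin_iff_eventually.mp h1] with z hz hzA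
    obtain ⟨t, ht, rfl⟩ := hz hzA
    exact ⟨t, ht, Or.inl rfl⟩
  -- The statements for two arcs are applied to the single arc `γ` taken twice.
  rcases eventually_zero_or_of_axis hq hγ hγ hA with h1 | h1 <;>
    exact not_both_exceptional hA h0 h1 h1

/-- Here `A₁` covers the exceptional divisor, and `A₂` must carry every component through `q`. The
exceptional divisor is then a single coordinate axis, and the independence of the tangents makes
`A₂` transverse to it. -/
lemma exists_transverse_aux {A₁ A₂ : ℂ → ℂ × ℂ} (h₁ : IsRegular A₁) (h₂ : IsRegular A₂)
    (hind : ∀ c : ℂ × ℂ →L[ℂ] ℂ, c ≠ 0 → c (deriv A₁ 0) = 0 → c (deriv A₂ 0) ≠ 0)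
    (hA : ∀ U ∈ 𝓝 (0 : ℂ), ∀ᶠ z in 𝓝 (0 : ℂ × ℂ), z ∈ fullTransform q S →
      ∃ t ∈ U, A₁ t = z ∨ A₂ t = z) (hq : q ≠ [])
    (hz1 : ∀ᶠ t in 𝓝 (0 : ℂ), q.proj (A₁ t) = 0)
    (hz2 : ¬ ∀ᶠ t in 𝓝 (0 : ℂ), q.proj (A₂ t) = 0) :
    ∃ c γ, IsAxis c q ∧ IsRegular γ ∧ OffExceptional q γ ∧
      analyticOrderAt (fun t => coord c (γ t)) 0 = 1 ∧
      ∀ i, (0 : ℂ × ℂ) ∈ strictTransform q (S.component i) →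
        ∀ᶠ t in 𝓝 (0 : ℂ), S.eqn i (q.proj (γ t)) = 0 := by
  have hoff : OffExceptional q A₂ :=
    (analyticAt_proj_comp h₂.isArc).eventually_eq_zero_or_eventually_ne_zero.resolve_left hz2
  have hoff' := eventually_nhdsWithin_iff.mp hoff
  have hexc : ∀ U ∈ 𝓝 (0 : ℂ), ∀ᶠ z in 𝓝 (0 : ℂ × ℂ), q.proj z = 0 → ∃ t ∈ U, A₁ t = z := by
    intro U hU
    filter_upwards [hA _ (inter_mem hU hoff')] with z hz h0
    obtain ⟨t, ht, h | h⟩ := hz (Or.inr h0)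
    · exact ⟨t, ht.1, h⟩
    · by_cases ht0 : t = 0
      · refine ⟨0, mem_of_mem_nhds hU, ?_⟩
        rw [← h, ht0, h₁.map_zero, h₂.map_zero]
      · exact absurd (by rw [h, h0]) (ht.2 ht0)
  have hvan : ∀ i, (0 : ℂ × ℂ) ∈ strictTransform q (S.component i) →
      ∀ᶠ t in 𝓝 (0 : ℂ), S.eqn i (q.proj (A₂ t)) = 0 := by
    intro i hi
    refine eventually_zero_of_frequently ((S.analyticAt i).fun_comp_of_eq
      (analyticAt_proj_comp h₂.isArc) (by simp [h₂.map_zero])) fun U hU => ?_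
    obtain ⟨z, hz, h1, h2⟩ := exists_of_mem_strictTransform hi (hA _ (inter_mem hU hz1))
    obtain ⟨t, ht, rfl | rfl⟩ := hz (mem_fullTransform h1 h2)
    · exact absurd ht.2 h2
    · refine ⟨t, ht.1, ?_, h1⟩
      rintro rfl
      exact h2 (by rw [h₂.map_zero, proj_zero])
  rcases isAxis_or_corner hq with ⟨c, hc⟩ | hc
  · refine ⟨c, A₂, hc, h₂, hoff, ?_, hvan⟩
    have hcne : coord c ≠ 0 := by
      intro h
      cases c with
      | false => simpa [coord] using DFunLike.congr_fun h ((1 : ℂ), (0 : ℂ))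
      | true => simpa [coord] using DFunLike.congr_fun h ((0 : ℂ), (1 : ℂ))
    have hder : ∀ {A : ℂ → ℂ × ℂ}, IsRegular A →
        HasDerivAt (fun t => coord c (A t)) (coord c (deriv A 0)) 0 := fun h =>
      (coord c).hasFDerivAt.comp_hasDerivAt 0 h.analyticAt.differentiableAt.hasDerivAt
    have h3 : ∀ᶠ t in 𝓝 (0 : ℂ), coord c (A₁ t) = 0 := by
      filter_upwards [hz1, h₁.isArc.tendsto.eventually hc] with t h3 h4
      exact h4.mp h3
    have h4 : coord c (deriv A₁ 0) = 0 :=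
      (hder h₁).unique ((hasDerivAt_const (0 : ℂ) (0 : ℂ)).congr_of_eventuallyEq h3)
    refine order_eq_one_of_deriv ((coord c).analyticAt _ |>.comp h₂.analyticAt)
      (by simp [h₂.map_zero]) ?_
    rw [(hder h₂).deriv]
    exact hind _ hcne h4
  -- At a corner the arc `A₁` would cover both axes, so each of its coordinates would have zeros
  -- accumulating at the origin and would vanish identically.
  · exfalso
    refine h₁.isArc.not_both (eventually_zero_of_frequently h₁.isArc.fst_analyticAt fun U hU => ?_)
      (eventually_zero_of_frequently h₁.isArc.snd_analyticAt fun U hU => ?_)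
    · obtain ⟨s, ⟨h5, h6⟩, h7⟩ := (((tendsto_axis_snd.eventually (hexc U hU)).and
        (tendsto_axis_snd.eventually hc)).filter_mono nhdsWithin_le_nhds |>.and
        (self_mem_nhdsWithin (s := ({0}ᶜ : Set ℂ)))).exists
      obtain ⟨t, ht, h8⟩ := h5 (h6.mpr (Or.inl rfl))
      refine ⟨t, ht, ?_, by rw [h8]⟩
      rintro rfl
      rw [h₁.map_zero] at h8
      exact h7 (congrArg Prod.snd h8).symm
    · obtain ⟨s, ⟨h5, h6⟩, h7⟩ := (((tendsto_axis_fst.eventually (hexc U hU)).and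
        (tendsto_axis_fst.eventually hc)).filter_mono nhdsWithin_le_nhds |>.and
        (self_mem_nhdsWithin (s := ({0}ᶜ : Set ℂ)))).exists
      obtain ⟨t, ht, h8⟩ := h5 (h6.mpr (Or.inr rfl))
      refine ⟨t, ht, ?_, by rw [h8]⟩
      rintro rfl
      rw [h₁.map_zero] at h8
      exact h7 (congrArg Prod.fst h8).symm

/-- After a desingularization the strict transform is transverse to the exceptional divisor. -/
lemma exists_transverse (hq : q ≠ []) (hnc : IsNormalCrossingAt (fullTransform q S)) {i : Fin S.k}
    (h0 : (0 : ℂ × ℂ) ∈ strictTransform q (S.component i)) :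
    ∃ c γ, IsAxis c q ∧ IsRegular γ ∧ OffExceptional q γ ∧
      analyticOrderAt (fun t => coord c (γ t)) 0 = 1 ∧
      ∀ i, (0 : ℂ × ℂ) ∈ strictTransform q (S.component i) →
        ∀ᶠ t in 𝓝 (0 : ℂ), S.eqn i (q.proj (γ t)) = 0 := by
  obtain ⟨A₁, A₂, G₁, G₂, h₁, h₂, hind, -, -, -, hA⟩ := hnc.exists_axes
  have hind' : ∀ c : ℂ × ℂ →L[ℂ] ℂ, c ≠ 0 → c (deriv A₂ 0) = 0 → c (deriv A₁ 0) ≠ 0 :=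
    fun c hc h3 h4 => hind c hc h4 h3
  have hA' : ∀ U ∈ 𝓝 (0 : ℂ), ∀ᶠ z in 𝓝 (0 : ℂ × ℂ), z ∈ fullTransform q S →
      ∃ t ∈ U, A₂ t = z ∨ A₁ t = z := fun U hU => (hA U hU).mono fun z hz hzA => by
    obtain ⟨t, ht, h⟩ := hz hzA
    exact ⟨t, ht, h.symm⟩
  rcases eventually_zero_or_of_axis hq h₁.isArc h₂.isArc hA with h3 | h3
  · exact exists_transverse_aux h₁ h₂ hind hA hq h3 fun h4 => not_both_exceptional hA h0 h3 h4
  · exact exists_transverse_aux h₂ h₁ hind' hA' hq h3 fun h4 => not_both_exceptional hA h0 h4 h3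

lemma isRegularParam_axis {κ : ℂ → ℂ × ℂ} {c : ℂ × ℂ → ℂ} (hc : Tendsto c (𝓝 0) (𝓝 0))
    (hκ : IsRegular κ) {A : Set (ℂ × ℂ)}
    (h1 : ∀ t, κ t ∈ A) (h2 : ∀ z ∈ A, κ (c z) = z) :
    IsRegularParam A κ := by
  refine ⟨hκ.analyticAt, hκ.map_zero, hκ.deriv_ne_zero, le_antisymm
    (tendsto_nhdsWithin_iff.mpr ⟨hκ.isArc.tendsto, Eventually.of_forall h1⟩) fun V hV => ?_⟩
  have h3 : ∀ᶠ t in 𝓝 (0 : ℂ), κ t ∈ V := hV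
  refine mem_nhdsWithin_iff_eventually.mpr ?_
  filter_upwards [hc.eventually h3] with z hz hzA
  rwa [h2 z hzA] at hz

/-- Where the strict transform does not pass, its union with a smooth exceptional divisor is
smooth. -/
lemma isSmoothCurveAt_fullTransform {c : Bool} (hc : IsAxis c q)
    (h0 : ∀ i, (0 : ℂ × ℂ) ∉ strictTransform q (S.component i)) :
    IsSmoothCurveAt (fullTransform q S) := by
  have h1 : (0 : ℂ × ℂ) ∉ strictTransform q S.support := fun h => by
    obtain ⟨i, hi⟩ := mem_strictTransform_support.mp h
    exact h0 i hi
  have h2 : ∀ᶠ z in 𝓝 (0 : ℂ × ℂ), z ∉ strictTransform q S.support :=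
    isClosed_closure.isOpen_compl.mem_nhds h1
  have h3 : 𝓝[fullTransform q S] (0 : ℂ × ℂ) = 𝓝[{z | coord c z = 0}] 0 := by
    refine nhdsWithin_eq_iff_eventuallyEq.mpr ?_
    filter_upwards [h2, hc] with z h4 h5
    refine propext ⟨?_, fun h => Or.inr (h5.mpr h)⟩
    rintro (h | h)
    · exact absurd h h4
    · exact h5.mp h
  have key : ∃ κ, IsRegularParam {z | coord c z = 0} κ := by
    cases c with
    | false =>
      refine ⟨fun t => (0, t), isRegularParam_axis (continuous_snd.tendsto' 0 0 rfl)
        (isRegular_of_snd (analyticAt_const.prod analyticAt_id) rfl ?_) (fun t => rfl)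
        fun z hz => Prod.ext (Eq.symm hz) rfl⟩
      change deriv (fun t : ℂ => t) 0 ≠ 0
      simp
    | true =>
      refine ⟨fun t => (t, 0), isRegularParam_axis (continuous_fst.tendsto' 0 0 rfl)
        (isRegular_of_fst (analyticAt_id.prod analyticAt_const) rfl ?_) (fun t => rfl)
        fun z hz => Prod.ext rfl (Eq.symm hz)⟩
      change deriv (fun t : ℂ => t) 0 ≠ 0
      simp
  obtain ⟨κ, a, b, d, e⟩ := key
  exact ⟨κ, a, b, d, by rw [e, h3]⟩

end

/-! ### Curves with the same desingularization -/

section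

variable {S S' : Curve} {σ π : BlowUps} {p q : NearPoint}

lemma IsAxis.unique {c c' : Bool} (h : IsAxis c q) (h' : IsAxis c' q) : c = c' := by
  have key : ¬ (IsAxis false q ∧ IsAxis true q) := by
    rintro ⟨h1, h2⟩
    obtain ⟨t, ⟨h3, h4⟩, h5⟩ := (((tendsto_axis_fst.eventually h1).and
      (tendsto_axis_fst.eventually h2)).filter_mono nhdsWithin_le_nhds |>.and
      (self_mem_nhdsWithin (s := ({0}ᶜ : Set ℂ)))).exists
    exact h5 (h3.mp (h4.mpr rfl))
  cases c <;> cases c'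
  · rfl
  · exact absurd ⟨h, h'⟩ key
  · exact absurd ⟨h', h⟩ key
  · rfl

lemma OffExceptional.of_append {s : NearPoint} {γ : ℂ → ℂ × ℂ} (h : OffExceptional (p ++ s) γ) :
    OffExceptional s γ := by
  filter_upwards [h] with t ht h0
  exact ht (by rw [proj_append, h0, proj_zero])

/-- Branches of two curves through `q` that have the same infinitely near points. -/
structure IsCompanion (S S' : Curve) (q : NearPoint) (i : Fin S.k) (j : Fin S'.k)
    (γ γ' : ℂ → ℂ × ℂ) : Prop where
  isLift : IsLift (S.eqn i) q γ
  isLift' : IsLift (S'.eqn j) q γ'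
  sameOrders : SameOrders q γ γ'

/-- Where `S'` passes through `q`, its full transform is singular, hence so is that of `S`. The
exceptional divisor is smooth there, so the singularity comes from a component of `S` through `q`.
Both branches are transverse to the same axis, which gives equal orders. -/
lemma exists_isCompanion (hq : q ≠ []) (hnc : IsNormalCrossingAt (fullTransform q S))
    (hnc' : IsNormalCrossingAt (fullTransform q S'))
    (hs : IsSmoothCurveAt (fullTransform q S) → IsSmoothCurveAt (fullTransform q S'))
    {j : Fin S'.k} (h0 : (0 : ℂ × ℂ) ∈ strictTransform q (S'.component j)) :
    ∃ i γ γ', IsCompanion S S' q i j γ γ' := by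
  obtain ⟨c', γ', hc', hγ', ho', hord', hvan'⟩ := exists_transverse hq hnc' h0
  obtain ⟨i, hi⟩ : ∃ i, (0 : ℂ × ℂ) ∈ strictTransform q (S.component i) := by
    by_contra! h
    exact not_isSmoothCurveAt_fullTransform hq h0 (hs (isSmoothCurveAt_fullTransform hc' h))
  obtain ⟨c, γ, hc, hγ, ho, hord, hvan⟩ := exists_transverse hq hnc hi
  obtain rfl := hc.unique hc'
  exact ⟨i, γ, γ', ⟨hγ, ho, hvan i hi⟩, ⟨hγ', ho', hvan' j h0⟩,
    sameOrders_of_isAxis hc hγ.isArc hγ'.isArc hord hord'⟩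

/-- One of the two branches of the crossing is the exceptional divisor, so all components through
`q` vanish on the other one. -/
lemma eq_of_mem_strictTransform (hq : q ≠ []) (hnc : IsNormalCrossingAt (fullTransform q S))
    {i j : Fin S.k} (hi : (0 : ℂ × ℂ) ∈ strictTransform q (S.component i))
    (hj : (0 : ℂ × ℂ) ∈ strictTransform q (S.component j)) : i = j := by
  obtain ⟨c, γ, -, hγ, ho, -, hvan⟩ := exists_transverse hq hnc hi
  exact (IsLift.mk hγ ho (hvan i hi)).eq_of_vanish (hvan j hj)

lemma BlowUps.makesSmooth_of_exists_isLift
    (h : ∀ i p, p ∈ σ.points → (0 : ℂ × ℂ) ∈ strictTransform p (S.component i) →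
      ∃ γ, IsLift (S.eqn i) p γ) : σ.MakesSmooth S := by
  intro i p hp h0
  obtain ⟨γ, hγ⟩ := h i p hp h0
  exact ⟨γ, hγ.isRegularParam hγ.isEqn⟩

/-- Below a common point of the branches, one is regular if the other one is. -/
lemma IsCompanion.exists_isLift {s : NearPoint} {i : Fin S.k} {j : Fin S'.k} {γ γ' γ₀ : ℂ → ℂ × ℂ}
    (h : IsCompanion S S' (p ++ s) i j γ γ') (h₀ : IsLift (S.eqn i) p γ₀) :
    ∃ γ₁, IsLift (S'.eqn j) p γ₁ := by
  have ho := h.isLift.off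
  have ho' := h.isLift'.off
  obtain ⟨l, hl, he⟩ := h₀.exists_reparam h₀.isEqn (ho.of_append.isArc h.isLift.isRegular.isArc)
    (by filter_upwards [ho] with t ht; rwa [proj_append] at ht)
    (by filter_upwards [h.isLift.vanish] with t ht; rwa [proj_append] at ht)
  have h1 : mult (fun t => s.proj (γ t)) = 1 := by
    rw [← h₀.isRegular.mult_eq_one, mult, mult, ← hl.order (fun t => (γ₀ t).1),
      ← hl.order (fun t => (γ₀ t).2)]
    exact congrArg₂ min (analyticOrderAt_congr (he.mono fun t ht => congrArg Prod.fst ht))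
      (analyticOrderAt_congr (he.mono fun t ht => congrArg Prod.snd ht))
  rw [SameOrders.mult_eq h.isLift.isRegular h.isLift'.isRegular ho.of_append ho'.of_append
    (h.sameOrders.of_suffix (List.suffix_append p s))] at h1
  refine ⟨_, (ho'.of_append.isArc h.isLift'.isRegular.isArc).isRegular_of_mult h1, ?_, ?_⟩
  · filter_upwards [ho'] with t ht
    rwa [proj_append] at ht
  · filter_upwards [h.isLift'.vanish] with t ht
    rwa [proj_append] at ht

/-- If `p` is blown up by `π`, a companion at a point over `p` transfers regularity from `S` by
comparing multiplicities. Otherwise `p` lies over a point of `π`, where the branch of `S'` is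
already regular, and further blowing-ups keep it so. -/
lemma exists_isLift_of_isCompanion (hσ : σ.MakesSmooth S)
    (hπ : ∀ q ∈ π.points, ∀ j, (0 : ℂ × ℂ) ∈ strictTransform q (S'.component j) →
      ∃ i γ γ', IsCompanion S S' q i j γ γ') {j : Fin S'.k} (hp : p ∈ σ.points)
    (h0 : (0 : ℂ × ℂ) ∈ strictTransform p (S'.component j)) : ∃ γ, IsLift (S'.eqn j) p γ := by
  rcases π.mem_centers_or p with h | ⟨q, hq, hqp⟩
  · obtain ⟨_, hq, ⟨s, rfl⟩, h1⟩ := π.exists_point h h0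
    obtain ⟨i, γ, γ', hc⟩ := hπ _ hq j h1
    obtain ⟨γ₀, h₀⟩ := hσ.exists_isLift hp (strictTransform_mem_of_append hc.isLift.mem)
    exact hc.exists_isLift h₀
  · obtain ⟨i, γ, γ', hc⟩ := hπ q hq j (strictTransform_mem_of_prefix hqp h0)
    exact hc.isLift'.exists_lift_of_prefix (S'.analyticAt j) (S'.irreducible j) hqp h0

/-- Each active component of `S'` has a companion in `S`, and distinct components have distinct
companions. Differents and intersection multiplicities agree under this correspondence, so the sum
for `S'` is part of the sum for the companion in `S`. -/
lemma bound_le_of_isCompanion (hπ : ∀ q ∈ π.points, ∀ j,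
      (0 : ℂ × ℂ) ∈ strictTransform q (S'.component j) → ∃ i γ γ', IsCompanion S S' q i j γ γ')
    (huniq : ∀ q ∈ π.points, ∀ i j, (0 : ℂ × ℂ) ∈ strictTransform q (S'.component i) →
      (0 : ℂ × ℂ) ∈ strictTransform q (S'.component j) → i = j)
    {N : ℕ∞} (hN : ∀ i p γ, IsLift (S.eqn i) p γ → S.bound i (fun t => p.proj (γ t)) ≤ N)
    {j : Fin S'.k} {γ : ℂ → ℂ × ℂ} (h : IsLift (S'.eqn j) p γ) :
    S'.bound j (fun t => p.proj (γ t)) ≤ N := by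
  classical
  have h1 : ∀ j, S'.Active j → ∃ q i γ γ', q ∈ π.points ∧ IsCompanion S S' q i j γ γ' := by
    intro j hj
    obtain ⟨q, hq, h0⟩ := hj.exists_point π
    obtain ⟨i, γ, γ', hc⟩ := hπ q hq j h0
    exact ⟨q, i, γ, γ', hq, hc⟩
  have : Nonempty (Fin S.k) := ⟨⟨0, S.k_pos⟩⟩
  choose! Q ι Γ Γ' hQ hc using h1
  have hinc : ∀ l m, S'.Active l → S'.Active m → Q l <+: Q m → l = m := by
    intro l m hl hm hlm
    have h2 := π.eq_of_prefix (hQ l hl) (hQ m hm) hlm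
    exact huniq _ (hQ l hl) _ _ (hc l hl).isLift'.mem (h2 ▸ (hc m hm).isLift'.mem)
  -- A component of `S` passes only through comparable points, so a shared companion forces equal
  -- points of `π`, each of which carries only one component of `S'`.
  have hinj : ∀ l m, S'.Active l → S'.Active m → ι l = ι m → l = m := by
    intro l m hl hm hlm
    have h2 := (hc l hl).isLift
    rcases h2.isEqn.comparable h2.isRegular.isArc h2.off (hlm ▸ (hc m hm).isLift.mem) with h3 | h3
    · exact (hinc m l hm hl h3).symm
    · exact hinc l m hl hm h3
  have hj := h.active
  have hcj := hc j hj
  rw [hcj.isLift'.bound_eq h]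
  refine le_trans ?_ (hN _ _ _ hcj.isLift)
  rw [Curve.bound, Curve.bound, hcj.sameOrders.different_eq hcj.isLift.isRegular
    hcj.isLift'.isRegular hcj.isLift.off hcj.isLift'.off hcj.isLift.isEqn hcj.isLift'.isEqn]
  refine add_le_add le_rfl ?_
  calc ∑ l ∈ {l | S'.Active l ∧ l ≠ j}, analyticOrderAt (fun t => S'.eqn l ((Q j).proj (Γ' j t))) 0
      = ∑ l ∈ {l | S'.Active l ∧ l ≠ j},
          analyticOrderAt (fun t => S.eqn (ι l) ((Q j).proj (Γ j t))) 0 := by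
        refine Finset.sum_congr rfl fun l hl => ?_
        obtain ⟨-, hl, hlj⟩ := Finset.mem_filter.mp hl
        have hcl := hc l hl
        exact (SameOrders.order_eq (fun h2 => hlj (hinc l j hl hj h2))
          (fun h2 => hlj (hinc j l hj hl h2).symm) hcl.isLift.isRegular.isArc
          hcl.isLift'.isRegular.isArc hcj.isLift.isRegular.isArc hcj.isLift'.isRegular.isArc
          hcl.isLift.off hcl.isLift'.off hcl.sameOrders hcj.isLift.off hcj.isLift'.off
          hcj.sameOrders hcl.isLift.isEqn hcl.isLift'.isEqn).symm
    _ = ∑ i ∈ Finset.image ι {l | S'.Active l ∧ l ≠ j},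
          analyticOrderAt (fun t => S.eqn i ((Q j).proj (Γ j t))) 0 := by
        refine (Finset.sum_image (f := fun i => analyticOrderAt
          (fun t => S.eqn i ((Q j).proj (Γ j t))) 0) fun l hl m hm hlm => ?_).symm
        exact hinj l m (Finset.mem_filter.mp hl).2.1 (Finset.mem_filter.mp hm).2.1 hlm
    _ ≤ _ := by
        refine Finset.sum_le_sum_of_subset fun i hi => ?_
        obtain ⟨l, hl, rfl⟩ := Finset.mem_image.mp hi
        obtain ⟨-, hl, hlj⟩ := Finset.mem_filter.mp hl
        exact Finset.mem_filter.mpr ⟨Finset.mem_univ _, (hc l hl).isLift.active,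
          fun h2 => hlj (hinj l j hl hj h2)⟩

/-! ### Curves with normal crossings -/

/-- The different of a regular branch is zero. All other components run along `B`, hence there is at
most one; its equation divides `G`, which is a parameter on `A`, so the intersection multiplicity is
at most one. -/
lemma bound_le_one {A B : ℂ → ℂ × ℂ} {G : ℂ × ℂ → ℂ}
    (hAB : ∀ l, S.Active l → IsLift (S.eqn l) [] A ∨ IsLift (S.eqn l) [] B)
    (hG : AnalyticAt ℂ G 0) (hGA : ∀ᶠ t in 𝓝 (0 : ℂ), G (A t) = t)
    (hGB : ∀ᶠ t in 𝓝 (0 : ℂ), G (B t) = 0) {j : Fin S.k} (h : IsLift (S.eqn j) [] A) :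
    S.bound j (fun t => NearPoint.proj [] (A t)) ≤ 1 := by
  classical
  have hA := h.isRegular
  have hl : ∀ l, S.Active l → l ≠ j → IsLift (S.eqn l) [] B := fun l h1 h2 =>
    (hAB l h1).resolve_left fun h3 => h2 (h.eq_of_vanish h3.vanish).symm
  have hdiff : different (S.eqn j) (fun t => NearPoint.proj [] (A t)) = 0 := by
    have h1 := (hA.isArc.hasConductor_zero h.isEqn hA.deriv_ne_zero).different_add_one
    rw [hA.mult_eq_one, Nat.cast_zero] at h1
    exact ENat.add_left_injective_of_ne_top ENat.one_ne_top h1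
  have hord : ∀ l, S.Active l → l ≠ j →
      analyticOrderAt (fun t => S.eqn l (NearPoint.proj [] (A t))) 0 ≤ 1 := by
    intro l h1 h2
    obtain ⟨r, hr, he⟩ := (hl l h1 h2).isEqn.dvd G hG hGB
    have h3 : AnalyticAt ℂ (fun t => S.eqn l (A t)) 0 :=
      (S.analyticAt l).fun_comp_of_eq hA.analyticAt hA.map_zero
    have h4 : AnalyticAt ℂ (fun t => r (A t)) 0 := hr.fun_comp_of_eq hA.analyticAt hA.map_zero
    have h5 := analyticOrderAt_mul h3 h4
    have h6 : analyticOrderAt (fun t => G (A t)) 0 =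
        analyticOrderAt ((fun t => S.eqn l (A t)) * fun t => r (A t)) 0 :=
      analyticOrderAt_congr (hA.isArc.tendsto.eventually he)
    have h7 : analyticOrderAt (fun t => G (A t)) 0 = analyticOrderAt (fun t : ℂ => t) 0 :=
      analyticOrderAt_congr hGA
    rw [order_eq_one_of_deriv (a := fun t => t) analyticAt_id rfl (by simp), h6, h5] at h7
    exact le_self_add.trans h7.le
  rw [Curve.bound, hdiff, zero_add]
  refine (Finset.sum_le_card_nsmul _ _ 1 fun l hl => ?_).trans ?_
  · obtain ⟨-, h1, h2⟩ := Finset.mem_filter.mp hl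
    exact hord l h1 h2
  · rw [nsmul_one]
    have : Finset.card {l | S.Active l ∧ l ≠ j} ≤ 1 := by
      refine Finset.card_le_one.mpr fun l h1 m h2 => ?_
      obtain ⟨-, h1, h1'⟩ := Finset.mem_filter.mp h1
      obtain ⟨-, h2, h2'⟩ := Finset.mem_filter.mp h2
      exact (hl l h1 h1').eq_of_vanish (hl m h2 h2').vanish
    exact_mod_cast this

/-- If the equation vanished identically on neither arc, its zeros on both would be isolated, and
the covering would leave no points near the origin for the component. -/
lemma isLift_or_isLift {A B : ℂ → ℂ × ℂ} (hA : IsRegular A) (hB : IsRegular B)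
    (hcov : ∀ U ∈ 𝓝 (0 : ℂ), ∀ᶠ z in 𝓝 (0 : ℂ × ℂ), z ∈ fullTransform [] S →
      ∃ t ∈ U, A t = z ∨ B t = z) {j : Fin S.k} (hj : S.Active j) :
    IsLift (S.eqn j) [] A ∨ IsLift (S.eqn j) [] B := by
  suffices h : (∀ᶠ t in 𝓝 (0 : ℂ), S.eqn j (A t) = 0) ∨ ∀ᶠ t in 𝓝 (0 : ℂ), S.eqn j (B t) = 0 from
    h.imp (fun h => ⟨hA, hA.isArc.ne_zero, h⟩) (fun h => ⟨hB, hB.isArc.ne_zero, h⟩)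
  have ha : ∀ {A : ℂ → ℂ × ℂ}, IsRegular A → AnalyticAt ℂ (fun t => S.eqn j (A t)) 0 :=
    fun hA => (S.analyticAt j).fun_comp_of_eq hA.analyticAt hA.map_zero
  by_contra hne
  rw [not_or] at hne
  have h1 := eventually_nhdsWithin_iff.mp
    ((ha hA).eventually_eq_zero_or_eventually_ne_zero.resolve_left hne.1)
  have h2 := eventually_nhdsWithin_iff.mp
    ((ha hB).eventually_eq_zero_or_eventually_ne_zero.resolve_left hne.2)
  obtain ⟨z, hz, hz1, hz2⟩ := exists_of_mem_strictTransform hj (hcov _ (inter_mem h1 h2))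
  obtain ⟨t, ht, h3⟩ := hz (mem_fullTransform hz1 hz2)
  have ht0 : t ≠ 0 := by
    rintro rfl
    rw [hA.map_zero, hB.map_zero, or_self] at h3
    exact hz2 (by rw [← h3, proj_zero])
  rcases h3 with rfl | rfl
  · exact ht.1 ht0 hz1
  · exact ht.2 ht0 hz1

lemma IsNormalCrossingAt.exists_isLift (h : IsNormalCrossingAt (fullTransform [] S)) {j : Fin S.k}
    (hj : S.Active j) :
    ∃ A, IsLift (S.eqn j) [] A ∧ S.bound j (fun t => NearPoint.proj [] (A t)) ≤ 1 := by
  obtain ⟨A₁, A₂, G₁, G₂, h₁, h₂, -, hG₁, hG₂, he, hA⟩ := h.exists_axes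
  have hor := fun l (hl : S.Active l) => isLift_or_isLift h₁ h₂ hA hl
  rcases hor j hj with h3 | h3
  · exact ⟨A₁, h3, bound_le_one hor hG₂ (he.mono fun t ht => ht.2.2.1)
      (he.mono fun t ht => ht.2.2.2) h3⟩
  · exact ⟨A₂, h3, bound_le_one (fun l hl => (hor l hl).symm) hG₁ (he.mono fun t ht => ht.2.1)
      (he.mono fun t ht => ht.1) h3⟩

/-- By `IsLift.bound_eq` each component has a single finite bound, independent of the point and the
parametrization; the sum over the finitely many components majorizes them all. -/
lemma Curve.exists_bound_le (S : Curve) :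
    ∃ N : ℕ, ∀ i p γ, IsLift (S.eqn i) p γ → S.bound i (fun t => p.proj (γ t)) ≤ N := by
  have h : ∀ i, ∃ n : ℕ, ∀ p γ, IsLift (S.eqn i) p γ → S.bound i (fun t => p.proj (γ t)) ≤ n := by
    intro i
    by_cases hi : ∃ p γ, IsLift (S.eqn i) p γ
    · obtain ⟨p, γ, h⟩ := hi
      obtain ⟨n, hn⟩ := ENat.ne_top_iff_exists.mp h.bound_ne_top
      exact ⟨n, fun q γ' h' => by rw [h.bound_eq h', hn]⟩
    · exact ⟨0, fun p γ h => absurd ⟨p, γ, h⟩ hi⟩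
  choose n hn using h
  refine ⟨∑ i, n i, fun i p γ h => (hn i p γ h).trans ?_⟩
  exact_mod_cast Finset.single_le_sum (f := n) (fun _ _ => Nat.zero_le _) (Finset.mem_univ i)

end

end PlaneGerm

theorem mainTheorem7 (S : PlaneGerm.Curve) (σ : PlaneGerm.BlowUps) (hσ : σ.MakesSmooth S) :
    ∃ N : ℕ, σ.Lifts S N ∧
      ∀ S' ∈ PlaneGerm.sameDesingularization S, σ.MakesSmooth S' ∧ σ.Lifts S' N := by
  obtain ⟨N, hN⟩ := S.exists_bound_le
  have hle : (N : ℕ∞) ≤ (N + 1 : ℕ) := by exact_mod_cast N.le_succ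
  -- The additional one covers the case of a common desingularization without blowing-ups, where the
  -- bounds of `S'` are at most one whatever `N` is.
  refine ⟨N + 1, PlaneGerm.BlowUps.lifts_of_bound_le fun i p γ _ h => (hN i p γ h).trans hle, ?_⟩
  rintro S' ⟨π, hπ, hπ', hsing⟩
  -- The origin is a center exactly if `π` blows up anything. Only then is there an exceptional
  -- divisor through which `S'` can be compared with `S`.
  by_cases hnil : [] ∈ π.centers
  · have hne : ∀ q ∈ π.points, q ≠ [] := by
      rintro q hq rfl
      exact hq.1 hnil
    have hcomp : ∀ q ∈ π.points, ∀ j, (0 : ℂ × ℂ) ∈ PlaneGerm.strictTransform q (S'.component j) →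
        ∃ i γ γ', PlaneGerm.IsCompanion S S' q i j γ γ' := fun q hq j h0 =>
      PlaneGerm.exists_isCompanion (hne q hq) (hπ q hq) (hπ' q hq) (fun h => by
        by_contra h1
        have h2 : q ∈ π.singularities S' := ⟨hq, h1⟩
        rw [hsing] at h2
        exact h2.2 h) h0
    refine ⟨PlaneGerm.BlowUps.makesSmooth_of_exists_isLift fun j p hp h0 =>
      PlaneGerm.exists_isLift_of_isCompanion hσ hcomp hp h0,
      PlaneGerm.BlowUps.lifts_of_bound_le fun j p γ _ h => ?_⟩
    exact (PlaneGerm.bound_le_of_isCompanion hcomp (fun q hq i j =>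
      PlaneGerm.eq_of_mem_strictTransform (hne q hq) (hπ' q hq)) hN h).trans hle
  · have hnc := hπ' [] (π.nil_mem hnil)
    refine ⟨PlaneGerm.BlowUps.makesSmooth_of_exists_isLift fun j p hp h0 => ?_,
      PlaneGerm.BlowUps.lifts_of_bound_le fun j p γ _ h => ?_⟩
    · obtain ⟨A, hA, -⟩ := hnc.exists_isLift (PlaneGerm.Curve.active_of_mem h0)
      exact hA.exists_lift_of_prefix (S'.analyticAt j) (S'.irreducible j) List.nil_prefix h0
    · obtain ⟨A, hA, hb⟩ := hnc.exists_isLift h.active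
      rw [hA.bound_eq h]
      exact hb.trans (by exact_mod_cast Nat.le_add_left 1 N)
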